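/- Let $\Sigma$ be a finite set of propositions and $\Gamma = 2^\Sigma\setminus\{\emptyset\}$. A timed word is a nonempty finite sequence $(\sigma_1,\tau_1)\dots(\sigma_n,\tau_n)$ with $\sigma_i\in\Gamma$ and $0=\tau_1\le\tau_2\le\dots\le\tau_n$ real. Intervals $I$ are open, half-open or closed with end points in $\mathbb N\cup\{\infty\}$; $I$ is punctual if it is $[a,a]$ with $a\in\mathbb N$. *Automata.* A 1-clock alternating timed automaton (1-ATA) $(\Gamma,S,s_0,F,\delta)$ has a finite set $S$ of locations, $s_0\in S$, $F\subseteq S$, and a transition function $\delta$ from $S\times\Gamma$ to the formulas $\varphi::=\top\mid\bot\mid\varphi\wedge\varphi\mid\varphi\vee\varphi\mid s\mid g\mid x.\varphi$, where $s\in S$, $g$ is a clock constraint $x\in I$ or $x\notin I$, and $x.\varphi$ resets the clock $x$ to $0$. A run starts in the configuration $\{(s_0,0)\}$ and alternates time elapse with discrete transitions, in which every state $(s,\nu)$ of the configuration is replaced by the states of a disjunct, satisfied at $\nu$, of the disjunctive normal form of $\delta(s,a)$; a word is accepted if some run on it ends in a configuration all of whose locations are in $F$. A location occurring in a transition is bound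 if it occurs in the scope of a reset, and free otherwise. - The automaton is *conjunctive-disjunctive* (C⊕D) if $S$ is partitioned into $S_\wedge$ and $S_\vee$ such that for $s\in S_\wedge$ each $\delta(s,a)$ is a conjunction of clauses $q\vee\beta$, $g\vee\beta$ or $\beta$ with $q\in S_\wedge$, and for $s\in S_\vee$ each $\delta(s,a)$ is a disjunction of clauses $q\wedge\beta$, $g\wedge\beta$ or $\beta$ with $q\in S_\vee$; here $g$ is a clock constraint and $\beta$ is a positive Boolean combination (with true and false) of expressions $x.p$, $p\in S$. - It has *loop-free resets* (lfr) if $S$ is partitioned into islands, each with a header location, such that $s_0$ is a header, bound locations are headers, the free locations in $\delta(s,a)$ are non-header locations of the island of $s$, and, for some partial order, $x.q$ occurs in a transition from an island only if $q$ is strictly below the header of that island. - It is *partially ordered* (PO) if there is a partial order $\prec$ on $S$ such that every location occurring in $\delta(s,a)$ is $s$ or $\prec s$, and $s$ is not bound in $\delta(s,a)$. *Logics.* The formulas of $\mathsf{FRatMTL}$ are $\varphi::=a\,(a\in\Sigma)\mid true\mid\varphi\wedge\varphi\mid\neg\varphi\mid\varphi\,\mathsf U_I\varphi\mid\mathsf{FRat}_{I,\mathsf{re}}\varphi$,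 where $\mathsf{re}$ is a rational expression whose letters are formulas. Here $\rho,i\models\varphi\,\mathsf U_I\psi$ iff there is $j>i$ with $\rho,j\models\psi$, $\tau_j-\tau_i\in I$ and $\rho,k\models\varphi$ for all $i<k<j$; and $\rho,i\models\mathsf{FRat}_{I,\mathsf{re}}\varphi$ iff there is $j>i$ with $\rho,j\models\varphi$, $\tau_j-\tau_i\in I$ and a word $\psi_{i+1}\dots\psi_{j-1}\in L(\mathsf{re})$ with $\rho,k\models\psi_k$ for all $i<k<j$. The language of $\varphi$ is the set of timed words $\rho$ with $\rho,1\models\varphi$. $\mathsf{FSfrMTL}$ consists of the formulas in which every rational expression $\mathsf{re}$, with set of letters $\mathsf S$, is equivalent to a star-free expression: there is a star-free language $K$ over the alphabet $2^{\mathsf S}$ such that for all timed words and positions $i<j$, the word marking each position $k$, $i<k<j$, with the set of formulas of $\mathsf S$ true at $k$ belongs to $K$ iff some word $\psi_{i+1}\dots\psi_{j-1}\in L(\mathsf{re})$ has $\rho,k\models\psi_k$ for all $i<k<j$. $\mathsf{FRatMITL}$ and $\mathsf{FSfrMITL}$ are the restrictions of $\mathsf{FRatMTL}$ and $\mathsf{FSfrMTL}$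 to formulas without punctual intervals. **Theorem.** The following classes are expressively equivalent, i.e. each language of timed words over $\Sigma$ defined by a member of one is defined by a member of the other: 1. C⊕D 1-ATA with loop-free resets, and $\mathsf{FRatMTL}$; 2. partially ordered C⊕D 1-ATA, and $\mathsf{FSfrMTL}$; 3. C⊕D 1-ATA with loop-free resets in whose clock constraints no interval is punctual, and $\mathsf{FRatMITL}$; 4. partially ordered C⊕D 1-ATA in whose clock constraints no interval is punctual, and $\mathsf{FSfrMITL}$. -/

import Mathlib

namespace ATA

/-! ### Intervals, timed words -/

/-- Open, half-open and closed time intervals with end points in `ℕ ∪ {∞}`. -/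
inductive Interval where
  | cc (a b : ℕ)
  | co (a b : ℕ)
  | oc (a b : ℕ)
  | oo (a b : ℕ)
  | ci (a : ℕ)
  | oi (a : ℕ)

/-- The set of reals denoted by an interval: `[a,b]`, `[a,b)`, `(a,b]`, `(a,b)`, `[a,∞)`, `(a,∞)`. -/
def Interval.toSet : Interval → Set ℝ
  | .cc a b => Set.Icc (a : ℝ) (b : ℝ)
  | .co a b => Set.Ico (a : ℝ) (b : ℝ)
  | .oc a b => Set.Ioc (a : ℝ) (b : ℝ)
  | .oo a b => Set.Ioo (a : ℝ) (b : ℝ)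
  | .ci a => Set.Ici (a : ℝ)
  | .oi a => Set.Ioi (a : ℝ)

/-- An interval is punctual if it has the form `[a,a]`. -/
def Interval.Punctual (I : Interval) : Prop := ∃ a : ℕ, I = .cc a a

/-- The symbols read by the automata: nonempty sets of propositions. -/
abbrev Letter (P : Type*) := {A : Set P // A.Nonempty}

/-- Finite (nonempty, weakly monotonic) timed words over the propositions `P`, with first time
stamp `0`. The positions are `0, …, last`. -/
structure TimedWord (P : Type*) where
  last : ℕ
  letter : Fin (last + 1) → Letter P
  time : Fin (last + 1) → ℝ
  time_mono : Monotone time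
  time_zero : time 0 = 0

/-- The time that elapses before the symbol at a position is read. -/
def TimedWord.delay {P : Type*} (ρ : TimedWord P) (k : Fin (ρ.last + 1)) : ℝ :=
  Fin.cases (motive := fun _ => ℝ) (ρ.time 0)
    (fun m : Fin ρ.last => ρ.time m.succ - ρ.time m.castSucc) k

/-! ### One-clock alternating timed automata -/

/-- Clock constraints: `x ∈ I` and its negation `x ∉ I`. -/
inductive Guard where
  | mem (I : Interval)
  | notMem (I : Interval)

/-- The interval of a clock constraint. -/
def Guard.interval : Guard → Interval
  | .mem I => I
  | .notMem I => I

/-- A clock value satisfies a clock constraint. -/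
def Guard.Holds : Guard → ℝ → Prop
  | .mem I, v => v ∈ I.toSet
  | .notMem I, v => v ∉ I.toSet

/-- Transition formulas over the locations `S`; `reset φ` is the binding construct `x.φ`. -/
inductive TForm (S : Type) where
  | top
  | bot
  | conj (φ ψ : TForm S)
  | disj (φ ψ : TForm S)
  | loc (s : S)
  | guard (g : Guard)
  | reset (φ : TForm S)

namespace TForm

variable {S : Type}

/-- The sets of states that a state with clock value `v` may be replaced with: each is obtained by
choosing one satisfied disjunct of the disjunctive normal form of the formula. -/
def outcomes : TForm S → ℝ → Set (Set (S × ℝ))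
  | top, _ => {∅}
  | bot, _ => ∅
  | conj φ ψ, v => {M | ∃ A ∈ φ.outcomes v, ∃ B ∈ ψ.outcomes v, M = A ∪ B}
  | disj φ ψ, v => φ.outcomes v ∪ ψ.outcomes v
  | loc s, v => {{(s, v)}}
  | guard g, v => {M | M = ∅ ∧ g.Holds v}
  | reset φ, _ => φ.outcomes 0

/-- The locations that occur outside the scope of a reset. -/
def freeLocs : TForm S → Set S
  | top => ∅
  | bot => ∅
  | conj φ ψ => φ.freeLocs ∪ ψ.freeLocs
  | disj φ ψ => φ.freeLocs ∪ ψ.freeLocs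
  | loc s => {s}
  | guard _ => ∅
  | reset _ => ∅

/-- The locations that occur in the scope of a reset. -/
def boundLocs : TForm S → Set S
  | top => ∅
  | bot => ∅
  | conj φ ψ => φ.boundLocs ∪ ψ.boundLocs
  | disj φ ψ => φ.boundLocs ∪ ψ.boundLocs
  | loc _ => ∅
  | guard _ => ∅
  | reset φ => φ.freeLocs ∪ φ.boundLocs

/-- The clock constraints that occur in a formula. -/
def guards : TForm S → Set Guard
  | top => ∅
  | bot => ∅
  | conj φ ψ => φ.guards ∪ ψ.guards
  | disj φ ψ => φ.guards ∪ ψ.guards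
  | loc _ => ∅
  | guard g => {g}
  | reset φ => φ.guards

/-- Positive Boolean combinations of the atoms `x.q`. -/
inductive IsResetCombination : TForm S → Prop
  | top : IsResetCombination top
  | bot : IsResetCombination bot
  | atom (q : S) : IsResetCombination (reset (loc q))
  | conj {β γ : TForm S} :
      IsResetCombination β → IsResetCombination γ → IsResetCombination (conj β γ)
  | disj {β γ : TForm S} :
      IsResetCombination β → IsResetCombination γ → IsResetCombination (disj β γ)

/-- Conjunctions of clauses, each of which is `q' ∨ β`, `g ∨ β` or `β`, where `q' ∈ Q`, `g` is a
clock constraint and `β` is a positive Boolean combination of the atoms `x.q`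
(the part `∨ β` may be missing). -/
inductive IsConjunctive (Q : Set S) : TForm S → Prop
  | loc {q : S} : q ∈ Q → IsConjunctive Q (loc q)
  | locOr {q : S} {β : TForm S} :
      q ∈ Q → IsResetCombination β → IsConjunctive Q (disj (loc q) β)
  | guard (g : Guard) : IsConjunctive Q (guard g)
  | guardOr (g : Guard) {β : TForm S} :
      IsResetCombination β → IsConjunctive Q (disj (guard g) β)
  | resets {β : TForm S} : IsResetCombination β → IsConjunctive Q β
  | conj {φ ψ : TForm S} : IsConjunctive Q φ → IsConjunctive Q ψ → IsConjunctive Q (conj φ ψ)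

/-- Disjunctions of clauses, each of which is `q' ∧ β`, `g ∧ β` or `β`, where `q' ∈ Q`, `g` is a
clock constraint and `β` is a positive Boolean combination of the atoms `x.q`
(the part `∧ β` may be missing). -/
inductive IsDisjunctive (Q : Set S) : TForm S → Prop
  | loc {q : S} : q ∈ Q → IsDisjunctive Q (loc q)
  | locAnd {q : S} {β : TForm S} :
      q ∈ Q → IsResetCombination β → IsDisjunctive Q (conj (loc q) β)
  | guard (g : Guard) : IsDisjunctive Q (guard g)
  | guardAnd (g : Guard) {β : TForm S} :
      IsResetCombination β → IsDisjunctive Q (conj (guard g) β)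
  | resets {β : TForm S} : IsResetCombination β → IsDisjunctive Q β
  | disj {φ ψ : TForm S} : IsDisjunctive Q φ → IsDisjunctive Q ψ → IsDisjunctive Q (disj φ ψ)

end TForm

/-- One-clock alternating timed automata over the propositions `P`. -/
structure OneATA (P : Type*) where
  Loc : Type
  finite_loc : Finite Loc
  init : Loc
  final : Set Loc
  δ : Loc → Letter P → TForm Loc

namespace OneATA

variable {P : Type*} (A : OneATA P)

/-- A configuration is a set of states, i.e. of locations with a clock value. -/
abbrev Config := Set (A.Loc × ℝ)

variable {A} in
/-- The configuration reached after `t` time units. -/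
def Config.elapse (C : A.Config) (t : ℝ) : A.Config :=
  (fun p : A.Loc × ℝ => (p.1, p.2 + t)) '' C

/-- Discrete transitions: each state is replaced according to the transition function. -/
def Step (a : Letter P) (C C' : A.Config) : Prop :=
  ∃ M : A.Loc × ℝ → A.Config,
    (∀ p ∈ C, M p ∈ (A.δ p.1 a).outcomes p.2) ∧ C' = ⋃ p ∈ C, M p

/-- A run on a timed word: from `{(s₀, 0)}`, time elapses and discrete transitions alternate. -/
def IsRun (ρ : TimedWord P) (C : Fin (ρ.last + 2) → A.Config) : Prop :=
  C 0 = {(A.init, 0)} ∧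
    ∀ k : Fin (ρ.last + 1),
      A.Step (ρ.letter k) (Config.elapse (C k.castSucc) (ρ.delay k)) (C k.succ)

/-- The timed words with a run whose last configuration has final locations only. -/
def language : Set (TimedWord P) :=
  {ρ | ∃ C, A.IsRun ρ C ∧ ∀ p ∈ C (Fin.last _), p.1 ∈ A.final}

/-- The automaton is in normal form, with islands given by `header`: `header s` is the header
location of the island of `s`, the islands being the fibres of `header` and the reset locations
being the headers. The initial location is a reset location, resets lead to reset locations only,
and every other transition stays in its island and does not lead to the header. -/
structure IsNormalForm (header : A.Loc → A.Loc) : Prop where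
  header_header : ∀ s, header (header s) = header s
  header_init : header A.init = A.init
  bound : ∀ s a, ∀ q ∈ (A.δ s a).boundLocs, header q = q
  free : ∀ s a, ∀ p ∈ (A.δ s a).freeLocs, header p = header s ∧ p ≠ header s

/-- Loop-free resets: the automaton is in normal form, and every reset in an island leads to a
reset location that is strictly below the header of the island, for some partial order. -/
def HasLoopFreeResets : Prop :=
  ∃ (header : A.Loc → A.Loc) (lt : A.Loc → A.Loc → Prop),
    A.IsNormalForm header ∧ IsStrictOrder A.Loc lt ∧
      ∀ p a, ∀ q ∈ (A.δ p a).boundLocs, lt q (header p)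

/-- Partially ordered automata. -/
def IsPartiallyOrdered : Prop :=
  ∃ lt : A.Loc → A.Loc → Prop, IsStrictOrder A.Loc lt ∧
    ∀ s a,
      (∀ p ∈ (A.δ s a).freeLocs ∪ (A.δ s a).boundLocs, p = s ∨ lt p s) ∧
        s ∉ (A.δ s a).boundLocs

/-- Conjunctive-disjunctive automata: the locations are partitioned into conjunctive ones
(those in `Q`) and disjunctive ones. -/
def IsConjunctiveDisjunctive : Prop :=
  ∃ Q : Set A.Loc, ∀ s a,
    (s ∈ Q → (A.δ s a).IsConjunctive Q) ∧ (s ∉ Q → (A.δ s a).IsDisjunctive Qᶜ)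

/-- No punctual interval is used in a clock constraint. -/
def IsNonPunctual : Prop :=
  ∀ s a, ∀ g ∈ (A.δ s a).guards, ¬ g.interval.Punctual

end OneATA

/-! ### The logics -/

/-- Rational expressions over an alphabet. -/
inductive RatExp (α : Type*) where
  | eps
  | letter (a : α)
  | cat (r s : RatExp α)
  | alt (r s : RatExp α)
  | star (r : RatExp α)

namespace RatExp

variable {α : Type*}

/-- The language of a rational expression. -/
def lang : RatExp α → Language α
  | eps => 1
  | letter a => {[a]}
  | cat r s => r.lang * s.lang
  | alt r s => r.lang + s.lang
  | star r => KStar.kstar r.lang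

/-- The letters that occur in a rational expression. -/
def letters : RatExp α → Set α
  | eps => ∅
  | letter a => {a}
  | cat r s => r.letters ∪ s.letters
  | alt r s => r.letters ∪ s.letters
  | star r => r.letters

theorem sizeOf_lt_of_mem_letters [SizeOf α] (r : RatExp α) {a : α}
    (ha : a ∈ r.letters) : sizeOf a < sizeOf r := by
  induction r with
  | eps => exact absurd ha (Set.notMem_empty a)
  | letter b =>
    simp only [letters, Set.mem_singleton_iff] at ha
    subst ha
    simp
  | cat r s ihr ihs =>
    simp only [cat.sizeOf_spec]
    rcases ha with h | h
    · have := ihr h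
      omega
    · have := ihs h
      omega
  | alt r s ihr ihs =>
    simp only [alt.sizeOf_spec]
    rcases ha with h | h
    · have := ihr h
      omega
    · have := ihs h
      omega
  | star r ih =>
    simp only [star.sizeOf_spec]
    have := ih ha
    omega

theorem mem_letters_of_mem_lang (r : RatExp α) {w : List α}
    (hw : w ∈ r.lang) {a : α} (ha : a ∈ w) : a ∈ r.letters := by
  induction r generalizing w with
  | eps =>
    cases (Language.mem_one w).1 hw
    simp at ha
  | letter b =>
    cases (show w = [b] from hw)
    simpa [letters] using ha
  | cat r s ihr ihs =>
    obtain ⟨u, hu, v, hv, rfl⟩ := Language.mem_mul.1 hw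
    rcases List.mem_append.1 ha with h | h
    · exact Or.inl (ihr hu h)
    · exact Or.inr (ihs hv h)
  | alt r s ihr ihs =>
    rcases hw with h | h
    · exact Or.inl (ihr h ha)
    · exact Or.inr (ihs h ha)
  | star r ih =>
    obtain ⟨L, rfl, hL⟩ := Language.mem_kstar.1 hw
    obtain ⟨u, hu, hau⟩ := List.mem_flatten.1 ha
    exact ih (hL u hu) hau

end RatExp

/-- The formulas of metric temporal logic extended with the modality `FRat`:
`frat I re φ` is the formula `FRat_{I, re} φ`, where `re` is a rational expression over formulas. -/
inductive Formula (P : Type*) where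
  | atom (a : P)
  | tru
  | and (φ ψ : Formula P)
  | neg (φ : Formula P)
  | until (I : Interval) (φ ψ : Formula P)
  | frat (I : Interval) (re : RatExp (Formula P)) (φ : Formula P)

variable {P : Type*}

/-- `Sat ρ φ i`: the formula `φ` holds at the position `i` of `ρ`. For `FRat_{I, re} φ` there is a
later position `j` with `φ` and with its delay in `I`, and a word `w` in the language of `re`
such that the positions strictly between `i` and `j` satisfy the successive letters of `w`. -/
def Sat (ρ : TimedWord P) : Formula P → Fin (ρ.last + 1) → Prop
  | .atom a, i => a ∈ (ρ.letter i).1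
  | .tru, _ => True
  | .and φ ψ, i => Sat ρ φ i ∧ Sat ρ ψ i
  | .neg φ, i => ¬ Sat ρ φ i
  | .until I φ ψ, i =>
      ∃ j, i < j ∧ Sat ρ ψ j ∧ ρ.time j - ρ.time i ∈ I.toSet ∧
        ∀ k, i < k → k < j → Sat ρ φ k
  | .frat I re φ, i =>
      ∃ j, i < j ∧ Sat ρ φ j ∧ ρ.time j - ρ.time i ∈ I.toSet ∧
        ∃ (w : List (Formula P)) (_ : w ∈ re.lang) (_ : i.1 + 1 + w.length = j.1),
          ∀ (m : ℕ) (_ : m < w.length), Sat ρ w[m] ⟨i.1 + 1 + m, by omega⟩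
termination_by φ => sizeOf φ
decreasing_by
  all_goals simp_wf
  all_goals try omega
  have h := re.sizeOf_lt_of_mem_letters
    (re.mem_letters_of_mem_lang (by assumption) (List.getElem_mem (by assumption)))
  omega

/-- The timed words that satisfy a formula at their first position. -/
def Formula.language (φ : Formula P) : Set (TimedWord P) := {ρ | Sat ρ φ 0}

/-- `seg ρ S i j` is the word over the subsets of `S` that marks the positions strictly between
`i` and `j` with the formulas of `S` which hold there. -/
def seg (ρ : TimedWord P) (S : Set (Formula P)) (i j : Fin (ρ.last + 1)) : List (Set S) :=
  List.ofFn fun m : Fin (j.1 - i.1 - 1) =>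
    {ψ : S | Sat ρ ψ.1 ⟨i.1 + 1 + m.1, by omega⟩}

/-- The words obtained from a word of sets by choosing one element of each set. -/
def single {α : Type*} {S : Set α} (u : List (Set S)) : Language α :=
  {w | List.Forall₂ (fun a X => ∃ h : a ∈ S, (⟨a, h⟩ : S) ∈ X) w u}

/-- Star-free languages. -/
inductive IsStarFree {α : Type*} : Language α → Prop
  | zero : IsStarFree 0
  | one : IsStarFree 1
  | char (a : α) : IsStarFree {[a]}
  | add {K L : Language α} : IsStarFree K → IsStarFree L → IsStarFree (K + L)
  | mul {K L : Language α} : IsStarFree K → IsStarFree L → IsStarFree (K * L)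
  | compl {L : Language α} : IsStarFree L → IsStarFree Lᶜ

/-- A rational expression over a set `S` of formulas is equivalent to a star-free one over the
subsets of `S`: some star-free language contains the marking `seg ρ S i j` of a segment if and
only if the segment matches the rational expression. -/
def HasStarFreeEquivalent (re : RatExp (Formula P)) : Prop :=
  ∃ K : Language (Set re.letters), IsStarFree K ∧
    ∀ (ρ : TimedWord P) (i j : Fin (ρ.last + 1)), i < j →
      (seg ρ re.letters i j ∈ K ↔ ∃ w, w ∈ single (seg ρ re.letters i j) ∧ w ∈ re.lang)

/-- All rational expressions in the formula have star-free equivalents. -/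
inductive Formula.IsSfr : Formula P → Prop
  | atom (a : P) : IsSfr (.atom a)
  | tru : IsSfr .tru
  | and {φ ψ : Formula P} : IsSfr φ → IsSfr ψ → IsSfr (.and φ ψ)
  | neg {φ : Formula P} : IsSfr φ → IsSfr (.neg φ)
  | until {I : Interval} {φ ψ : Formula P} : IsSfr φ → IsSfr ψ → IsSfr (.until I φ ψ)
  | frat {I : Interval} {re : RatExp (Formula P)} {φ : Formula P} :
      HasStarFreeEquivalent re → (∀ ψ ∈ re.letters, IsSfr ψ) → IsSfr φ → IsSfr (.frat I re φ)

/-- All intervals in the formula are non-punctual. -/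
inductive Formula.IsNonPunctual : Formula P → Prop
  | atom (a : P) : IsNonPunctual (.atom a)
  | tru : IsNonPunctual .tru
  | and {φ ψ : Formula P} : IsNonPunctual φ → IsNonPunctual ψ → IsNonPunctual (.and φ ψ)
  | neg {φ : Formula P} : IsNonPunctual φ → IsNonPunctual (.neg φ)
  | until {I : Interval} {φ ψ : Formula P} :
      ¬ I.Punctual → IsNonPunctual φ → IsNonPunctual ψ → IsNonPunctual (.until I φ ψ)
  | frat {I : Interval} {re : RatExp (Formula P)} {φ : Formula P} :
      ¬ I.Punctual → (∀ ψ ∈ re.letters, IsNonPunctual ψ) → IsNonPunctual φ →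
        IsNonPunctual (.frat I re φ)

/-! ### The classes and their comparison -/

/-- Conjunctive-disjunctive automata with loop-free resets. -/
def CDLfr (P : Type*) : Set (OneATA P) :=
  {A | A.IsConjunctiveDisjunctive ∧ A.HasLoopFreeResets}

/-- Partially ordered conjunctive-disjunctive automata. -/
def CDPO (P : Type*) : Set (OneATA P) :=
  {A | A.IsConjunctiveDisjunctive ∧ A.IsPartiallyOrdered}

/-- Automata all of whose clock constraints are non-punctual. -/
def NPAutomata (P : Type*) : Set (OneATA P) := {A | A.IsNonPunctual}

/-- The logic `FRatMTL`. -/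
def FRatMTL (P : Type*) : Set (Formula P) := Set.univ

/-- The logic `FSfrMTL`. -/
def FSfrMTL (P : Type*) : Set (Formula P) := {φ | φ.IsSfr}

/-- The logic `FRatMITL`. -/
def FRatMITL (P : Type*) : Set (Formula P) := {φ | φ.IsNonPunctual}

/-- The logic `FSfrMITL`. -/
def FSfrMITL (P : Type*) : Set (Formula P) := {φ | φ.IsSfr ∧ φ.IsNonPunctual}

/-- A class of automata and a class of formulas are expressively equivalent: each language of the
one class is a language of the other. -/
def ExpressivelyEquivalent (F : Set (OneATA P)) (G : Set (Formula P)) : Prop :=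
  (∀ A ∈ F, ∃ φ ∈ G, A.language = φ.language) ∧
    (∀ φ ∈ G, ∃ A ∈ F, φ.language = A.language)

end ATA

/-! Both directions read acceptance as a truth value rather than through runs. Describe a state by
the time `t` of its last reset instead of its clock value. Then `t` does not change while time
elapses, and since a configuration accepts iff all its states do, acceptance of a suffix is computed
backwards by evaluating transition formulas (`OneATA.mem_language`).

From automata to formulas: a clause of a disjunctive location has at most one free location; the
rest is a clock constraint or a combination of resets that does not depend on `t`. So acceptance
means that a single path through free locations exists which ends in a final location at the end of
the word or leaves through a clause with a clock constraint (`accept_iff_path`). Once the reset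
locations are expressed by formulas, Kleene's theorem turns the paths into rational expressions over
step formulas, and the clock constraint becomes the interval of `FRat`. Conjunctive locations are
treated by duality, and induction along the order on resets reaches all locations
(`OneATA.exists_formula`). In a partially ordered automaton the only loops are self-loops, so only
single letters are starred, and such expressions are star-free.

From formulas to automata: in the position automaton of a rational expression each position is
entered with a fixed letter. Entering `p` is therefore a clause `p ∧ β`, where `β` resets into the
automaton of that letter, and reaching the target is a clause with the constraint `x ∈ I`. This is a
disjunctive island whose header, the initial state, is never re-entered. Negation dualises the whole
automaton (`Formula.Within.exists_represents`).

For partially ordered automata the stars must first be reduced to single letters. A star-free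
language is aperiodic and has finitely many left quotients, so its quotient automaton is
counter-free. As in the algebraic proof that star-free languages are definable in linear temporal
logic, induction on the number of states and then of letters applies
(`IsCounterFree.exists_definesAct`): a letter `c` that acts nontrivially has an image smaller than
the state set; the blocks between occurrences of `c` use a smaller alphabet, and the sequence of
blocks acts on that image. Each `c` announces its block by a nested `FRat` formula.

Punctuality is preserved because the complement of an interval in `[0, ∞)` is a union of
non-punctual intervals, except that `[0, 0]` may occur; it is expressed by comparing successive time
stamps. -/

namespace ATA

/-! ### Semantics at natural-number positions, matching, restricted formulas -/

variable {P : Type*}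

/-! ### Satisfaction at natural-number positions -/

/-- The position `n`, or the last position if there is no position `n`. -/
def TimedWord.pos (ρ : TimedWord P) (n : ℕ) : Fin (ρ.last + 1) := ⟨min n ρ.last, by omega⟩

/-- The time stamp of the position `n`. -/
def TimedWord.timeAt (ρ : TimedWord P) (n : ℕ) : ℝ := ρ.time (ρ.pos n)

/-- The symbol at the position `n`. -/
def TimedWord.letterAt (ρ : TimedWord P) (n : ℕ) : Letter P := ρ.letter (ρ.pos n)

theorem TimedWord.pos_val (ρ : TimedWord P) (i : Fin (ρ.last + 1)) : ρ.pos i.1 = i := by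
  ext
  simp only [TimedWord.pos]
  omega

theorem TimedWord.pos_eq (ρ : TimedWord P) {n : ℕ} (h : n < ρ.last + 1) : ρ.pos n = ⟨n, h⟩ := by
  ext
  simp only [TimedWord.pos]
  omega

theorem TimedWord.timeAt_mono (ρ : TimedWord P) : Monotone ρ.timeAt := by
  intro i j h
  apply ρ.time_mono
  simp only [TimedWord.pos, Fin.mk_le_mk]
  omega

theorem TimedWord.timeAt_zero (ρ : TimedWord P) : ρ.timeAt 0 = 0 := by
  rw [TimedWord.timeAt, ← ρ.time_zero]
  congr 1

/-- Satisfaction at the position `n`. -/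
def SatAt (ρ : TimedWord P) (φ : Formula P) (n : ℕ) : Prop := Sat ρ φ (ρ.pos n)

/-- The positions `i, …, j - 1` satisfy the successive letters of a word of the expression. -/
def Match (ρ : TimedWord P) (re : RatExp (Formula P)) (i j : ℕ) : Prop :=
  ∃ w ∈ re.lang, i + w.length = j ∧ ∀ (m : ℕ) (h : m < w.length), SatAt ρ w[m] (i + m)

section SatAt

variable {ρ : TimedWord P} {φ ψ : Formula P} {n : ℕ}

@[simp] theorem satAt_atom {a : P} : SatAt ρ (.atom a) n ↔ a ∈ (ρ.letterAt n).1 := by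
  simp only [SatAt, Sat, TimedWord.letterAt]

@[simp] theorem satAt_tru : SatAt ρ .tru n := by
  simp only [SatAt, Sat]

@[simp] theorem satAt_and : SatAt ρ (.and φ ψ) n ↔ SatAt ρ φ n ∧ SatAt ρ ψ n := by
  simp only [SatAt, Sat]

@[simp] theorem satAt_neg : SatAt ρ (.neg φ) n ↔ ¬ SatAt ρ φ n := by
  simp only [SatAt, Sat]

theorem satAt_until {I : Interval} (hn : n ≤ ρ.last) :
    SatAt ρ (.until I φ ψ) n ↔ ∃ j, n < j ∧ j ≤ ρ.last ∧ SatAt ρ ψ j ∧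
      ρ.timeAt j - ρ.timeAt n ∈ I.toSet ∧ ∀ k, n < k → k < j → SatAt ρ φ k := by
  simp only [SatAt, Sat, TimedWord.timeAt]
  constructor
  · rintro ⟨j, hj, h1, h2, h3⟩
    have hj' : n < j.1 := by
      have := Fin.lt_def.1 hj
      simp only [TimedWord.pos] at this
      omega
    refine ⟨j.1, hj', by omega, by rwa [ρ.pos_val], by rwa [ρ.pos_val], fun k hk hkj => ?_⟩
    apply h3 <;> simp only [TimedWord.pos, Fin.lt_def] <;> omega
  · rintro ⟨j, hj, hl, h1, h2, h3⟩
    refine ⟨ρ.pos j, ?_, h1, h2, fun k hk hkj => ?_⟩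
    · simp only [TimedWord.pos, Fin.lt_def]; omega
    · rw [← ρ.pos_val k]
      simp only [TimedWord.pos, Fin.lt_def] at hk hkj
      apply h3 <;> omega

theorem satAt_frat {I : Interval} {re : RatExp (Formula P)} (hn : n ≤ ρ.last) :
    SatAt ρ (.frat I re φ) n ↔ ∃ j, n < j ∧ j ≤ ρ.last ∧ SatAt ρ φ j ∧
      ρ.timeAt j - ρ.timeAt n ∈ I.toSet ∧ Match ρ re (n + 1) j := by
  simp only [SatAt, Sat, TimedWord.timeAt, Match]
  have hp : (ρ.pos n).1 = n := by simp only [TimedWord.pos]; omega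
  constructor
  · rintro ⟨j, hj, h1, h2, w, hw, hl, h3⟩
    have hj' : n < j.1 := by
      have := Fin.lt_def.1 hj
      omega
    refine ⟨j.1, hj', by omega, by rwa [ρ.pos_val], by rwa [ρ.pos_val], w, hw, by omega, ?_⟩
    intro m hm
    convert h3 m hm using 1
    rw [ρ.pos_eq (by omega)]
    simp [hp]
  · rintro ⟨j, hj, hl, h1, h2, w, hw, hl', h3⟩
    have hpj : (ρ.pos j).1 = j := by simp only [TimedWord.pos]; omega
    refine ⟨ρ.pos j, ?_, h1, h2, w, hw, by omega, ?_⟩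
    · simp only [Fin.lt_def]; omega
    · intro m hm
      convert h3 m hm using 1
      ext
      simp only [TimedWord.pos]
      omega

end SatAt

theorem Formula.mem_language {φ : Formula P} {ρ : TimedWord P} :
    ρ ∈ φ.language ↔ SatAt ρ φ 0 := by
  simp only [Formula.language, Set.mem_ofPred_eq, SatAt]
  rw [ρ.pos_eq (Nat.succ_pos _)]
  rfl

/-! ### Matching rational expressions -/

section Match

variable {ρ : TimedWord P} {r s : RatExp (Formula P)} {i j : ℕ}

@[simp] theorem match_eps : Match ρ .eps i j ↔ i = j := by
  simp only [Match, RatExp.lang]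
  constructor
  · rintro ⟨w, hw, hl, -⟩
    cases (Language.mem_one w).1 hw
    simpa using hl
  · rintro rfl
    exact ⟨[], (Language.mem_one _).2 rfl, rfl, fun m h => by simp at h⟩

@[simp] theorem match_letter {φ : Formula P} :
    Match ρ (.letter φ) i j ↔ i + 1 = j ∧ SatAt ρ φ i := by
  simp only [Match, RatExp.lang]
  constructor
  · rintro ⟨w, hw, hl, h⟩
    cases (show w = [φ] from hw)
    exact ⟨hl, h 0 (by simp)⟩
  · rintro ⟨rfl, h⟩
    refine ⟨[φ], rfl, rfl, fun m hm => ?_⟩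
    obtain rfl : m = 0 := by simpa using hm
    exact h

@[simp] theorem match_alt : Match ρ (.alt r s) i j ↔ Match ρ r i j ∨ Match ρ s i j := by
  simp only [Match, RatExp.lang, Language.mem_add]
  constructor
  · rintro ⟨w, hw | hw, h⟩
    · exact Or.inl ⟨w, hw, h⟩
    · exact Or.inr ⟨w, hw, h⟩
  · rintro (⟨w, hw, h⟩ | ⟨w, hw, h⟩)
    · exact ⟨w, Or.inl hw, h⟩
    · exact ⟨w, Or.inr hw, h⟩

theorem satAt_append {u v : List (Formula P)} :
    (∀ (m : ℕ) (h : m < (u ++ v).length), SatAt ρ (u ++ v)[m] (i + m)) ↔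
      (∀ (m : ℕ) (h : m < u.length), SatAt ρ u[m] (i + m)) ∧
        ∀ (m : ℕ) (h : m < v.length), SatAt ρ v[m] (i + u.length + m) := by
  constructor
  · intro h
    refine ⟨fun m hm => ?_, fun m hm => ?_⟩
    · have := h m (by simp; omega)
      rwa [List.getElem_append_left hm] at this
    · have := h (u.length + m) (by simp; omega)
      rw [List.getElem_append_right (by omega)] at this
      simpa [add_assoc] using this
  · rintro ⟨h1, h2⟩ m hm
    by_cases hu : m < u.length
    · rw [List.getElem_append_left hu]
      exact h1 m hu
    · rw [List.getElem_append_right (by omega)]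
      have := h2 (m - u.length) (by simp at hm; omega)
      convert this using 1
      omega

@[simp] theorem match_cat :
    Match ρ (.cat r s) i j ↔ ∃ k, Match ρ r i k ∧ Match ρ s k j := by
  simp only [Match, RatExp.lang]
  constructor
  · rintro ⟨w, hw, hl, h⟩
    obtain ⟨u, hu, v, hv, rfl⟩ := Language.mem_mul.1 hw
    rw [satAt_append] at h
    simp only [List.length_append] at hl
    exact ⟨i + u.length, ⟨u, hu, rfl, h.1⟩, v, hv, by omega, h.2⟩
  · rintro ⟨k, ⟨u, hu, rfl, h1⟩, v, hv, rfl, h2⟩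
    exact ⟨u ++ v, Language.mem_mul.2 ⟨u, hu, v, hv, rfl⟩, by simp; omega, satAt_append.2 ⟨h1, h2⟩⟩

theorem match_star :
    Match ρ (.star r) i j ↔ Relation.ReflTransGen (Match ρ r) i j := by
  constructor
  · rintro ⟨w, hw, hl, h⟩
    obtain ⟨L, rfl, hL⟩ := Language.mem_kstar.1 hw
    clear hw
    induction L generalizing i with
    | nil =>
      obtain rfl : i = j := by simpa using hl
      exact .refl
    | cons u L ih =>
      rw [List.flatten_cons] at hl
      simp only [List.flatten_cons] at h
      rw [satAt_append] at h
      simp only [List.length_append] at hl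
      exact .head ⟨u, hL u (by simp), rfl, h.1⟩
        (ih (fun y hy => hL y (by simp [hy])) (by omega) h.2)
  · intro h
    induction h using Relation.ReflTransGen.head_induction_on with
    | refl => exact ⟨[], Language.nil_mem_kstar _, rfl, fun m h => by simp at h⟩
    | head h1 _ ih =>
      obtain ⟨u, hu, rfl, h1⟩ := h1
      obtain ⟨v, hv, rfl, h2⟩ := ih
      refine ⟨u ++ v, ?_, by simp; omega, satAt_append.2 ⟨h1, h2⟩⟩
      obtain ⟨L, rfl, hL⟩ := Language.mem_kstar.1 hv
      refine Language.mem_kstar.2 ⟨u :: L, by simp, fun y hy => ?_⟩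
      rcases List.mem_cons.1 hy with rfl | hy
      · exact hu
      · exact hL y hy

theorem Match.le (h : Match ρ r i j) : i ≤ j := by
  obtain ⟨w, -, rfl, -⟩ := h
  omega

theorem match_star_letter {φ : Formula P} :
    Match ρ (.star (.letter φ)) i j ↔ i ≤ j ∧ ∀ k, i ≤ k → k < j → SatAt ρ φ k := by
  rw [match_star]
  constructor
  · intro h
    induction h using Relation.ReflTransGen.head_induction_on with
    | refl => exact ⟨le_rfl, fun k _ _ => by omega⟩
    | head h1 _ ih =>
      obtain ⟨rfl, h2⟩ := match_letter.1 h1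
      refine ⟨by omega, fun k hk hkj => ?_⟩
      rcases Nat.eq_or_lt_of_le hk with rfl | hk
      · exact h2
      · exact ih.2 k hk hkj
  · rintro ⟨hij, h⟩
    obtain ⟨d, rfl⟩ := Nat.exists_eq_add_of_le hij
    clear hij
    induction d with
    | zero => exact .refl
    | succ d ih =>
      refine .tail (ih fun k hk hkd => h k hk (by omega)) ?_
      exact match_letter.2 ⟨by omega, h _ (by omega) (by omega)⟩

/-- Because of this the automaton construction only has to treat `FRat`. The star is on a single
letter, so the partially ordered case is not disturbed. -/
theorem satAt_until_iff_frat {I : Interval} {φ ψ : Formula P} (hi : i ≤ ρ.last) :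
    SatAt ρ (.until I φ ψ) i ↔ SatAt ρ (.frat I (.star (.letter φ)) ψ) i := by
  rw [satAt_until hi, satAt_frat hi]
  simp only [match_star_letter]
  refine exists_congr fun j => and_congr_right fun hj => ?_
  refine and_congr_right fun _ => and_congr_right fun _ => and_congr_right fun _ => ?_
  exact ⟨fun h => ⟨hj, fun k hk => h k hk⟩, fun h k hk => h.2 k hk⟩

end Match

/-! ### Derived connectives -/

/-- The formula that holds nowhere. -/
def Formula.fls : Formula P := .neg .tru

/-- Finite disjunctions. -/
def Formula.orList : List (Formula P) → Formula P
  | [] => .fls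
  | φ :: l => .neg (.and (.neg φ) (.neg (Formula.orList l)))

/-- Finite conjunctions. -/
def Formula.andList : List (Formula P) → Formula P
  | [] => .tru
  | φ :: l => .and φ (Formula.andList l)

/-- Disjunctions over finite types. -/
noncomputable def Formula.iOr {ι : Type*} [Finite ι] (f : ι → Formula P) : Formula P :=
  have := Fintype.ofFinite ι
  .orList (Finset.univ.toList.map f)

/-- Conjunctions over finite types. -/
noncomputable def Formula.iAnd {ι : Type*} [Finite ι] (f : ι → Formula P) : Formula P :=
  have := Fintype.ofFinite ι
  .andList (Finset.univ.toList.map f)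

/-- There is no later position. -/
def Formula.atEnd : Formula P := .neg (.until (.ci 0) .tru .tru)

/-- There is no later position, or the next one has the same time stamp. -/
def Formula.nextSimul : Formula P := .neg (.until (.oi 0) .fls .tru)

section

variable {ρ : TimedWord P} {n : ℕ}

@[simp] theorem not_satAt_fls : ¬ SatAt ρ .fls n := by simp [Formula.fls]

@[simp] theorem satAt_orList {l : List (Formula P)} :
    SatAt ρ (.orList l) n ↔ ∃ φ ∈ l, SatAt ρ φ n := by
  induction l with
  | nil => simp [Formula.orList]
  | cons φ l ih => simp [Formula.orList, ih]; tauto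

@[simp] theorem satAt_andList {l : List (Formula P)} :
    SatAt ρ (.andList l) n ↔ ∀ φ ∈ l, SatAt ρ φ n := by
  induction l with
  | nil => simp [Formula.andList]
  | cons φ l ih => simp [Formula.andList, ih]

@[simp] theorem satAt_iOr {ι : Type*} [Finite ι] {f : ι → Formula P} :
    SatAt ρ (.iOr f) n ↔ ∃ i, SatAt ρ (f i) n := by
  simp [Formula.iOr]

@[simp] theorem satAt_iAnd {ι : Type*} [Finite ι] {f : ι → Formula P} :
    SatAt ρ (.iAnd f) n ↔ ∀ i, SatAt ρ (f i) n := by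
  simp [Formula.iAnd]

theorem satAt_atEnd (hn : n ≤ ρ.last) : SatAt ρ .atEnd n ↔ n = ρ.last := by
  rw [Formula.atEnd, satAt_neg, satAt_until hn]
  constructor
  · intro h
    by_contra hne
    refine h ⟨n + 1, by omega, by omega, satAt_tru, ?_, fun _ _ _ => satAt_tru⟩
    have := ρ.timeAt_mono (Nat.le_succ n)
    simpa [Interval.toSet] using this
  · rintro rfl ⟨j, h1, h2, -⟩
    omega

theorem satAt_nextSimul (hn : n < ρ.last) :
    SatAt ρ .nextSimul n ↔ ρ.timeAt (n + 1) = ρ.timeAt n := by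
  rw [Formula.nextSimul, satAt_neg, satAt_until hn.le]
  have hm := ρ.timeAt_mono (Nat.le_succ n)
  constructor
  · intro h
    by_contra hne
    refine h ⟨n + 1, by omega, by omega, satAt_tru, ?_, fun _ _ _ => by omega⟩
    simpa [Interval.toSet] using lt_of_le_of_ne hm (Ne.symm hne)
  · rintro h ⟨j, h1, h2, -, h3, h4⟩
    -- The left argument of the until holds nowhere, so only the immediate successor can be its
    -- witness.
    obtain rfl : j = n + 1 := by
      by_contra hne
      exact not_satAt_fls (h4 (n + 1) (by omega) (by omega))
    simp [Interval.toSet, h] at h3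

end

/-! ### Formulas with restricted intervals and expressions -/

/-- All intervals of the formula satisfy `J` and all its rational expressions satisfy `R`. -/
inductive Formula.Within (J : Interval → Prop) (R : RatExp (Formula P) → Prop) : Formula P → Prop
  | atom (a : P) : Within J R (.atom a)
  | tru : Within J R .tru
  | and {φ ψ : Formula P} : Within J R φ → Within J R ψ → Within J R (.and φ ψ)
  | neg {φ : Formula P} : Within J R φ → Within J R (.neg φ)
  | until {I : Interval} {φ ψ : Formula P} :
      J I → Within J R φ → Within J R ψ → Within J R (.until I φ ψ)
  | frat {I : Interval} {re : RatExp (Formula P)} {φ : Formula P} :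
      J I → R re → (∀ ψ ∈ re.letters, Within J R ψ) → Within J R φ → Within J R (.frat I re φ)

namespace Formula.Within

variable {J J' : Interval → Prop} {R R' : RatExp (Formula P) → Prop}

theorem fls : Formula.Within J R (.fls : Formula P) := .neg .tru

theorem orList {l : List (Formula P)} (h : ∀ φ ∈ l, φ.Within J R) :
    (Formula.orList l).Within J R := by
  induction l with
  | nil => exact fls
  | cons φ l ih =>
    exact .neg (.and (.neg (h φ (by simp))) (.neg (ih fun ψ hψ => h ψ (by simp [hψ]))))

theorem andList {l : List (Formula P)} (h : ∀ φ ∈ l, φ.Within J R) :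
    (Formula.andList l).Within J R := by
  induction l with
  | nil => exact .tru
  | cons φ l ih => exact .and (h φ (by simp)) (ih fun ψ hψ => h ψ (by simp [hψ]))

theorem iOr {ι : Type*} [Finite ι] {f : ι → Formula P} (h : ∀ i, (f i).Within J R) :
    (Formula.iOr f).Within J R :=
  orList fun φ hφ => by
    obtain ⟨i, -, rfl⟩ := List.mem_map.1 hφ
    exact h i

theorem iAnd {ι : Type*} [Finite ι] {f : ι → Formula P} (h : ∀ i, (f i).Within J R) :
    (Formula.iAnd f).Within J R :=
  andList fun φ hφ => by
    obtain ⟨i, -, rfl⟩ := List.mem_map.1 hφ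
    exact h i

theorem mono (hJ : ∀ I, J I → J' I) (hR : ∀ re, R re → R' re) {φ : Formula P}
    (h : φ.Within J R) : φ.Within J' R' := by
  induction h with
  | atom a => exact .atom a
  | tru => exact .tru
  | and _ _ h1 h2 => exact .and h1 h2
  | neg _ h => exact .neg h
  | frat hI hr _ _ h1 h2 => exact .frat (hJ _ hI) (hR _ hr) h1 h2
  | _ hI _ _ h1 h2 => exact .until (hJ _ hI) h1 h2

theorem isSfr (hR : ∀ re, R re → HasStarFreeEquivalent re) {φ : Formula P}
    (h : φ.Within J R) : φ.IsSfr := by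
  induction h with
  | atom a => exact .atom a
  | tru => exact .tru
  | and _ _ h1 h2 => exact .and h1 h2
  | neg _ h => exact .neg h
  | frat hI hr _ _ h1 h2 => exact .frat (hR _ hr) h1 h2
  | _ hI _ _ h1 h2 => exact .until h1 h2

theorem isNonPunctual (hJ : ∀ I, J I → ¬ I.Punctual) {φ : Formula P}
    (h : φ.Within J R) : φ.IsNonPunctual := by
  induction h with
  | atom a => exact .atom a
  | tru => exact .tru
  | and _ _ h1 h2 => exact .and h1 h2
  | neg _ h => exact .neg h
  | frat hI hr _ _ h1 h2 => exact .frat (hJ _ hI) h1 h2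
  | _ hI _ _ h1 h2 => exact .until (hJ _ hI) h1 h2

end Formula.Within

theorem Formula.IsNonPunctual.within {φ : Formula P} (h : φ.IsNonPunctual) :
    φ.Within (fun I => ¬ I.Punctual) fun _ => True := by
  induction h with
  | atom a => exact .atom a
  | tru => exact .tru
  | and _ _ h1 h2 => exact .and h1 h2
  | neg _ h => exact .neg h
  | frat hI _ _ h1 h2 => exact .frat hI trivial h1 h2
  | _ hI _ _ h1 h2 => exact .until hI h1 h2

theorem Formula.IsSfr.within {φ : Formula P} (h : φ.IsSfr) :
    φ.Within (fun _ => True) HasStarFreeEquivalent := by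
  induction h with
  | atom a => exact .atom a
  | tru => exact .tru
  | and _ _ h1 h2 => exact .and h1 h2
  | neg _ h => exact .neg h
  | frat hr _ _ h1 h2 => exact .frat trivial hr h1 h2
  | _ _ _ h1 h2 => exact .until trivial h1 h2

/-- Needed for the fourth class, where the two restrictions come from separate inductive predicates
but one induction must use both. -/
theorem Formula.Within.inter {J J' : Interval → Prop} {R R' : RatExp (Formula P) → Prop}
    {φ : Formula P} (h : φ.Within J R) (h' : φ.Within J' R') :
    φ.Within (fun I => J I ∧ J' I) fun re => R re ∧ R' re := by
  induction h with
  | atom a => exact .atom a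
  | tru => exact .tru
  | and _ _ h1 h2 =>
    cases h' with
    | and k1 k2 => exact .and (h1 k1) (h2 k2)
  | neg _ h =>
    cases h' with
    | neg k => exact .neg (h k)
  | frat hI hr _ _ h1 h2 =>
    cases h' with
    | frat k k' k1 k2 => exact .frat ⟨hI, k⟩ ⟨hr, k'⟩ (fun ψ hψ => h1 ψ hψ (k1 ψ hψ)) (h2 k2)
  | _ hI _ _ h1 h2 =>
    obtain _ | _ | _ | _ | ⟨k, k1, k2⟩ := h'
    exact .until ⟨hI, k⟩ (h1 k1) (h2 k2)

/-- The letters of an expression are formulas themselves, so the recursion is on size. With trivial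
parameters, `Within` then serves as the induction principle for arbitrary formulas. -/
theorem Formula.within_true (φ : Formula P) : φ.Within (fun _ => True) fun _ => True := by
  match φ with
  | .atom a => exact .atom a
  | .tru => exact .tru
  | .and φ ψ => exact .and φ.within_true ψ.within_true
  | .neg φ => exact .neg φ.within_true
  | .until I φ ψ => exact .until trivial φ.within_true ψ.within_true
  | .frat I re φ => exact .frat trivial trivial (fun ψ hψ => ψ.within_true) φ.within_true
termination_by sizeOf φ
decreasing_by
  all_goals simp_wf
  all_goals try omega
  have := re.sizeOf_lt_of_mem_letters hψ
  omega

theorem RatExp.finite_letters {α : Type*} (r : RatExp α) : r.letters.Finite := by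
  induction r with
  | eps => exact Set.finite_empty
  | letter a => exact Set.finite_singleton a
  | cat r s h1 h2 => exact h1.union h2
  | alt r s h1 h2 => exact h1.union h2
  | star r h => exact h

end ATA

/-! ### Star-free languages, aperiodicity and counter-free actions -/

namespace ATA

/-! ### Star-free languages -/

section StarFree

variable {α : Type*}

theorem IsStarFree.congr {K L : Language α} (hK : IsStarFree K) (h : ∀ w, w ∈ L ↔ w ∈ K) :
    IsStarFree L :=
  (Language.ext h : L = K) ▸ hK

theorem IsStarFree.top : IsStarFree (⊤ : Language α) := by
  refine IsStarFree.congr (IsStarFree.zero (α := α)).compl fun w => ?_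
  exact iff_of_true trivial (Language.notMem_zero w)

/-- The words of one letter, which belongs to `A`. -/
def letterLang (A : Set α) : Language α := {w | ∃ a ∈ A, w = [a]}

/-- The words all of whose letters belong to `A`. -/
def starLang (A : Set α) : Language α := {w | ∀ a ∈ w, a ∈ A}

theorem isStarFree_letterLang {A : Set α} (hA : A.Finite) :
    IsStarFree (letterLang A) := by
  induction A, hA using Set.Finite.induction_on with
  | empty =>
    refine IsStarFree.congr (IsStarFree.zero (α := α)) fun w => ?_
    exact iff_of_false (by rintro ⟨a, ha, -⟩; exact ha) (Language.notMem_zero w)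
  | @insert a s _ _ ih =>
    refine IsStarFree.congr ((IsStarFree.char a).add ih) fun w => ?_
    rw [Language.mem_add]
    constructor
    · rintro ⟨b, rfl | hb, rfl⟩
      · exact Or.inl rfl
      · exact Or.inr ⟨b, hb, rfl⟩
    · rintro (h | ⟨b, hb, rfl⟩)
      · exact ⟨a, Or.inl rfl, h⟩
      · exact ⟨b, Or.inr hb, rfl⟩

/-- The complement consists of the words with some letter outside `A`, which is a product of `⊤`, a
finite set of letters and `⊤`. -/
theorem isStarFree_starLang [Finite α] (A : Set α) :
    IsStarFree (starLang A) := by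
  refine IsStarFree.congr (((IsStarFree.top.mul (isStarFree_letterLang Aᶜ.toFinite)).mul IsStarFree.top).compl) fun w => ?_
  change (∀ a ∈ w, a ∈ A) ↔ ¬ w ∈ (⊤ * letterLang Aᶜ * ⊤ : Language α)
  rw [← not_iff_not, not_not]
  simp only [not_forall, exists_prop]
  constructor
  · rintro ⟨a, hw, ha⟩
    obtain ⟨u, v, rfl⟩ := List.append_of_mem hw
    exact Language.mem_mul.2 ⟨u ++ [a], Language.mem_mul.2 ⟨u, trivial, [a], ⟨a, ha, rfl⟩, rfl⟩,
      v, trivial, by simp⟩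
  · intro h
    obtain ⟨y, hy, v, -, rfl⟩ := Language.mem_mul.1 h
    obtain ⟨u, -, y', ⟨a, ha, rfl⟩, rfl⟩ := Language.mem_mul.1 hy
    exact ⟨a, by simp, ha⟩

end StarFree

/-! ### Expressions in which only single letters are iterated -/

/-- The star is applied to single letters only. -/
inductive RatExp.IsLetterStar {α : Type*} : RatExp α → Prop
  | eps : IsLetterStar .eps
  | letter (a : α) : IsLetterStar (.letter a)
  | cat {r s : RatExp α} : IsLetterStar r → IsLetterStar s → IsLetterStar (.cat r s)
  | alt {r s : RatExp α} : IsLetterStar r → IsLetterStar s → IsLetterStar (.alt r s)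
  | star (a : α) : IsLetterStar (.star (.letter a))

section

variable {α : Type*} {S : Set α}

theorem single_append_left {u : List (Set S)} {w₁ w₂ : List α} (h : w₁ ++ w₂ ∈ single u) :
    ∃ u₁ u₂, u = u₁ ++ u₂ ∧ w₁ ∈ single u₁ ∧ w₂ ∈ single u₂ := by
  refine ⟨u.take w₁.length, u.drop w₁.length, (List.take_append_drop _ _).symm, ?_, ?_⟩
  · exact (List.forall₂_take_append _ _ _ (List.Forall₂.flip h)).flip
  · exact (List.forall₂_drop_append _ _ _ (List.Forall₂.flip h)).flip

/-- The words of sets from which a word of the expression can be chosen. -/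
def RatExp.setLang (S : Set α) (r : RatExp α) : Language (Set S) :=
  {u | ∃ w, w ∈ single u ∧ w ∈ r.lang}

/-- Choosing one element of each set commutes with union and concatenation, and a starred letter `a`
becomes the words all of whose sets contain `a`. -/
theorem RatExp.IsLetterStar.isStarFree [Finite S] {r : RatExp α} (h : r.IsLetterStar) :
    IsStarFree (r.setLang S) := by
  induction h with
  | eps =>
    refine IsStarFree.congr (IsStarFree.one (α := Set S)) fun u => ?_
    rw [Language.mem_one]
    constructor
    · rintro ⟨w, hu, hw⟩
      cases (Language.mem_one w).1 hw
      exact List.forall₂_nil_left_iff.1 hu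
    · rintro rfl
      exact ⟨[], List.Forall₂.nil, (Language.mem_one _).2 rfl⟩
  | letter a =>
    refine IsStarFree.congr (isStarFree_letterLang (Set.toFinite {X : Set S | ∃ h : a ∈ S, ⟨a, h⟩ ∈ X})) fun u => ?_
    constructor
    · rintro ⟨w, hu, hw⟩
      cases (show w = [a] from hw)
      obtain ⟨X, u', h, h', rfl⟩ := List.forall₂_cons_left_iff.1 hu
      cases List.forall₂_nil_left_iff.1 h'
      exact ⟨X, h, rfl⟩
    · rintro ⟨X, h, rfl⟩
      exact ⟨[a], .cons h .nil, rfl⟩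
  | alt _ _ h1 h2 =>
    refine IsStarFree.congr (h1.add h2) fun u => ?_
    rw [Language.mem_add]
    constructor
    · rintro ⟨w, hu, hw | hw⟩
      · exact Or.inl ⟨w, hu, hw⟩
      · exact Or.inr ⟨w, hu, hw⟩
    · rintro (⟨w, hu, hw⟩ | ⟨w, hu, hw⟩)
      · exact ⟨w, hu, Or.inl hw⟩
      · exact ⟨w, hu, Or.inr hw⟩
  | cat _ _ h1 h2 =>
    refine IsStarFree.congr (h1.mul h2) fun u => ?_
    rw [Language.mem_mul]
    constructor
    · rintro ⟨w, hu, hw⟩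
      obtain ⟨w₁, hw₁, w₂, hw₂, rfl⟩ := Language.mem_mul.1 hw
      obtain ⟨u₁, u₂, rfl, k₁, k₂⟩ := single_append_left hu
      exact ⟨u₁, ⟨w₁, k₁, hw₁⟩, u₂, ⟨w₂, k₂, hw₂⟩, rfl⟩
    · rintro ⟨u₁, ⟨w₁, k₁, hw₁⟩, u₂, ⟨w₂, k₂, hw₂⟩, rfl⟩
      exact ⟨w₁ ++ w₂, List.rel_append k₁ k₂, Language.mem_mul.2 ⟨w₁, hw₁, w₂, hw₂, rfl⟩⟩
  | star a =>
    refine IsStarFree.congr (isStarFree_starLang {X : Set S | ∃ h : a ∈ S, ⟨a, h⟩ ∈ X}) fun u => ?_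
    constructor
    · rintro ⟨w, hu, hw⟩ X hX
      obtain ⟨L, rfl, hL⟩ := Language.mem_kstar.1 hw
      obtain ⟨n, hn, rfl⟩ := List.mem_iff_getElem.1 hX
      have hlen := hu.length_eq
      have hb := List.Forall₂.get hu (hlen ▸ hn) hn
      have : ∀ b ∈ L.flatten, b = a := by
        intro b hb
        obtain ⟨y, hy, hby⟩ := List.mem_flatten.1 hb
        cases (show y = [a] from hL y hy)
        simpa using hby
      have hna := this _ (List.getElem_mem (hlen ▸ hn))
      simp only [List.get_eq_getElem, hna] at hb
      exact hb
    · intro h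
      refine ⟨List.replicate u.length a, ?_, Language.mem_kstar.2
        ⟨List.replicate u.length [a], by simp, fun y hy => List.eq_of_mem_replicate hy⟩⟩
      induction u with
      | nil => exact .nil
      | cons X u ih =>
        exact .cons (h X (by simp)) (ih fun Y hY => h Y (List.mem_cons_of_mem _ hY))

end

theorem RatExp.IsLetterStar.hasStarFreeEquivalent {P : Type*} {r : RatExp (Formula P)}
    (h : r.IsLetterStar) : HasStarFreeEquivalent r :=
  have : Finite r.letters := r.finite_letters
  ⟨_, h.isStarFree, fun _ _ _ _ => Iff.rfl⟩

/-! ### Star-free languages are aperiodic -/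

/-- The `n`-th power of a word. -/
def wpow {α : Type*} (n : ℕ) (w : List α) : List α := (List.replicate n w).flatten

section

variable {α : Type*}

@[simp] theorem wpow_zero (w : List α) : wpow 0 w = [] := rfl

theorem wpow_succ (n : ℕ) (w : List α) : wpow (n + 1) w = w ++ wpow n w := by
  simp [wpow, List.replicate_succ]

theorem wpow_add (m n : ℕ) (w : List α) : wpow (m + n) w = wpow m w ++ wpow n w := by
  induction m with
  | zero => simp
  | succ m ih => rw [Nat.add_right_comm, wpow_succ, ih, wpow_succ, List.append_assoc]

theorem wpow_one (w : List α) : wpow 1 w = w := by simp [wpow]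

theorem length_wpow (n : ℕ) (w : List α) : (wpow n w).length = n * w.length := by
  simp [wpow]

/-- Large powers of a word can be exchanged. -/
def IsAperiodic (L : Language α) : Prop :=
  ∃ n, ∀ m, n ≤ m → ∀ x y z, x ++ wpow m y ++ z ∈ L ↔ x ++ wpow (m + 1) y ++ z ∈ L

/-- The cut between `u` and `v` falls into `x`, into one of the copies of `y`, or into `z`. -/
theorem append_wpow_eq_append {n : ℕ} {x y z u v : List α} (h : x ++ wpow n y ++ z = u ++ v) :
    (∃ x', x = u ++ x' ∧ v = x' ++ wpow n y ++ z) ∨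
    (∃ p q y₁ y₂, n = p + 1 + q ∧ y = y₁ ++ y₂ ∧ u = x ++ wpow p y ++ y₁ ∧
      v = y₂ ++ wpow q y ++ z) ∨
    ∃ z', u = x ++ wpow n y ++ z' ∧ z = z' ++ v := by
  induction n generalizing x with
  | zero =>
    simp only [wpow_zero, List.append_nil] at h ⊢
    rcases List.append_eq_append_iff.1 h with ⟨a, rfl, rfl⟩ | ⟨a, rfl, rfl⟩
    · exact Or.inr (Or.inr ⟨a, rfl, rfl⟩)
    · exact Or.inl ⟨a, rfl, rfl⟩
  | succ n ih =>
    rw [wpow_succ, ← List.append_assoc] at h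
    rcases ih h with ⟨x', hx, rfl⟩ | ⟨p, q, y₁, y₂, rfl, hy, rfl, rfl⟩ | ⟨z', rfl, rfl⟩
    · rcases List.append_eq_append_iff.1 hx with ⟨a, rfl, rfl⟩ | ⟨a, rfl, rfl⟩
      · exact Or.inr (Or.inl ⟨0, n, a, x', by omega, rfl, by simp, rfl⟩)
      · exact Or.inl ⟨a, rfl, by simp [wpow_succ]⟩
    · exact Or.inr (Or.inl ⟨p + 1, q, y₁, y₂, by omega, hy, by simp [wpow_succ], rfl⟩)
    · exact Or.inr (Or.inr ⟨z', by simp [wpow_succ], rfl⟩)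

/-- If the factorisation cuts a copy of `y`, with `p` copies before it and `q` after it, then the
threshold `n₁ + n₂ + 1` makes `p` or `q` large enough to change the power in that factor alone. -/
theorem IsAperiodic.mul {K L : Language α} (hK : IsAperiodic K) (hL : IsAperiodic L) :
    IsAperiodic (K * L) := by
  obtain ⟨n₁, h₁⟩ := hK
  obtain ⟨n₂, h₂⟩ := hL
  refine ⟨n₁ + n₂ + 1, fun m hm x y z => ⟨fun h => ?_, fun h => ?_⟩⟩
  · obtain ⟨u, hu, v, hv, huv⟩ := Language.mem_mul.1 h
    rcases append_wpow_eq_append huv.symm with ⟨x', rfl, rfl⟩ |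
      ⟨p, q, y₁, y₂, rfl, rfl, rfl, rfl⟩ | ⟨z', rfl, rfl⟩
    · exact Language.mem_mul.2 ⟨u, hu, _, (h₂ _ (by omega) _ _ _).1 hv, by simp⟩
    · by_cases hp : n₁ ≤ p
      · refine Language.mem_mul.2 ⟨_, (h₁ p hp _ _ _).1 hu, _, hv, ?_⟩
        rw [show p + 1 + q + 1 = (p + 1) + 1 + q by omega, wpow_add (p + 1 + 1), wpow_add (p + 1),
          wpow_one]
        simp
      · refine Language.mem_mul.2 ⟨_, hu, _, (h₂ q (by omega) _ _ _).1 hv, ?_⟩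
        rw [show p + 1 + q + 1 = p + 1 + (q + 1) by omega, wpow_add (p + 1), wpow_add p,
          wpow_one]
        simp
    · exact Language.mem_mul.2 ⟨_, (h₁ _ (by omega) _ _ _).1 hu, v, hv, by simp⟩
  · obtain ⟨u, hu, v, hv, huv⟩ := Language.mem_mul.1 h
    rcases append_wpow_eq_append huv.symm with ⟨x', rfl, rfl⟩ |
      ⟨p, q, y₁, y₂, hpq, rfl, rfl, rfl⟩ | ⟨z', rfl, rfl⟩
    · exact Language.mem_mul.2 ⟨u, hu, _, (h₂ _ (by omega) _ _ _).2 hv, by simp⟩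
    -- Here there are `m + 1` copies and one has to be removed, so a factor needs one copy more than
    -- its threshold.
    · by_cases hp : n₁ + 1 ≤ p
      · obtain ⟨p, rfl⟩ : ∃ p', p = p' + 1 := ⟨p - 1, by omega⟩
        refine Language.mem_mul.2 ⟨_, (h₁ p (by omega) _ _ _).2 hu, _, hv, ?_⟩
        rw [show m = p + 1 + q by omega, wpow_add (p + 1), wpow_add p, wpow_one]
        simp
      · obtain ⟨q, rfl⟩ : ∃ q', q = q' + 1 := ⟨q - 1, by omega⟩
        refine Language.mem_mul.2 ⟨_, hu, _, (h₂ q (by omega) _ _ _).2 hv, ?_⟩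
        rw [show m = p + 1 + q by omega, wpow_add (p + 1), wpow_add p, wpow_one]
        simp
    · exact Language.mem_mul.2 ⟨_, (h₁ _ (by omega) _ _ _).2 hu, v, hv, by simp⟩

theorem IsStarFree.isAperiodic {L : Language α} (h : IsStarFree L) : IsAperiodic L := by
  induction h with
  | zero => exact ⟨0, fun m _ x y z => iff_of_false (Language.notMem_zero _) (Language.notMem_zero _)⟩
  | one =>
    refine ⟨1, fun m hm x y z => ?_⟩
    obtain ⟨m, rfl⟩ : ∃ p', m = p' + 1 := ⟨m - 1, by omega⟩
    rw [Language.mem_one, Language.mem_one]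
    simp [wpow_succ]
  | char a =>
    -- From the exponent 2 on, a nonempty `y` makes both words longer than one letter.
    refine ⟨2, fun m hm x y z => ?_⟩
    change x ++ wpow m y ++ z = [a] ↔ x ++ wpow (m + 1) y ++ z = [a]
    rcases y with _ | ⟨b, y⟩
    · simp [wpow]
    · refine iff_of_false (fun h => ?_) fun h => ?_ <;>
      · have := congrArg List.length h
        simp only [List.length_append, length_wpow, List.length_cons, List.length_nil] at this
        nlinarith
  | add _ _ h₁ h₂ =>
    obtain ⟨n₁, h₁⟩ := h₁
    obtain ⟨n₂, h₂⟩ := h₂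
    refine ⟨n₁ + n₂, fun m hm x y z => ?_⟩
    rw [Language.mem_add, Language.mem_add, h₁ m (by omega), h₂ m (by omega)]
  | mul _ _ h₁ h₂ => exact h₁.mul h₂
  | compl _ h =>
    obtain ⟨n, h⟩ := h
    exact ⟨n, fun m hm x y z => not_congr (h m hm x y z)⟩

/-- The quotient of `K * L` by `x` is the quotient of `K` by `x` times `L`, together with the
quotients of `L` by those `v` for which `x = u ++ v` with `u ∈ K`. It is determined by one quotient
of `K` and a set of quotients of `L`. -/
theorem finite_range_leftQuotient_mul {K L : Language α} (hK : (Set.range K.leftQuotient).Finite)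
    (hL : (Set.range L.leftQuotient).Finite) : (Set.range (K * L).leftQuotient).Finite := by
  refine ((hK.prod hL.powerset).image
    fun p => (({w | w ∈ p.1 * L ∨ ∃ M ∈ p.2, w ∈ M} : Language α))).subset ?_
  rintro _ ⟨x, rfl⟩
  refine ⟨(K.leftQuotient x, L.leftQuotient '' {v | ∃ u ∈ K, u ++ v = x}),
    ⟨⟨x, rfl⟩, Set.image_subset_range _ _⟩, ?_⟩
  apply Language.ext
  intro w
  change (w ∈ K.leftQuotient x * L ∨ ∃ M ∈ L.leftQuotient '' {v | ∃ u ∈ K, u ++ v = x}, w ∈ M) ↔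
    x ++ w ∈ K * L
  rw [Language.mem_mul, Language.mem_mul]
  constructor
  · rintro (⟨u, hu, v, hv, rfl⟩ | ⟨_, ⟨v, ⟨u, hu, rfl⟩, rfl⟩, hw⟩)
    · exact ⟨x ++ u, hu, v, hv, by simp⟩
    · exact ⟨u, hu, v ++ w, hw, by simp⟩
  · rintro ⟨u, hu, v, hv, huv⟩
    rcases List.append_eq_append_iff.1 huv with ⟨a, rfl, rfl⟩ | ⟨a, rfl, rfl⟩
    · exact Or.inr ⟨_, ⟨a, ⟨u, hu, rfl⟩, rfl⟩, hv⟩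
    · exact Or.inl ⟨a, hu, v, hv, rfl⟩

theorem IsStarFree.finite_range_leftQuotient {L : Language α} (h : IsStarFree L) :
    (Set.range L.leftQuotient).Finite := by
  induction h with
  | zero =>
    refine (Set.finite_singleton (0 : Language α)).subset ?_
    rintro _ ⟨x, rfl⟩
    rfl
  | one =>
    refine (Set.toFinite ({0, 1} : Set (Language α))).subset ?_
    rintro _ ⟨x, rfl⟩
    rcases x with _ | ⟨a, x⟩
    · exact Or.inr rfl
    · left
      ext w
      exact iff_of_false (fun h => by simpa using (Language.mem_one _).1 h)
        (Language.notMem_zero w)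
  | char a =>
    refine (Set.toFinite ({0, 1, {[a]}} : Set (Language α))).subset ?_
    rintro _ ⟨x, rfl⟩
    rcases x with _ | ⟨b, x⟩
    · exact Or.inr (Or.inr rfl)
    · by_cases hb : b = a ∧ x = []
      · right; left
        obtain ⟨rfl, rfl⟩ := hb
        ext w
        rw [Language.mem_leftQuotient, Language.mem_one]
        change [b] ++ w = [b] ↔ _
        simp
      · left
        ext w
        refine iff_of_false (fun h => hb ?_) (Language.notMem_zero w)
        have h : (b :: x) ++ w = [a] := h
        simp at h
        exact ⟨h.1, h.2.1⟩
  | add _ _ h₁ h₂ =>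
    refine ((h₁.prod h₂).image fun p => p.1 + p.2).subset ?_
    rintro _ ⟨x, rfl⟩
    exact ⟨(_, _), ⟨⟨x, rfl⟩, ⟨x, rfl⟩⟩, rfl⟩
  | mul _ _ h₁ h₂ => exact finite_range_leftQuotient_mul h₁ h₂
  | compl _ h =>
    refine (h.image fun p => pᶜ).subset ?_
    rintro _ ⟨x, rfl⟩
    exact ⟨_, ⟨x, rfl⟩, rfl⟩

end

/-! ### Counter-free actions -/

section

variable {Q Δ : Type*}

/-- The action of words on states. -/
def actWord (act : Δ → Q → Q) : List Δ → Q → Q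
  | [], q => q
  | a :: w, q => actWord act w (act a q)

@[simp] theorem actWord_append (act : Δ → Q → Q) (u v : List Δ) (q : Q) :
    actWord act (u ++ v) q = actWord act v (actWord act u q) := by
  induction u generalizing q with
  | nil => rfl
  | cons a u ih => exact ih _

/-- No power of a word permutes states nontrivially. -/
def IsCounterFree (act : Δ → Q → Q) : Prop :=
  ∀ (w : List Δ) (n : ℕ) (q : Q), 0 < n → actWord act (wpow n w) q = q → actWord act w q = q

/-- The action on the left quotients of a language. -/
def quotientAct (L : Language Δ) (a : Δ) (q : Set.range L.leftQuotient) :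
    Set.range L.leftQuotient :=
  ⟨q.1.leftQuotient [a], by
    obtain ⟨_, x, rfl⟩ := q
    exact ⟨x ++ [a], Language.leftQuotient_append _ _ _⟩⟩

theorem coe_actWord_quotientAct (L : Language Δ) (w : List Δ) (q : Set.range L.leftQuotient) :
    (actWord (quotientAct L) w q).1 = q.1.leftQuotient w := by
  induction w generalizing q with
  | nil => rfl
  | cons a w ih =>
    rw [actWord, ih, quotientAct, ← Language.leftQuotient_append]
    rfl

/-- If `w ^ n` fixes `q`, then so does `w ^ (m * n)`, and `m * n` is beyond the threshold `m`. One
more factor `w` then changes nothing, so `w` fixes `q`. -/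
theorem IsAperiodic.isCounterFree {L : Language Δ} (h : IsAperiodic L) :
    IsCounterFree (quotientAct L) := by
  obtain ⟨m, h⟩ := h
  intro w n q hn hq
  have hpow : ∀ k, actWord (quotientAct L) (wpow (k * n) w) q = q := by
    intro k
    induction k with
    | zero => simp [actWord]
    | succ k ih => rw [Nat.succ_mul, wpow_add, actWord_append, ih, hq]
  have h1 := hpow m
  have h2 : actWord (quotientAct L) (wpow (m * n + 1) w) q = actWord (quotientAct L) w q := by
    rw [wpow_add, actWord_append, h1, wpow_one]
  rw [← h2]
  nth_rw 2 [← h1]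
  apply Subtype.ext
  rw [coe_actWord_quotientAct, coe_actWord_quotientAct]
  obtain ⟨_, x, rfl⟩ := q
  ext z
  have := h (m * n) (Nat.le_mul_of_pos_right m hn) x w z
  simp only [Language.mem_leftQuotient]
  rw [← List.append_assoc, ← List.append_assoc, this]

end

end ATA

/-! ### Letter-star expressions for star-free languages -/

namespace ATA

universe u v

variable {P : Type v}

/-! ### Finite alternatives of rational expressions -/

/-- Finite alternatives; the empty one is represented by a letter that holds nowhere. -/
def RatExp.altList : List (RatExp (Formula P)) → RatExp (Formula P)
  | [] => .letter .fls
  | r :: l => .alt r (RatExp.altList l)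

/-- Alternatives over finite types. -/
noncomputable def RatExp.iAlt {ι : Type*} [Finite ι] (r : ι → RatExp (Formula P)) :
    RatExp (Formula P) :=
  have := Fintype.ofFinite ι
  .altList (Finset.univ.toList.map r)

theorem match_altList {ρ : TimedWord P} {l : List (RatExp (Formula P))} {i j : ℕ} :
    Match ρ (.altList l) i j ↔ ∃ r ∈ l, Match ρ r i j := by
  induction l with
  | nil => simp [RatExp.altList]
  | cons r l ih => simp [RatExp.altList, ih]

@[simp] theorem match_iAlt {ρ : TimedWord P} {ι : Type*} [Finite ι]
    {r : ι → RatExp (Formula P)} {i j : ℕ} :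
    Match ρ (.iAlt r) i j ↔ ∃ k, Match ρ (r k) i j := by
  simp [RatExp.iAlt, match_altList]

/-- All letters of the expression satisfy `p`. -/
def RatExp.LettersIn {α : Type*} (p : α → Prop) (r : RatExp α) : Prop := ∀ a ∈ r.letters, p a

namespace RatExp.LettersIn

variable {α : Type*} {p : α → Prop} {r s : RatExp α}

theorem eps : RatExp.LettersIn p .eps := fun _ h => h.elim

theorem letter {a : α} (h : p a) : RatExp.LettersIn p (.letter a) := by
  rintro _ rfl
  exact h

theorem cat (hr : r.LettersIn p) (hs : s.LettersIn p) : (r.cat s).LettersIn p :=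
  fun a ha => ha.elim (hr a) (hs a)

theorem alt (hr : r.LettersIn p) (hs : s.LettersIn p) : (r.alt s).LettersIn p :=
  fun a ha => ha.elim (hr a) (hs a)

theorem star (hr : r.LettersIn p) : r.star.LettersIn p := hr

end RatExp.LettersIn

theorem RatExp.LettersIn.iAlt {p : Formula P → Prop} (hp : p .fls) {ι : Type*} [Finite ι]
    {r : ι → RatExp (Formula P)} (h : ∀ i, (r i).LettersIn p) : (RatExp.iAlt r).LettersIn p := by
  have : ∀ l : List (RatExp (Formula P)), (∀ r ∈ l, r.LettersIn p) →
      (RatExp.altList l).LettersIn p := by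
    intro l hl
    induction l with
    | nil => exact .letter hp
    | cons r l ih => exact .alt (hl r (by simp)) (ih fun s hs => hl s (by simp [hs]))
  refine this _ fun r hr => ?_
  obtain ⟨i, -, rfl⟩ := List.mem_map.1 hr
  exact h i

theorem RatExp.IsLetterStar.iAlt {ι : Type*} [Finite ι]
    {r : ι → RatExp (Formula P)} (h : ∀ i, (r i).IsLetterStar) : (RatExp.iAlt r).IsLetterStar := by
  have : ∀ l : List (RatExp (Formula P)), (∀ r ∈ l, r.IsLetterStar) →
      (RatExp.altList l).IsLetterStar := by
    intro l hl
    induction l with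
    | nil => exact .letter _
    | cons r l ih => exact .alt (hl r (by simp)) (ih fun s hs => hl s (by simp [hs]))
  refine this _ fun r hr => ?_
  obtain ⟨i, -, rfl⟩ := List.mem_map.1 hr
  exact h i

/-! ### Labelled segments -/

section Labelled

variable {Δ : Type*} {ρ : TimedWord P} {χ : Δ → Formula P}

/-- The positions from `i` on satisfy the formulas of the successive letters of a word. -/
def Labelled (ρ : TimedWord P) (χ : Δ → Formula P) : ℕ → List Δ → Prop
  | _, [] => True
  | i, a :: v => SatAt ρ (χ a) i ∧ Labelled ρ χ (i + 1) v

theorem labelled_append {i : ℕ} {u v : List Δ} :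
    Labelled ρ χ i (u ++ v) ↔ Labelled ρ χ i u ∧ Labelled ρ χ (i + u.length) v := by
  induction u generalizing i with
  | nil => simp [Labelled]
  | cons a u ih => simp [Labelled, ih, and_assoc, add_assoc, add_comm 1]

theorem labelled_map {Δ' : Type*} {g : Δ' → Δ} {i : ℕ} {u : List Δ'} :
    Labelled ρ χ i (u.map g) ↔ Labelled ρ (fun a => χ (g a)) i u := by
  induction u generalizing i with
  | nil => simp [Labelled]
  | cons a u ih => simp [Labelled, ih]

theorem labelled_iff_getElem {i : ℕ} {v : List Δ} :
    Labelled ρ χ i v ↔ ∀ (m : ℕ) (h : m < v.length), SatAt ρ (χ v[m]) (i + m) := by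
  induction v generalizing i with
  | nil => simp [Labelled]
  | cons a v ih =>
    rw [Labelled, ih]
    constructor
    · rintro ⟨h1, h2⟩ m hm
      rcases m with _ | m
      · exact h1
      · have := h2 m (by simpa using hm)
        rwa [add_right_comm, add_assoc] at this
    · intro h
      refine ⟨h 0 (by simp), fun m hm => ?_⟩
      have := h (m + 1) (by simpa using hm)
      rwa [add_right_comm, add_assoc]

/-- At most one of the formulas holds at each position. -/
def Exclusive (χ : Δ → Formula P) : Prop :=
  ∀ (ρ : TimedWord P) (k : ℕ), k ≤ ρ.last → ∀ a b, SatAt ρ (χ a) k → SatAt ρ (χ b) k → a = b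

theorem Exclusive.labelled_unique (hχ : Exclusive χ) {i : ℕ} {u v : List Δ}
    (hu : Labelled ρ χ i u) (hv : Labelled ρ χ i v) (hl : u.length = v.length)
    (hi : i + u.length ≤ ρ.last + 1) : u = v := by
  induction u generalizing i v with
  | nil => exact (List.length_eq_zero_iff.1 hl.symm).symm
  | cons a u ih =>
    rcases v with _ | ⟨b, v⟩
    · simp at hl
    · simp only [List.length_cons] at hl hi
      rw [hχ ρ i (by omega) a b hu.1 hv.1, ih hu.2 hv.2 (by omega) (by omega)]

end Labelled

/-! ### Counter-free actions define expressions in which only letters are iterated -/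

/-- Only letters are iterated, and all letters are such formulas, with intervals in `J`. -/
def RatExp.Good (J : Interval → Prop) (r : RatExp (Formula P)) : Prop :=
  r.IsLetterStar ∧ r.LettersIn (Formula.Within J RatExp.IsLetterStar)

namespace RatExp.Good

variable {J : Interval → Prop}

theorem letter {φ : Formula P} (h : φ.Within J RatExp.IsLetterStar) : RatExp.Good J (.letter φ) :=
  ⟨.letter φ, .letter h⟩

theorem cat {r s : RatExp (Formula P)} (hr : r.Good J) (hs : s.Good J) : (r.cat s).Good J :=
  ⟨hr.1.cat hs.1, hr.2.cat hs.2⟩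

theorem alt {r s : RatExp (Formula P)} (hr : r.Good J) (hs : s.Good J) : (r.alt s).Good J :=
  ⟨hr.1.alt hs.1, hr.2.alt hs.2⟩

theorem iAlt {ι : Type*} [Finite ι] {r : ι → RatExp (Formula P)} (h : ∀ i, (r i).Good J) :
    (RatExp.iAlt r).Good J :=
  ⟨.iAlt fun i => (h i).1, .iAlt .fls fun i => (h i).2⟩

end RatExp.Good

/-- The expression matches the segments that are labelled with a word acting as `f`. -/
def RatExp.DefinesAct {Q Δ : Type*} (act : Δ → Q → Q) (χ : Δ → Formula P) (f : Q → Q)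
    (r : RatExp (Formula P)) : Prop :=
  ∀ (ρ : TimedWord P) (i j : ℕ), j ≤ ρ.last →
    (Match ρ r i j ↔ ∃ v, i + v.length = j ∧ actWord act v = f ∧ Labelled ρ χ i v)

/-- Base of the induction: every word acts as the identity, so the segments in question are those
labelled by any letters at all, or there are none. -/
theorem definesAct_of_trivial {Q Δ : Type*} [Finite Δ] {J : Interval → Prop} {act : Δ → Q → Q}
    (hact : ∀ a, act a = id) {χ : Δ → Formula P}
    (hχ : ∀ a, (χ a).Within J RatExp.IsLetterStar) (f : Q → Q) :
    ∃ r : RatExp (Formula P), r.Good J ∧ r.DefinesAct act χ f := by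
  have hid : ∀ v, actWord act v = id := by
    intro v
    induction v with
    | nil => rfl
    | cons a v ih =>
      funext q
      rw [actWord, ih, hact]
      rfl
  by_cases hf : f = id
  · refine ⟨.star (.letter (.iOr χ)), ⟨.star _, .star (.letter (.iOr hχ))⟩, fun ρ i j _ => ?_⟩
    rw [match_star_letter]
    constructor
    · rintro ⟨hij, h⟩
      obtain ⟨d, rfl⟩ := Nat.exists_eq_add_of_le hij
      clear hij
      induction d generalizing i with
      | zero => exact ⟨[], rfl, by rw [hf, hid], trivial⟩
      | succ d ih =>
        obtain ⟨v, hv, -, h2⟩ := ih (i + 1) (by omega) fun k hk hkd => h k (by omega) (by omega)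
        obtain ⟨a, ha⟩ := satAt_iOr.1 (h i (by omega) (by omega))
        exact ⟨a :: v, by simp; omega, by rw [hf, hid], ha, h2⟩
    · rintro ⟨v, rfl, -, h⟩
      refine ⟨by omega, fun k hk hkv => satAt_iOr.2 ?_⟩
      have := labelled_iff_getElem.1 h (k - i) (by omega)
      exact ⟨_, by rwa [Nat.add_sub_cancel' hk] at this⟩
  · refine ⟨.letter .fls, .letter .fls, fun ρ i j _ => ?_⟩
    refine iff_of_false (by simp) ?_
    rintro ⟨v, -, h, -⟩
    exact hf (by rw [← h, hid])

section Block

variable {Q Δ : Type*} {act : Δ → Q → Q} {χ : Δ → Formula P} {c : Δ}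

variable (act c) in
/-- The functions by which the words without the letter `c` act. -/
abbrev BlockFun := {t : Q → Q // ∃ u : List {a // a ≠ c}, actWord act (u.map (·.1)) = t}

/-- The action of the blocks that end with `c` on the image of `c`; the symbol `none` stands for a
letter inside of a block. -/
def blockAct (act : Δ → Q → Q) (c : Δ) :
    Option (BlockFun act c) → Set.range (act c) → Set.range (act c)
  | none, q => q
  | some t, q => ⟨act c (t.1 q.1), _, rfl⟩

/-- `some t` labels the occurrences of `c` before a block without `c` that acts as `t`,
and `none` labels the occurrences of all other letters. -/
noncomputable def blockLabel [Finite Δ] (χ : Δ → Formula P) (c : Δ)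
    (r : (Q → Q) → RatExp (Formula P)) : Option (BlockFun act c) → Formula P
  | none => .iOr fun a : {a // a ≠ c} => χ a
  | some t => .and (χ c) (.frat (.ci 0) (r t.1) (χ c))

/-- Replacing `some t` by a word acting as `t` followed by `c`, and `none` by the empty word, gives
a word with the same action. Hence the block action inherits counter-freeness. -/
theorem actWord_blockAct (w : List (Option (BlockFun act c))) :
    ∃ v : List Δ, ∀ q, (actWord (blockAct act c) w q).1 = actWord act v q.1 := by
  induction w with
  | nil => exact ⟨[], fun q => rfl⟩
  | cons t w ih =>
    obtain ⟨v, hv⟩ := ih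
    rcases t with _ | ⟨_, u, rfl⟩
    · exact ⟨v, fun q => hv q⟩
    · refine ⟨u.map (·.1) ++ [c] ++ v, fun q => ?_⟩
      rw [actWord, hv]
      simp [blockAct, actWord]

theorem IsCounterFree.blockAct (h : IsCounterFree act) : IsCounterFree (blockAct act c) := by
  intro w n q hn hq
  obtain ⟨v, hv⟩ := actWord_blockAct w
  have hpow : ∀ n q, (actWord (ATA.blockAct act c) (wpow n w) q).1
      = actWord act (wpow n v) q.1 := by
    intro n
    induction n with
    | zero => exact fun _ => rfl
    | succ n ih =>
      intro q
      rw [wpow_succ, wpow_succ, actWord_append, actWord_append, ih, hv]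
  apply Subtype.ext
  rw [hv]
  exact h v n q.1 hn (by rw [← hpow, hq])

/-- Otherwise `c` permutes the finite set of states, so some positive power of it is the identity,
and counter-freeness makes `c` itself the identity. -/
theorem IsCounterFree.card_range_lt [Finite Q] (h : IsCounterFree act) (hc : act c ≠ id) :
    Nat.card (Set.range (act c)) < Nat.card Q := by
  by_contra hlt
  apply hc
  have hsurj : Function.Surjective (act c) := by
    rw [← Set.range_eq_univ]
    apply Set.eq_of_subset_of_ncard_le (Set.subset_univ _)
    rw [Set.ncard_univ]
    exact not_lt.1 hlt
  have hinj := Finite.injective_iff_surjective.2 hsurj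
  obtain ⟨n, hn, hid⟩ := (isOfFinOrder_of_finite (Equiv.ofBijective _ ⟨hinj, hsurj⟩)).exists_pow_eq_one
  have hpow : ∀ n q, actWord act (wpow n [c]) q
      = ((Equiv.ofBijective _ ⟨hinj, hsurj⟩) ^ n : Equiv.Perm Q) q := by
    intro n
    induction n with
    | zero => exact fun q => rfl
    | succ n ih =>
      intro q
      rw [wpow_succ, actWord_append, ih, pow_succ]
      rfl
  funext q
  exact h [c] n q hn (by rw [hpow, hid]; rfl)

theorem actWord_coe (u : List {a // a ≠ c}) :
    actWord (fun a : {a // a ≠ c} => act a) u = actWord act (u.map (·.1)) := by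
  funext q
  induction u generalizing q with
  | nil => rfl
  | cons a u ih => exact ih _

theorem exists_last_occurrence {v : List Δ} (h : c ∈ v) :
    ∃ v₁ v₂, v = v₁ ++ c :: v₂ ∧ c ∉ v₂ := by
  obtain ⟨u, w, hv, hu⟩ := List.eq_append_cons_of_mem (List.mem_reverse.2 h)
  refine ⟨w.reverse, u.reverse, ?_, by simpa using hu⟩
  simpa using congrArg List.reverse hv

variable {r : (Q → Q) → RatExp (Formula P)} {ρ : TimedWord P}

/-- A block contains no `c`, so both blocks end at the first `c` from `k` on; between them the
letters are unique by exclusivity. -/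
theorem block_unique (hχ : Exclusive χ) {k j j' : ℕ} {u u' : List {a // a ≠ c}}
    (hu : Labelled ρ χ k (u.map (·.1))) (hu' : Labelled ρ χ k (u'.map (·.1)))
    (hj : k + u.length = j) (hj' : k + u'.length = j') (hjl : j ≤ ρ.last) (hjl' : j' ≤ ρ.last)
    (hc : SatAt ρ (χ c) j) (hc' : SatAt ρ (χ c) j') : u = u' := by
  have key : ∀ {j j' : ℕ} {u u' : List {a // a ≠ c}}, Labelled ρ χ k (u'.map (·.1)) →
      k + u.length = j → k + u'.length = j' → j ≤ ρ.last → SatAt ρ (χ c) j → ¬ j < j' := by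
    intro j j' u u' hu' hj hj' hjl hc hlt
    have := labelled_iff_getElem.1 hu' (j - k) (by simp; omega)
    rw [Nat.add_sub_cancel' (by omega)] at this
    have h := hχ ρ j hjl _ _ this hc
    rw [List.getElem_map] at h
    exact (u'[j - k]'(by omega)).2 h
  have hjj : j = j' :=
    le_antisymm (not_lt.1 (key hu hj' hj hjl' hc')) (not_lt.1 (key hu' hj hj' hjl hc))
  have := hχ.labelled_unique hu hu' (by simp; omega) (by simp; omega)
  exact List.map_injective_iff.2 Subtype.val_injective this

variable [Finite Δ]

/-- The interval `[0, ∞)` imposes nothing, so the label just looks ahead to the `c` that closes the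
block. It says something about the block only if such a `c` follows, which is why the lemmas below
assume `c` at the end of the segment. -/
theorem satAt_blockLabel_some
    (hr : ∀ f, (r f).DefinesAct (fun a : {a // a ≠ c} => act a) (fun a => χ a) f)
    {t : BlockFun act c} {k : ℕ} (hk : k ≤ ρ.last) :
    SatAt ρ (blockLabel χ c r (some t)) k ↔ SatAt ρ (χ c) k ∧ ∃ u : List {a // a ≠ c},
      actWord act (u.map (·.1)) = t.1 ∧ k + 1 + u.length ≤ ρ.last ∧
        Labelled ρ χ (k + 1) (u.map (·.1)) ∧ SatAt ρ (χ c) (k + 1 + u.length) := by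
  rw [blockLabel, satAt_and, satAt_frat hk]
  refine and_congr_right fun _ => ?_
  constructor
  · rintro ⟨j, hj, hjl, hc, -, hm⟩
    obtain ⟨u, rfl, hu, hl⟩ := (hr _ ρ _ _ hjl).1 hm
    exact ⟨u, by rw [← hu, actWord_coe], hjl, labelled_map.2 hl, hc⟩
  · rintro ⟨u, hu, hjl, hl, hc⟩
    refine ⟨_, by omega, hjl, hc, ?_, (hr _ ρ _ _ hjl).2 ⟨u, rfl, ?_, labelled_map.1 hl⟩⟩
    · simpa [Interval.toSet] using ρ.timeAt_mono (show k ≤ k + 1 + u.length by omega)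
    · rw [actWord_coe, hu]

/-- The block after an occurrence of `c` is unique, hence so is the function by which it acts.
Exclusivity is what allows the induction hypothesis to be applied to the block labels. -/
theorem exclusive_blockLabel (hχ : Exclusive χ)
    (hr : ∀ f, (r f).DefinesAct (fun a : {a // a ≠ c} => act a) (fun a => χ a) f) :
    Exclusive (blockLabel (act := act) χ c r) := by
  have hne : ∀ (ρ : TimedWord P) (k : ℕ), k ≤ ρ.last → ∀ t,
      SatAt ρ (blockLabel (act := act) χ c r none) k →
        ¬ SatAt ρ (blockLabel (act := act) χ c r (some t)) k := by
    intro ρ k hk t h1 h2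
    obtain ⟨a, ha⟩ := satAt_iOr.1 h1
    exact a.2 (hχ ρ k hk _ _ ha (satAt_and.1 h2).1)
  intro ρ k hk t t' ht ht'
  rcases t with _ | t <;> rcases t' with _ | t'
  · rfl
  · exact (hne ρ k hk t' ht ht').elim
  · exact (hne ρ k hk t ht' ht).elim
  · obtain ⟨-, u, hu, hl, h1, h2⟩ := (satAt_blockLabel_some hr hk).1 ht
    obtain ⟨-, u', hu', hl', h1', h2'⟩ := (satAt_blockLabel_some hr hk).1 ht'
    have := block_unique hχ h1 h1' rfl rfl hl hl' h2 h2'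
    subst this
    exact congrArg some (Subtype.ext (hu.symm.trans hu'))

/-- A word of block labels on a segment comes from a word. -/
theorem exists_word_of_blockLabel (hχ : Exclusive χ)
    (hr : ∀ f, (r f).DefinesAct (fun a : {a // a ≠ c} => act a) (fun a => χ a) f)
    (w : List (Option (BlockFun act c))) {k : ℕ} (hk : k + w.length ≤ ρ.last)
    (hw : Labelled ρ (blockLabel χ c r) k w) (hc : SatAt ρ (χ c) (k + w.length)) :
    ∃ (u : List {a // a ≠ c}) (v : List Δ), u.length + v.length = w.length ∧
      Labelled ρ χ k (u.map (·.1) ++ v) ∧ SatAt ρ (χ c) (k + u.length) ∧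
      (∀ t w', w = some t :: w' → u = []) ∧
      ∀ p, actWord act (v ++ [c]) p = actWord (blockAct act c) w ⟨act c p, p, rfl⟩ := by
  induction w generalizing k with
  | nil => exact ⟨[], [], rfl, trivial, hc, fun _ _ _ => rfl, fun p => rfl⟩
  | cons t w ih =>
    simp only [List.length_cons] at hk hc
    obtain ⟨u, v, hl, h1, h2, -, h3⟩ := ih (by omega) hw.2 (by rwa [add_right_comm, add_assoc])
    rcases t with _ | t
    · obtain ⟨a, ha⟩ := satAt_iOr.1 hw.1
      refine ⟨a :: u, v, by simp; omega, ⟨ha, h1⟩, ?_, fun t w' h => by simp at h, h3⟩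
      rwa [List.length_cons, add_comm u.length, ← add_assoc]
    · obtain ⟨h4, u', hu', hl', h5, h6⟩ := (satAt_blockLabel_some hr (by omega)).1 hw.1
      -- The block announced by the label is the block `u` that the induction has found after it.
      have hu := block_unique hχ h5 (labelled_append.1 h1).1 rfl rfl hl' (by omega) h6 h2
      subst hu
      refine ⟨[], c :: (u'.map (·.1) ++ v), by simp; omega, ⟨h4, h1⟩, h4, fun _ _ _ => rfl, ?_⟩
      intro p
      rw [List.cons_append, actWord, List.append_assoc, actWord_append, h3, hu']
      rfl

/-- A word on a segment determines a word of block labels. -/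
theorem exists_blockLabel_of_word
    (hr : ∀ f, (r f).DefinesAct (fun a : {a // a ≠ c} => act a) (fun a => χ a) f)
    (v : List Δ) {k : ℕ} (hk : k + v.length ≤ ρ.last)
    (hv : Labelled ρ χ k v) (hc : SatAt ρ (χ c) (k + v.length)) :
    ∃ (w : List (Option (BlockFun act c))) (u : List {a // a ≠ c}) (v' : List Δ),
      w.length = v.length ∧ v = u.map (·.1) ++ v' ∧
      Labelled ρ (blockLabel χ c r) k w ∧ SatAt ρ (χ c) (k + u.length) ∧
      (∀ r', v = c :: r' → u = [] ∧ ∃ t w', w = some t :: w') ∧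
      ∀ p, actWord act (v' ++ [c]) p = actWord (blockAct act c) w ⟨act c p, p, rfl⟩ := by
  induction v generalizing k with
  | nil => exact ⟨[], [], [], rfl, rfl, trivial, hc, fun _ h => by simp at h, fun p => rfl⟩
  | cons a v ih =>
    simp only [List.length_cons] at hk hc
    obtain ⟨w, u, v', hl, rfl, h1, h2, -, h3⟩ :=
      ih (by omega) hv.2 (by rwa [add_right_comm, add_assoc])
    simp only [List.length_append, List.length_map] at hk hl
    by_cases ha : a = c
    · subst ha
      -- The label of this occurrence is the action of the block `u` that starts right after it.
      let t : BlockFun act a := ⟨_, u, rfl⟩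
      refine ⟨some t :: w, [], a :: (u.map (·.1) ++ v'), by simp [hl], rfl, ⟨?_, h1⟩, hv.1,
        fun _ _ => ⟨rfl, t, w, rfl⟩, ?_⟩
      · exact (satAt_blockLabel_some hr (by omega)).2
          ⟨hv.1, u, rfl, by omega, (labelled_append.1 hv.2).1, h2⟩
      · intro p
        rw [List.cons_append, actWord, List.append_assoc, actWord_append, h3]
        rfl
    · refine ⟨none :: w, ⟨a, ha⟩ :: u, v', by simp [hl], rfl,
        ⟨satAt_iOr.2 ⟨⟨a, ha⟩, hv.1⟩, h1⟩, ?_, ?_, h3⟩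
      · rwa [List.length_cons, add_comm u.length, ← add_assoc]
      · intro r' h
        exact (ha (List.cons.inj h).1).elim

/-- The expressions for an action, from those for the words without `c` and for the block
action. -/
theorem exists_definesAct_of_block [Finite Q] {J : Interval → Prop} (hJ : J (.ci 0))
    (hχ : Exclusive χ) (hχJ : ∀ a, (χ a).Within J RatExp.IsLetterStar)
    (hr : ∀ f, (r f).DefinesAct (fun a : {a // a ≠ c} => act a) (fun a => χ a) f)
    (hrJ : ∀ f, (r f).Good J)
    {r' : (Set.range (act c) → Set.range (act c)) → RatExp (Formula P)}
    (hr' : ∀ f, (r' f).DefinesAct (blockAct act c) (blockLabel χ c r) f)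
    (hrJ' : ∀ f, (r' f).Good J) (f : Q → Q) :
    ∃ s : RatExp (Formula P), s.Good J ∧ s.DefinesAct act χ f := by
  -- Words with exactly one `c`: the two functions are the actions of the parts before and after it.
  let ι := {p : (Q → Q) × (Q → Q) // ∀ q, p.2 (act c (p.1 q)) = f q}
  -- Words with at least two `c`: the actions before the first and after the last `c`, the block
  -- label of the first `c`, and the action of the block labels strictly between the two. The last
  -- `c` carries no block label, since its look-ahead would leave the segment.
  let κ := {p : (Q → Q) × (Q → Q) × BlockFun act c × (Set.range (act c) → Set.range (act c)) //
    ∀ q, p.2.1 (p.2.2.2 (blockAct act c (some p.2.2.1) ⟨act c (p.1 q), _, rfl⟩)) = f q}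
  have hlab : ∀ t, (blockLabel (act := act) χ c r t).Within J RatExp.IsLetterStar := by
    rintro (_ | t)
    · exact .iOr fun a => hχJ a
    · exact .and (hχJ c) (.frat hJ (hrJ _).1 (hrJ _).2 (hχJ c))
  refine ⟨.alt (r f) (.alt
    (.iAlt fun p : ι => .cat (r p.1.1) (.cat (.letter (χ c)) (r p.1.2)))
    (.iAlt fun p : κ => .cat (r p.1.1) (.cat (.letter (blockLabel χ c r (some p.1.2.2.1)))
      (.cat (r' p.1.2.2.2) (.cat (.letter (χ c)) (r p.1.2.1)))))), ?_, ?_⟩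
  · exact .alt (hrJ f) (.alt (.iAlt fun p => .cat (hrJ _) (.cat (.letter (hχJ c)) (hrJ _)))
      (.iAlt fun p => .cat (hrJ _) (.cat (.letter (hlab _)) (.cat (hrJ' _)
        (.cat (.letter (hχJ c)) (hrJ _))))))
  intro ρ i j hj
  simp only [match_alt, match_iAlt, match_cat, match_letter]
  constructor
  · rintro (h | ⟨⟨⟨f₀, f₁⟩, hf⟩, k, h1, _, ⟨rfl, hc⟩, h2⟩ |
      ⟨⟨⟨f₀, f₁, t, x⟩, hf⟩, k, h1, _, ⟨rfl, ht⟩, z, hx, _, ⟨rfl, hc⟩, h2⟩)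
    · obtain ⟨u, rfl, hu, hl⟩ := (hr _ ρ _ _ hj).1 h
      exact ⟨u.map (·.1), by simp, by rw [← hu, actWord_coe], labelled_map.2 hl⟩
    · have hk2 := h2.le
      obtain ⟨u, rfl, rfl, hl⟩ := (hr _ ρ _ _ (by omega)).1 h1
      obtain ⟨u', rfl, rfl, hl'⟩ := (hr _ ρ _ _ hj).1 h2
      refine ⟨u.map (·.1) ++ c :: u'.map (·.1), by simp; omega, ?_, ?_⟩
      · funext q
        rw [← hf q, actWord_append, actWord, actWord_coe, actWord_coe]
      · rw [labelled_append, List.length_map]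
        exact ⟨labelled_map.2 hl, hc, labelled_map.2 hl'⟩
    · have hk2 := h2.le
      have hk3 := hx.le
      obtain ⟨u, rfl, rfl, hl⟩ := (hr _ ρ _ _ (by omega)).1 h1
      obtain ⟨w, rfl, rfl, hw⟩ := (hr' _ ρ _ _ (by omega)).1 hx
      obtain ⟨u', rfl, rfl, hl'⟩ := (hr _ ρ _ _ hj).1 h2
      -- The word of labels is taken from the first `c` on, so that the leading block `u₁` is empty.
      obtain ⟨u₁, v, h3, h4, -, h5, h6⟩ := exists_word_of_blockLabel hχ hr (some t :: w)
        (by simp; omega) ⟨ht, hw⟩ (by simpa [add_assoc, add_comm 1] using hc)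
      obtain rfl := h5 _ _ rfl
      simp only [List.length_nil, List.length_cons, zero_add, List.map_nil,
        List.nil_append] at h3 h4
      refine ⟨u.map (·.1) ++ (v ++ [c] ++ u'.map (·.1)), by simp; omega, ?_, ?_⟩
      · funext q
        rw [← hf q, actWord_append, actWord_append, h6, ← actWord_coe, ← actWord_coe]
        rfl
      · rw [labelled_append, labelled_append, labelled_append, List.length_map]
        refine ⟨labelled_map.2 hl, ⟨h4, ?_, trivial⟩, ?_⟩
        · convert hc using 1
          omega
        · rw [labelled_map]
          convert hl' using 1
          simp
          omega
  · rintro ⟨v, rfl, rfl, hv⟩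
    by_cases hc : c ∈ v
    · obtain ⟨u, v, rfl, hu⟩ := List.eq_append_cons_of_mem hc
      lift u to List {a // a ≠ c} using fun a ha => by rintro rfl; exact hu ha
      simp only [List.length_append, List.length_cons, List.length_map] at hj ⊢
      rw [labelled_append] at hv
      obtain ⟨hv1, hv2⟩ := hv
      rw [List.length_map] at hv2
      right
      by_cases hc' : c ∈ v
      · right
        obtain ⟨v, u', rfl, hu'⟩ := exists_last_occurrence hc'
        lift u' to List {a // a ≠ c} using fun a ha => by rintro rfl; exact hu' ha
        simp only [List.length_append, List.length_cons, List.length_map] at hj ⊢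
        rw [← List.cons_append, labelled_append] at hv2
        obtain ⟨hv2, hv3, hv4⟩ := hv2
        simp only [List.length_cons] at hv3 hv4
        obtain ⟨w, u₁, v', h1, h2, h3, -, h4, h5⟩ :=
          exists_blockLabel_of_word hr (c :: v) (by simp; omega) hv2 hv3
        obtain ⟨rfl, t, w, rfl⟩ := h4 _ rfl
        simp only [List.length_cons, List.map_nil, List.nil_append] at h1 h2
        subst h2
        refine ⟨⟨⟨actWord act (u.map (·.1)), actWord act (u'.map (·.1)), t,
          actWord (blockAct act c) w⟩, fun q => ?_⟩, i + u.length, ?_, _, ⟨rfl, h3.1⟩,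
          i + u.length + 1 + w.length, ?_, _, ⟨rfl, ?_⟩, ?_⟩
        · have := h5 (actWord act (u.map (·.1)) q)
          rw [actWord] at this
          rw [← this]
          simp [actWord]
        · exact (hr _ ρ _ _ (by omega)).2 ⟨u, rfl, actWord_coe u, labelled_map.1 hv1⟩
        · exact (hr' _ ρ _ _ (by omega)).2 ⟨w, rfl, rfl, h3.2⟩
        · convert hv3 using 1
          omega
        · refine (hr _ ρ _ _ (by omega)).2 ⟨u', by omega, actWord_coe u', ?_⟩
          convert labelled_map.1 hv4 using 1
          omega
      · left
        lift v to List {a // a ≠ c} using fun a ha => by rintro rfl; exact hc' ha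
        simp only [List.length_map] at hj ⊢
        refine ⟨⟨⟨actWord act (u.map (·.1)), actWord act (v.map (·.1))⟩, fun q => ?_⟩,
          i + u.length, ?_, _, ⟨rfl, hv2.1⟩, ?_⟩
        · rw [actWord_append, actWord]
        · exact (hr _ ρ _ _ (by omega)).2 ⟨u, rfl, actWord_coe u, labelled_map.1 hv1⟩
        · exact (hr _ ρ _ _ (by omega)).2 ⟨v, by omega, actWord_coe v, labelled_map.1 hv2.2⟩
    · left
      lift v to List {a // a ≠ c} using fun a ha => by rintro rfl; exact hc ha
      exact (hr _ ρ _ _ hj).2 ⟨v, by simp, actWord_coe v, labelled_map.1 hv⟩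

end Block

/-- Inner induction of a lexicographic one. Removing `c` lowers the number of letters with the same
states; the block action has a larger alphabet, possibly, but fewer states. -/
theorem exists_definesAct_aux {J : Interval → Prop} (hJ : J (.ci 0)) (n m : ℕ)
    (ih : ∀ n' < n, ∀ (Q Δ : Type u) [Finite Q] [Finite Δ] (act : Δ → Q → Q), IsCounterFree act →
      ∀ χ : Δ → Formula P, Exclusive χ → (∀ a, (χ a).Within J RatExp.IsLetterStar) →
        Nat.card Q = n' → ∀ f, ∃ r : RatExp (Formula P), r.Good J ∧ r.DefinesAct act χ f)
    (Q Δ : Type u) [Finite Q] [Finite Δ] (act : Δ → Q → Q) (hact : IsCounterFree act)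
    (χ : Δ → Formula P) (hχ : Exclusive χ) (hχJ : ∀ a, (χ a).Within J RatExp.IsLetterStar)
    (hn : Nat.card Q = n) (hm : Nat.card Δ = m) (f : Q → Q) :
    ∃ r : RatExp (Formula P), r.Good J ∧ r.DefinesAct act χ f := by
  induction m using Nat.strong_induction_on generalizing Δ f with
  | _ m ihm =>
    by_cases htriv : ∀ a, act a = id
    · exact definesAct_of_trivial htriv hχJ f
    obtain ⟨c, hc⟩ := not_forall.1 htriv
    have hcard : Nat.card {a // a ≠ c} < m := by
      rw [← hm]
      exact Finite.card_subtype_lt (x := c) (by simp)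
    have hact' : IsCounterFree fun a : {a // a ≠ c} => act a := by
      intro w k q hk hq
      rw [actWord_coe] at hq ⊢
      exact hact _ k q hk (by simpa [wpow] using hq)
    choose r hr using fun f => ihm _ hcard {a // a ≠ c} (fun a => act a) hact' (fun a => χ a)
      (fun ρ k hk a b h1 h2 => Subtype.ext (hχ ρ k hk a b h1 h2)) (fun a => hχJ a) rfl f
    have hlab : ∀ t, (blockLabel (act := act) χ c r t).Within J RatExp.IsLetterStar := by
      rintro (_ | t)
      · exact .iOr fun a => hχJ a
      · exact .and (hχJ c) (.frat hJ (hr _).1.1 (hr _).1.2 (hχJ c))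
    choose r' hr' using fun f => ih _ (hn ▸ hact.card_range_lt hc) (Set.range (act c))
      (Option (BlockFun act c)) (blockAct act c) hact.blockAct (blockLabel χ c r)
      (exclusive_blockLabel hχ fun f => (hr f).2) hlab rfl f
    exact exists_definesAct_of_block hJ hχ hχJ (fun f => (hr f).2) (fun f => (hr f).1)
      (fun f => (hr' f).2) (fun f => (hr' f).1) f

/-- For each function on the states, the segments labelled with a word that acts in this way are
matched by an expression in which only letters are iterated. -/
theorem IsCounterFree.exists_definesAct {J : Interval → Prop} (hJ : J (.ci 0)) {Q Δ : Type u}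
    [Finite Q] [Finite Δ] {act : Δ → Q → Q} (hact : IsCounterFree act) {χ : Δ → Formula P}
    (hχ : Exclusive χ) (hχJ : ∀ a, (χ a).Within J RatExp.IsLetterStar) (f : Q → Q) :
    ∃ r : RatExp (Formula P), r.Good J ∧ r.DefinesAct act χ f := by
  suffices ∀ n, ∀ (Q Δ : Type u) [Finite Q] [Finite Δ] (act : Δ → Q → Q), IsCounterFree act →
      ∀ χ : Δ → Formula P, Exclusive χ → (∀ a, (χ a).Within J RatExp.IsLetterStar) →
        Nat.card Q = n → ∀ f, ∃ r : RatExp (Formula P), r.Good J ∧ r.DefinesAct act χ f from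
    this _ Q Δ act hact χ hχ hχJ rfl f
  intro n
  induction n using Nat.strong_induction_on with
  | _ n ih =>
    intro Q Δ _ _ act hact χ hχ hχJ hn f
    exact exists_definesAct_aux hJ n _ ih Q Δ act hact χ hχ hχJ hn rfl f

/-! ### From star-free to letter-star expressions -/

/-- The formulas of `X` hold and the other formulas of the family do not hold. -/
noncomputable def Formula.exactly {S : Type*} [Finite S] (g : S → Formula P) (X : Set S) :
    Formula P :=
  open Classical in .iAnd fun s => if s ∈ X then g s else .neg (g s)

theorem satAt_exactly {S : Type*} [Finite S] {g : S → Formula P} {X : Set S} {ρ : TimedWord P}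
    {k : ℕ} : SatAt ρ (.exactly g X) k ↔ X = {s | SatAt ρ (g s) k} := by
  rw [Formula.exactly, satAt_iAnd, Set.ext_iff]
  refine forall_congr' fun s => ?_
  by_cases hs : s ∈ X <;> simp [hs]

theorem match_iff_single_seg {ρ : TimedWord P} {re : RatExp (Formula P)} {i j : ℕ} (hij : i < j)
    (hj : j ≤ ρ.last) : Match ρ re (i + 1) j ↔
      ∃ w, w ∈ single (seg ρ re.letters (ρ.pos i) (ρ.pos j)) ∧ w ∈ re.lang := by
  have hi' : (ρ.pos i).1 = i := by simp only [TimedWord.pos]; omega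
  have hj' : (ρ.pos j).1 = j := by simp only [TimedWord.pos]; omega
  have hp : ∀ m (h : (ρ.pos i).1 + 1 + m < ρ.last + 1), (⟨(ρ.pos i).1 + 1 + m, h⟩ : Fin _)
      = ρ.pos (i + 1 + m) := by
    intro m h
    ext
    simp only [TimedWord.pos]
    omega
  constructor
  · rintro ⟨w, hw, hl, h⟩
    refine ⟨w, ?_, hw⟩
    refine List.forall₂_iff_get.2 ⟨by simp [seg]; omega, fun m h1 h2 => ?_⟩
    refine ⟨re.mem_letters_of_mem_lang hw (List.get_mem _ _), ?_⟩
    simp only [seg, List.get_eq_getElem, List.getElem_ofFn, Set.mem_ofPred_eq, hp]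
    exact h m h1
  · rintro ⟨w, hs, hw⟩
    obtain ⟨hl, hs⟩ := List.forall₂_iff_get.1 hs
    simp only [seg, List.length_ofFn] at hl
    refine ⟨w, hw, by omega, fun m hm => ?_⟩
    obtain ⟨_, h⟩ := hs m hm (by simp [seg]; omega)
    simpa only [SatAt, seg, List.get_eq_getElem, List.getElem_ofFn, Set.mem_ofPred_eq, hp] using h

/-- At each position exactly one set of formulas is the set of those that hold, so the labelling is
unique and equals the marking. The `g s` stand for equivalent formulas already rewritten by an
induction. -/
theorem labelled_exactly_iff_seg {ρ : TimedWord P} {S : Set (Formula P)} [Finite S]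
    {g : S → Formula P}
    (hg : ∀ s, ∀ (ρ : TimedWord P) (k : ℕ), k ≤ ρ.last → (SatAt ρ (g s) k ↔ SatAt ρ s.1 k))
    {i j : ℕ} (hij : i < j) (hj : j ≤ ρ.last) (v : List (Set S)) :
    i + 1 + v.length = j ∧ Labelled ρ (Formula.exactly g) (i + 1) v ↔
      v = seg ρ S (ρ.pos i) (ρ.pos j) := by
  have hi' : (ρ.pos i).1 = i := by simp only [TimedWord.pos]; omega
  have hj' : (ρ.pos j).1 = j := by simp only [TimedWord.pos]; omega
  have hp : ∀ m (h : (ρ.pos i).1 + 1 + m < ρ.last + 1), (⟨(ρ.pos i).1 + 1 + m, h⟩ : Fin _)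
      = ρ.pos (i + 1 + m) := by
    intro m h
    ext
    simp only [TimedWord.pos]
    omega
  have hX : ∀ k, k ≤ ρ.last → {s | SatAt ρ (g s) k} = {s : S | Sat ρ s.1 (ρ.pos k)} := by
    intro k hk
    ext s
    exact hg s ρ k hk
  rw [labelled_iff_getElem]
  constructor
  · rintro ⟨hl, h⟩
    apply List.ext_getElem
    · simp [seg]; omega
    · intro m h1 h2
      simp only [seg, List.getElem_ofFn, hp]
      rw [satAt_exactly.1 (h m h1), hX _ (by omega)]
  · rintro rfl
    refine ⟨by simp [seg]; omega, fun m hm => ?_⟩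
    rw [satAt_exactly, hX _ (by simp [seg] at hm; omega)]
    simp only [seg, List.getElem_ofFn, hp]

/-- The marking of a segment belongs to `K` iff its action on the left quotients sends `K` to one
that contains the empty word. There are finitely many functions with this property, and each one has
its own expression. -/
theorem HasStarFreeEquivalent.exists_within {J : Interval → Prop} (hJ : J (.ci 0))
    {re : RatExp (Formula P)} (h : HasStarFreeEquivalent re)
    (hre : ∀ ψ ∈ re.letters, ∃ ψ' : Formula P, ψ'.Within J RatExp.IsLetterStar ∧
      ∀ (ρ : TimedWord P) (k : ℕ), k ≤ ρ.last → (SatAt ρ ψ' k ↔ SatAt ρ ψ k)) :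
    ∃ (l : List (RatExp (Formula P))), (∀ r ∈ l, r.Good J) ∧
      ∀ (ρ : TimedWord P) (i j : ℕ), i < j → j ≤ ρ.last →
        (Match ρ re (i + 1) j ↔ ∃ r ∈ l, Match ρ r (i + 1) j) := by
  have : Finite re.letters := re.finite_letters
  obtain ⟨K, hK, hseg⟩ := h
  choose g hgJ hg using fun s : re.letters => hre s.1 s.2
  have : Finite (Set.range K.leftQuotient) := hK.finite_range_leftQuotient
  have hχJ : ∀ X, (Formula.exactly g X).Within J RatExp.IsLetterStar := by
    intro X
    refine .iAnd fun s => ?_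
    split_ifs
    · exact hgJ s
    · exact .neg (hgJ s)
  have hχ : Exclusive (Formula.exactly g) := fun ρ k _ X Y hX hY =>
    (satAt_exactly.1 hX).trans (satAt_exactly.1 hY).symm
  choose r hrJ hr using
    fun f => hK.isAperiodic.isCounterFree.exists_definesAct hJ hχ hχJ f
  let q₀ : Set.range K.leftQuotient := ⟨K, [], rfl⟩
  have := Fintype.ofFinite {f : Set.range K.leftQuotient → Set.range K.leftQuotient //
    [] ∈ (f q₀).1}
  refine ⟨(Finset.univ : Finset {f : Set.range K.leftQuotient → Set.range K.leftQuotient //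
    [] ∈ (f q₀).1}).toList.map fun f => r f.1, ?_, fun ρ i j hij hj => ?_⟩
  · intro s hs
    obtain ⟨f, -, rfl⟩ := List.mem_map.1 hs
    exact hrJ _
  · rw [match_iff_single_seg hij hj, ← hseg ρ _ _ (by
      simp only [TimedWord.pos, Fin.lt_def]; omega)]
    have hacc : ∀ v, v ∈ K ↔ [] ∈ (actWord (quotientAct K) v q₀).1 := by
      intro v
      rw [coe_actWord_quotientAct, Language.mem_leftQuotient, List.append_nil]
    simp only [List.mem_map, Finset.mem_toList, Finset.mem_univ, true_and, Subtype.exists]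
    rw [hacc]
    constructor
    · intro h
      obtain ⟨h1, h2⟩ := (labelled_exactly_iff_seg hg hij hj _).2 rfl
      exact ⟨_, ⟨_, h, rfl⟩, (hr _ ρ _ _ hj).2 ⟨_, h1, rfl, h2⟩⟩
    · rintro ⟨_, ⟨f, hf, rfl⟩, hm⟩
      obtain ⟨v, h1, rfl, h2⟩ := (hr _ ρ _ _ hj).1 hm
      rwa [(labelled_exactly_iff_seg hg hij hj v).1 ⟨h1, h2⟩] at hf

/-- Formulas with star-free expressions are equivalent to formulas in whose expressions only
letters are iterated. -/
theorem Formula.Within.exists_isLetterStar {J : Interval → Prop} (hJ : J (.ci 0)) {φ : Formula P}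
    (h : φ.Within J HasStarFreeEquivalent) :
    ∃ φ' : Formula P, φ'.Within J RatExp.IsLetterStar ∧
      ∀ (ρ : TimedWord P) (k : ℕ), k ≤ ρ.last → (SatAt ρ φ' k ↔ SatAt ρ φ k) := by
  induction h with
  | atom a => exact ⟨_, .atom a, fun _ _ _ => Iff.rfl⟩
  | tru => exact ⟨_, .tru, fun _ _ _ => Iff.rfl⟩
  | and _ _ h1 h2 =>
    obtain ⟨φ', hφ, h1⟩ := h1
    obtain ⟨ψ', hψ, h2⟩ := h2
    exact ⟨_, .and hφ hψ, fun ρ k hk => by rw [satAt_and, satAt_and, h1 ρ k hk, h2 ρ k hk]⟩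
  | neg _ h =>
    obtain ⟨φ', hφ, h⟩ := h
    exact ⟨_, .neg hφ, fun ρ k hk => by rw [satAt_neg, satAt_neg, h ρ k hk]⟩
  | @frat I re φ hI hr _ _ h1 h2 =>
    obtain ⟨φ', hφ, h2⟩ := h2
    obtain ⟨l, hl, h⟩ := hr.exists_within hJ h1
    -- `FRat` distributes over alternatives of its expression.
    refine ⟨.orList (l.map fun r => .frat I r φ'), .orList ?_, fun ρ k hk => ?_⟩
    · intro ψ hψ
      obtain ⟨r, hr, rfl⟩ := List.mem_map.1 hψ
      exact .frat hI (hl r hr).1 (hl r hr).2 hφ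
    · simp only [satAt_orList, List.mem_map, exists_exists_and_eq_and, satAt_frat hk]
      constructor
      · rintro ⟨r, hr, j, hj, hjl, h3, h4, h5⟩
        exact ⟨j, hj, hjl, (h2 ρ j hjl).1 h3, h4, (h ρ k j hj hjl).2 ⟨r, hr, h5⟩⟩
      · rintro ⟨j, hj, hjl, h3, h4, h5⟩
        obtain ⟨r, hr, h5⟩ := (h ρ k j hj hjl).1 h5
        exact ⟨r, hr, j, hj, hjl, (h2 ρ j hjl).2 h3, h4, h5⟩
  | _ hI _ _ h1 h2 =>
    obtain ⟨φ', hφ, h1⟩ := h1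
    obtain ⟨ψ', hψ, h2⟩ := h2
    refine ⟨_, .until hI hφ hψ, fun ρ k hk => ?_⟩
    rw [satAt_until hk, satAt_until hk]
    refine exists_congr fun j => and_congr_right fun _ => and_congr_right fun hj => ?_
    rw [h2 ρ j hj]
    refine and_congr_right fun _ => and_congr_right fun _ => ?_
    exact forall_congr' fun m => forall_congr' fun _ => forall_congr' fun hm => h1 ρ m (by omega)

end ATA

/-! ### Acceptance by reset times, and duality -/

namespace ATA

/-! ### Acceptance in terms of reset times -/

namespace TForm

variable {S : Type}

/-- The truth value at time `now` of a transition formula for a clock that has been reset at time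
`t`, where `L s t` says that the location `s` with reset time `t` accepts the remaining word. -/
def Ev (L : S → ℝ → Prop) (now : ℝ) : TForm S → ℝ → Prop
  | top, _ => True
  | bot, _ => False
  | conj φ ψ, t => φ.Ev L now t ∧ ψ.Ev L now t
  | disj φ ψ, t => φ.Ev L now t ∨ ψ.Ev L now t
  | loc s, t => L s t
  | guard g, t => g.Holds (now - t)
  | reset φ, _ => φ.Ev L now now

/-- The clock value `v` at time `now` corresponds to the reset time `now - v`. The formulas are
positive, so choosing a disjunct of the normal form whose states all accept is the same as
evaluating the formula. -/
theorem exists_outcome_iff_ev {L : S → ℝ → Prop} {now : ℝ} {φ : TForm S} {v : ℝ} :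
    (∃ M ∈ φ.outcomes v, ∀ p ∈ M, L p.1 (now - p.2)) ↔ φ.Ev L now (now - v) := by
  induction φ generalizing v with
  | top => simp [outcomes, Ev]
  | bot => simp [outcomes, Ev]
  | conj φ ψ h1 h2 =>
    rw [Ev, ← h1, ← h2]
    constructor
    · rintro ⟨_, ⟨A, hA, B, hB, rfl⟩, h⟩
      exact ⟨⟨A, hA, fun p hp => h p (Or.inl hp)⟩, ⟨B, hB, fun p hp => h p (Or.inr hp)⟩⟩
    · rintro ⟨⟨A, hA, h⟩, ⟨B, hB, h'⟩⟩
      exact ⟨_, ⟨A, hA, B, hB, rfl⟩, fun p hp => hp.elim (h p) (h' p)⟩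
  | disj φ ψ h1 h2 =>
    rw [Ev, ← h1, ← h2]
    constructor
    · rintro ⟨M, hM | hM, h⟩
      · exact Or.inl ⟨M, hM, h⟩
      · exact Or.inr ⟨M, hM, h⟩
    · rintro (⟨M, hM, h⟩ | ⟨M, hM, h⟩)
      · exact ⟨M, Or.inl hM, h⟩
      · exact ⟨M, Or.inr hM, h⟩
  | loc s => simp [outcomes, Ev]
  | guard g =>
    rw [Ev, sub_sub_cancel]
    constructor
    · rintro ⟨M, ⟨rfl, h⟩, -⟩
      exact h
    · exact fun h => ⟨∅, ⟨rfl, h⟩, fun p hp => hp.elim⟩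
  | reset φ h =>
    have := h (v := 0)
    rw [sub_zero] at this
    exact this

theorem ev_congr {L L' : S → ℝ → Prop} {now : ℝ} {φ : TForm S} {t : ℝ}
    (hf : ∀ s ∈ φ.freeLocs, L s t ↔ L' s t) (hb : ∀ s ∈ φ.boundLocs, L s now ↔ L' s now) :
    φ.Ev L now t ↔ φ.Ev L' now t := by
  induction φ generalizing t with
  | top => rfl
  | bot => rfl
  | conj φ ψ h1 h2 =>
    exact and_congr (h1 (fun s hs => hf s (Or.inl hs)) fun s hs => hb s (Or.inl hs))
      (h2 (fun s hs => hf s (Or.inr hs)) fun s hs => hb s (Or.inr hs))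
  | disj φ ψ h1 h2 =>
    exact or_congr (h1 (fun s hs => hf s (Or.inl hs)) fun s hs => hb s (Or.inl hs))
      (h2 (fun s hs => hf s (Or.inr hs)) fun s hs => hb s (Or.inr hs))
  | loc s => exact hf s rfl
  | guard g => rfl
  | reset φ h => exact h (fun s hs => hb s (Or.inl hs)) fun s hs => hb s (Or.inr hs)

/-- No clock constraint occurs and every location is under a reset, so the previous reset time is
never consulted. -/
theorem IsResetCombination.ev_iff {β : TForm S} (hβ : β.IsResetCombination) {L : S → ℝ → Prop}
    {now t t' : ℝ} : β.Ev L now t ↔ β.Ev L now t' := by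
  induction hβ with
  | top => rfl
  | bot => rfl
  | atom q => rfl
  | conj _ _ h1 h2 => exact and_congr h1 h2
  | disj _ _ h1 h2 => exact or_congr h1 h2

theorem IsResetCombination.freeLocs_eq {β : TForm S} (hβ : β.IsResetCombination) :
    β.freeLocs = ∅ := by
  induction hβ with
  | top => rfl
  | bot => rfl
  | atom q => rfl
  | conj _ _ h1 h2 => simp [freeLocs, h1, h2]
  | disj _ _ h1 h2 => simp [freeLocs, h1, h2]

theorem IsResetCombination.guards_eq {β : TForm S} (hβ : β.IsResetCombination) :
    β.guards = ∅ := by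
  induction hβ with
  | top => rfl
  | bot => rfl
  | atom q => rfl
  | conj _ _ h1 h2 => simp [guards, h1, h2]
  | disj _ _ h1 h2 => simp [guards, h1, h2]

end TForm

section Accept

variable {P : Type*} {S : Type} (δ : S → Letter P → TForm S) (F : Set S) (ρ : TimedWord P)

/-- Acceptance of the last `m` symbols. -/
def acceptRem : ℕ → S → ℝ → Prop
  | 0, s, _ => s ∈ F
  | m + 1, s, t =>
      (δ s (ρ.letterAt (ρ.last - m))).Ev (acceptRem m) (ρ.timeAt (ρ.last - m)) t

/-- Acceptance of the symbols from the position `k` on, by a location whose clock has been reset at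
time `t`. -/
def Accept (k : ℕ) : S → ℝ → Prop := acceptRem δ F ρ (ρ.last + 1 - k)

variable {δ F ρ}

theorem accept_end {s : S} {t : ℝ} : Accept δ F ρ (ρ.last + 1) s t ↔ s ∈ F := by
  rw [Accept, Nat.sub_self]
  rfl

theorem accept_iff {k : ℕ} (hk : k ≤ ρ.last) {s : S} {t : ℝ} :
    Accept δ F ρ k s t ↔
      (δ s (ρ.letterAt k)).Ev (Accept δ F ρ (k + 1)) (ρ.timeAt k) t := by
  rw [Accept, show ρ.last + 1 - k = (ρ.last - k) + 1 by omega, acceptRem,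
    show ρ.last - (ρ.last - k) = k by omega, Accept, show ρ.last + 1 - (k + 1) = ρ.last - k by omega]

end Accept

section Language

variable {P : Type*} {A : OneATA P} {ρ : TimedWord P}

/-- The time at which the symbol before the position `k` is read. -/
def TimedWord.timeBefore (ρ : TimedWord P) : ℕ → ℝ
  | 0 => 0
  | k + 1 => ρ.timeAt k

theorem TimedWord.delay_eq (ρ : TimedWord P) (k : Fin (ρ.last + 1)) :
    ρ.delay k = ρ.timeAt k.1 - ρ.timeBefore k.1 := by
  rcases k with ⟨_ | k, hk⟩
  · rw [TimedWord.timeBefore, TimedWord.timeAt, ρ.pos_eq hk, sub_zero]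
    rfl
  · rw [TimedWord.timeBefore, TimedWord.timeAt, ρ.pos_eq hk, TimedWord.timeAt,
      ρ.pos_eq (by omega : k < ρ.last + 1)]
    rfl

/-- Backward induction along the run. Elapsing time shifts the clock and the current time alike, so
the reset time of a state is unchanged. -/
theorem OneATA.accept_of_isRun {C : Fin (ρ.last + 2) → A.Config} (hC : A.IsRun ρ C)
    (hF : ∀ p ∈ C (Fin.last _), p.1 ∈ A.final) (i : Fin (ρ.last + 2)) :
    ∀ p ∈ C i, Accept A.δ A.final ρ i.1 p.1 (ρ.timeBefore i.1 - p.2) := by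
  induction i using Fin.reverseInduction with
  | last => exact fun p hp => accept_end.2 (hF p hp)
  | cast k ih =>
    intro p hp
    obtain ⟨M, hM, hC'⟩ := hC.2 k
    have hp' : (p.1, p.2 + ρ.delay k) ∈ OneATA.Config.elapse (C k.castSucc) (ρ.delay k) :=
      ⟨p, hp, rfl⟩
    have hsub : M (p.1, p.2 + ρ.delay k) ⊆ C k.succ := by
      rw [hC']
      exact Set.subset_biUnion_of_mem (u := fun q => M q) hp'
    have hlet : ρ.letterAt k.1 = ρ.letter k := by rw [TimedWord.letterAt, ρ.pos_val]
    rw [Fin.val_castSucc, accept_iff (by omega), hlet]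
    have := TForm.exists_outcome_iff_ev.1
      ⟨_, hM _ hp', fun q hq => ih q (hsub hq)⟩
    have ht : ρ.timeBefore k.succ.1 - (p.2 + ρ.delay k) = ρ.timeBefore k.1 - p.2 := by
      rw [ρ.delay_eq, Fin.val_succ, TimedWord.timeBefore]
      ring
    rw [ht] at this
    exact this

open Classical in
/-- A choice of accepting outcomes at the position `k`. -/
noncomputable def OneATA.acceptingChoice (A : OneATA P) (ρ : TimedWord P) (k : ℕ)
    (p : A.Loc × ℝ) : A.Config :=
  if h : ∃ M ∈ (A.δ p.1 (ρ.letterAt k)).outcomes p.2,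
    ∀ q ∈ M, Accept A.δ A.final ρ (k + 1) q.1 (ρ.timeAt k - q.2) then h.choose else ∅

/-- The configurations reached with accepting outcomes. -/
noncomputable def OneATA.acceptingConfig (A : OneATA P) (ρ : TimedWord P) : ℕ → A.Config
  | 0 => {(A.init, 0)}
  | k + 1 => ⋃ p ∈ OneATA.Config.elapse (OneATA.acceptingConfig A ρ k)
      (ρ.timeAt k - ρ.timeBefore k), OneATA.acceptingChoice A ρ k p

theorem OneATA.acceptingChoice_spec {k : ℕ} {p : A.Loc × ℝ} (hk : k ≤ ρ.last)
    (hp : Accept A.δ A.final ρ k p.1 (ρ.timeAt k - p.2)) :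
    A.acceptingChoice ρ k p ∈ (A.δ p.1 (ρ.letterAt k)).outcomes p.2 ∧
      ∀ q ∈ A.acceptingChoice ρ k p, Accept A.δ A.final ρ (k + 1) q.1 (ρ.timeAt k - q.2) := by
  have h := TForm.exists_outcome_iff_ev.2 ((accept_iff hk).1 hp)
  rw [OneATA.acceptingChoice, dif_pos h]
  exact h.choose_spec

theorem OneATA.accept_of_mem_elapse {C : A.Config} {k : ℕ}
    (hC : ∀ p ∈ C, Accept A.δ A.final ρ k p.1 (ρ.timeBefore k - p.2)) {p : A.Loc × ℝ}
    (hp : p ∈ OneATA.Config.elapse C (ρ.timeAt k - ρ.timeBefore k)) :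
    Accept A.δ A.final ρ k p.1 (ρ.timeAt k - p.2) := by
  obtain ⟨q, hq, rfl⟩ := hp
  convert hC q hq using 1
  ring

theorem OneATA.accept_acceptingConfig (h : Accept A.δ A.final ρ 0 A.init 0) {k : ℕ}
    (hk : k ≤ ρ.last + 1) : ∀ p ∈ A.acceptingConfig ρ k,
      Accept A.δ A.final ρ k p.1 (ρ.timeBefore k - p.2) := by
  induction k with
  | zero =>
    rintro _ rfl
    simpa [TimedWord.timeBefore] using h
  | succ k ih =>
    intro p hp
    simp only [OneATA.acceptingConfig, Set.mem_iUnion] at hp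
    obtain ⟨q, hq, hp⟩ := hp
    exact (OneATA.acceptingChoice_spec (by omega)
      (OneATA.accept_of_mem_elapse (ih (by omega)) hq)).2 p hp

/-- Acceptance by a configuration is acceptance by each of its states, so a run is obtained by
choosing, independently for each state that accepts, an outcome whose states all accept. -/
theorem OneATA.mem_language : ρ ∈ A.language ↔ Accept A.δ A.final ρ 0 A.init 0 := by
  constructor
  · rintro ⟨C, hC, hF⟩
    have := OneATA.accept_of_isRun hC hF 0 (A.init, 0) (by rw [hC.1]; rfl)
    simpa [TimedWord.timeBefore] using this
  · intro h
    refine ⟨fun i => A.acceptingConfig ρ i.1, ⟨rfl, fun k => ?_⟩, fun p hp => ?_⟩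
    · have hlet : ρ.letterAt k.1 = ρ.letter k := by rw [TimedWord.letterAt, ρ.pos_val]
      refine ⟨A.acceptingChoice ρ k.1, fun p hp => ?_, ?_⟩
      · rw [ρ.delay_eq] at hp
        rw [← hlet]
        exact (OneATA.acceptingChoice_spec (by omega) (OneATA.accept_of_mem_elapse
          (OneATA.accept_acceptingConfig h k.2.le) hp)).1
      · rw [ρ.delay_eq]; rfl
    · exact accept_end.1 (OneATA.accept_acceptingConfig h le_rfl p hp)

end Language

/-! ### Duality -/

/-- The negation of a clock constraint. -/
def Guard.compl : Guard → Guard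
  | .mem I => .notMem I
  | .notMem I => .mem I

theorem Guard.holds_compl {g : Guard} {v : ℝ} : g.compl.Holds v ↔ ¬ g.Holds v := by
  cases g <;> simp [Guard.compl, Guard.Holds]

theorem Guard.interval_compl (g : Guard) : g.compl.interval = g.interval := by
  cases g <;> rfl

namespace TForm

variable {S : Type}

/-- The dual formula. -/
def dual : TForm S → TForm S
  | top => bot
  | bot => top
  | conj φ ψ => disj φ.dual ψ.dual
  | disj φ ψ => conj φ.dual ψ.dual
  | loc s => loc s
  | guard g => guard g.compl
  | reset φ => reset φ.dual

theorem ev_dual {L : S → ℝ → Prop} {now : ℝ} {φ : TForm S} {t : ℝ} :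
    φ.dual.Ev (fun s t => ¬ L s t) now t ↔ ¬ φ.Ev L now t := by
  induction φ generalizing t with
  | top => simp [dual, Ev]
  | bot => simp [dual, Ev]
  | conj φ ψ h1 h2 => simp only [dual, Ev, h1, h2]; tauto
  | disj φ ψ h1 h2 => simp only [dual, Ev, h1, h2]; tauto
  | loc s => rfl
  | guard g => exact Guard.holds_compl
  | reset φ h => exact h

theorem freeLocs_dual (φ : TForm S) : φ.dual.freeLocs = φ.freeLocs := by
  induction φ with
  | conj φ ψ h1 h2 => simp [dual, freeLocs, h1, h2]
  | disj φ ψ h1 h2 => simp [dual, freeLocs, h1, h2]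
  | _ => rfl

theorem boundLocs_dual (φ : TForm S) : φ.dual.boundLocs = φ.boundLocs := by
  induction φ with
  | conj φ ψ h1 h2 => simp [dual, boundLocs, h1, h2]
  | disj φ ψ h1 h2 => simp [dual, boundLocs, h1, h2]
  | reset φ h => simp [dual, boundLocs, h, freeLocs_dual]
  | _ => rfl

theorem guards_dual {J : Interval → Prop} {φ : TForm S} (h : ∀ g ∈ φ.guards, J g.interval) :
    ∀ g ∈ φ.dual.guards, J g.interval := by
  induction φ with
  | conj φ ψ h1 h2 =>
    rintro g (hg | hg)
    · exact h1 (fun g hg => h g (Or.inl hg)) g hg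
    · exact h2 (fun g hg => h g (Or.inr hg)) g hg
  | disj φ ψ h1 h2 =>
    rintro g (hg | hg)
    · exact h1 (fun g hg => h g (Or.inl hg)) g hg
    · exact h2 (fun g hg => h g (Or.inr hg)) g hg
  | guard g =>
    rintro _ rfl
    rw [Guard.interval_compl]
    exact h g rfl
  | reset φ h1 => exact h1 h
  | _ => exact fun g hg => hg.elim

theorem IsResetCombination.dual {β : TForm S} (hβ : β.IsResetCombination) :
    β.dual.IsResetCombination := by
  induction hβ with
  | top => exact .bot
  | bot => exact .top
  | atom q => exact .atom q
  | conj _ _ h1 h2 => exact .disj h1 h2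
  | disj _ _ h1 h2 => exact .conj h1 h2

theorem IsConjunctive.dual {Q : Set S} {φ : TForm S} (h : φ.IsConjunctive Q) :
    φ.dual.IsDisjunctive Q := by
  induction h with
  | loc h => exact .loc h
  | locOr h hβ => exact .locAnd h hβ.dual
  | guard g => exact .guard _
  | guardOr g hβ => exact .guardAnd _ hβ.dual
  | resets hβ => exact .resets hβ.dual
  | conj _ _ h1 h2 => exact .disj h1 h2

theorem IsDisjunctive.dual {Q : Set S} {φ : TForm S} (h : φ.IsDisjunctive Q) :
    φ.dual.IsConjunctive Q := by
  induction h with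
  | loc h => exact .loc h
  | locAnd h hβ => exact .locOr h hβ.dual
  | guard g => exact .guard _
  | guardAnd g hβ => exact .guardOr _ hβ.dual
  | resets hβ => exact .resets hβ.dual
  | disj _ _ h1 h2 => exact .conj h1 h2

end TForm

/-- Exchanging conjunctions with disjunctions, complementing constraints and final locations negates
the truth value at every stage of the backward evaluation. -/
theorem accept_dual {P : Type*} {S : Type} {δ : S → Letter P → TForm S} {F : Set S}
    {ρ : TimedWord P} {k : ℕ} {s : S} {t : ℝ} :
    Accept (fun s a => (δ s a).dual) Fᶜ ρ k s t ↔ ¬ Accept δ F ρ k s t := by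
  have : ∀ m, acceptRem (fun s a => (δ s a).dual) Fᶜ ρ m = fun s t => ¬ acceptRem δ F ρ m s t := by
    intro m
    induction m with
    | zero => rfl
    | succ m ih =>
      funext s t
      rw [acceptRem, ih, acceptRem]
      exact propext TForm.ev_dual
  rw [Accept, this, Accept]

end ATA

/-! ### Paths as rational expressions, clock constraints as intervals -/

namespace ATA

variable {P : Type*}

/-! ### Paths -/

section Path

variable {S : Type*}

/-- A path that reads the positions `i, …, j - 1`, where the step from `p` to `q` is allowed at the
positions that satisfy `step p q`. -/
inductive Path (ρ : TimedWord P) (step : S → S → Formula P) : S → ℕ → S → ℕ → Prop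
  | refl (q : S) (i : ℕ) : Path ρ step q i q i
  | cons {p q r : S} {i j : ℕ} :
      SatAt ρ (step p q) i → Path ρ step q (i + 1) r j → Path ρ step p i r j

variable {ρ : TimedWord P} {step : S → S → Formula P}

theorem Path.le {p q : S} {i j : ℕ} (h : Path ρ step p i q j) : i ≤ j := by
  induction h with
  | refl => exact le_rfl
  | cons _ _ ih => omega

theorem path_iff {p r : S} {i j : ℕ} : Path ρ step p i r j ↔
    (p = r ∧ i = j) ∨ ∃ q, SatAt ρ (step p q) i ∧ Path ρ step q (i + 1) r j := by
  constructor
  · rintro (_ | ⟨h1, h2⟩)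
    · exact Or.inl ⟨rfl, rfl⟩
    · exact Or.inr ⟨_, h1, h2⟩
  · rintro (⟨rfl, rfl⟩ | ⟨q, h1, h2⟩)
    · exact .refl _ _
    · exact .cons h1 h2

theorem Path.trans {p q r : S} {i j k : ℕ} (h : Path ρ step p i q j) (h' : Path ρ step q j r k) :
    Path ρ step p i r k := by
  induction h with
  | refl => exact h'
  | cons h1 _ ih => exact .cons h1 (ih h')

theorem path_succ_iff {p r : S} {i j : ℕ} (hij : i ≤ j) : Path ρ step p i r (j + 1) ↔
    ∃ q, Path ρ step p i q j ∧ SatAt ρ (step q r) j := by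
  constructor
  · intro h
    generalize hk : j + 1 = k at h
    induction h with
    | refl => omega
    | @cons p q r i _ h1 h2 ih =>
      subst hk
      rcases Nat.eq_or_lt_of_le hij with rfl | hlt
      · rcases path_iff.1 h2 with ⟨rfl, -⟩ | ⟨_, _, h3⟩
        · exact ⟨p, .refl _ _, h1⟩
        · have := h3.le
          omega
      · obtain ⟨q', h3, h4⟩ := ih hlt rfl
        exact ⟨q', .cons h1 h3, h4⟩
  · rintro ⟨q, h1, h2⟩
    exact h1.trans (.cons h2 (.refl _ _))

/-- Splits off the initial stay at `p`. When steps respect an order, the path never comes back to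
`p` afterwards. -/
theorem Path.exists_leave {p q : S} {i j : ℕ} (h : Path ρ step p i q j) :
    ∃ k, (i ≤ k ∧ ∀ m, i ≤ m → m < k → SatAt ρ (step p p) m) ∧
      ((p = q ∧ k = j) ∨ ∃ r, r ≠ p ∧ SatAt ρ (step p r) k ∧ Path ρ step r (k + 1) q j) := by
  induction h with
  | refl q i => exact ⟨i, ⟨le_rfl, fun m _ _ => by omega⟩, Or.inl ⟨rfl, rfl⟩⟩
  | @cons p r q i j h1 h2 ih =>
    by_cases hr : r = p
    · subst hr
      obtain ⟨k, ⟨hk, h3⟩, h4⟩ := ih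
      refine ⟨k, ⟨by omega, fun m hm hmk => ?_⟩, h4⟩
      rcases Nat.eq_or_lt_of_le hm with rfl | hm
      · exact h1
      · exact h3 m hm hmk
    · exact ⟨i, ⟨le_rfl, fun m _ _ => by omega⟩, Or.inr ⟨r, hr, h1, h2⟩⟩

/-- The expressions define the paths between each two states. -/
def DefinesPaths (step : S → S → Formula P) (re : S → S → RatExp (Formula P)) : Prop :=
  ∀ p q, (re p q).LettersIn (fun ψ => ψ = .fls ∨ ∃ p q, ψ = step p q) ∧
    ∀ (ρ : TimedWord P) (i j : ℕ), Match ρ (re p q) i j ↔ Path ρ step p i q j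

/-- The nonempty paths with all intermediate states in `X`. -/
inductive PathVia (ρ : TimedWord P) (step : S → S → Formula P) (X : Set S) :
    S → ℕ → S → ℕ → Prop
  | single {p q : S} {i : ℕ} : SatAt ρ (step p q) i → PathVia ρ step X p i q (i + 1)
  | cons {p q r : S} {i j : ℕ} : SatAt ρ (step p q) i → q ∈ X →
      PathVia ρ step X q (i + 1) r j → PathVia ρ step X p i r j

theorem PathVia.trans {X : Set S} {p q r : S} {i j k : ℕ} (h : PathVia ρ step X p i q j)
    (hq : q ∈ X) (h' : PathVia ρ step X q j r k) : PathVia ρ step X p i r k := by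
  induction h with
  | single h1 => exact .cons h1 hq h'
  | cons h1 h2 _ ih => exact .cons h1 h2 (ih hq h')

theorem PathVia.mono {X Y : Set S} (hXY : X ⊆ Y) {p q : S} {i j : ℕ}
    (h : PathVia ρ step X p i q j) : PathVia ρ step Y p i q j := by
  induction h with
  | single h1 => exact .single h1
  | cons h1 h2 _ ih => exact .cons h1 (hXY h2) ih

/-- The path is cut at its intermediate visits to `z`: up to the first, the loops between
consecutive ones, and from the last. -/
theorem pathVia_insert {X : Set S} {z p q : S} {i j : ℕ} :
    PathVia ρ step (insert z X) p i q j ↔ PathVia ρ step X p i q j ∨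
      ∃ k, PathVia ρ step X p i z k ∧ ∃ l,
        Relation.ReflTransGen (fun a b => PathVia ρ step X z a z b) k l ∧
          PathVia ρ step X z l q j := by
  constructor
  · intro h
    induction h with
    | single h1 => exact Or.inl (.single h1)
    | cons h1 h2 _ ih =>
      rcases h2 with rfl | h2
      · right
        refine ⟨_, .single h1, ?_⟩
        rcases ih with h | ⟨k, h3, l, h4, h5⟩
        · exact ⟨_, .refl, h⟩
        · exact ⟨l, .head h3 h4, h5⟩
      · rcases ih with h | ⟨k, h3, l, h4, h5⟩
        · exact Or.inl (.cons h1 h2 h)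
        · exact Or.inr ⟨k, .cons h1 h2 h3, l, h4, h5⟩
  · have hsub : X ⊆ insert z X := Set.subset_insert _ _
    rintro (h | ⟨k, h1, l, h2, h3⟩)
    · exact h.mono hsub
    · refine (h1.mono hsub).trans (Or.inl rfl) ?_
      clear h1
      induction h2 using Relation.ReflTransGen.head_induction_on with
      | refl => exact h3.mono hsub
      | head h4 _ ih => exact (h4.mono hsub).trans (Or.inl rfl) ih

theorem exists_pathVia (step : S → S → Formula P) {X : Set S} (hX : X.Finite) :
    ∃ re : S → S → RatExp (Formula P), ∀ p q,
      (re p q).LettersIn (fun ψ => ψ = .fls ∨ ∃ p q, ψ = step p q) ∧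
        ∀ (ρ : TimedWord P) (i j : ℕ), Match ρ (re p q) i j ↔ PathVia ρ step X p i q j := by
  induction X, hX using Set.Finite.induction_on with
  | empty =>
    refine ⟨fun p q => .letter (step p q), fun p q => ⟨.letter (Or.inr ⟨p, q, rfl⟩), ?_⟩⟩
    intro ρ i j
    rw [match_letter]
    constructor
    · rintro ⟨rfl, h⟩
      exact .single h
    · rintro (h | ⟨_, h, _⟩)
      · exact ⟨rfl, h⟩
      · exact h.elim
  | @insert z X _ _ ih =>
    obtain ⟨re, hre⟩ := ih
    refine ⟨fun p q => .alt (re p q) (.cat (re p z) (.cat (.star (re z z)) (re z q))),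
      fun p q => ⟨?_, fun ρ i j => ?_⟩⟩
    · exact .alt (hre p q).1 (.cat (hre p z).1 (.cat (.star (hre z z).1) (hre z q).1))
    · rw [pathVia_insert]
      have : Match ρ (re z z) = fun a b => PathVia ρ step X z a z b := by
        funext a b
        exact propext ((hre z z).2 ρ a b)
      simp only [match_alt, match_cat, match_star, (hre _ _).2 ρ, this]

theorem path_iff_pathVia {p q : S} {i j : ℕ} :
    Path ρ step p i q j ↔ (p = q ∧ i = j) ∨ PathVia ρ step Set.univ p i q j := by
  constructor
  · intro h
    induction h with
    | refl => exact Or.inl ⟨rfl, rfl⟩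
    | cons h1 _ ih =>
      right
      rcases ih with ⟨rfl, rfl⟩ | ih
      · exact .single h1
      · exact .cons h1 trivial ih
  · rintro (⟨rfl, rfl⟩ | h)
    · exact .refl _ _
    · induction h with
      | single h1 => exact .cons h1 (.refl _ _)
      | cons h1 _ _ ih => exact .cons h1 ih

/-- Kleene's theorem. -/
theorem exists_definesPaths [Finite S] (step : S → S → Formula P) :
    ∃ re, DefinesPaths step re := by
  classical
  obtain ⟨re, hre⟩ := exists_pathVia step (Set.finite_univ (α := S))
  refine ⟨fun p q => if p = q then .alt .eps (re p q) else re p q, fun p q => ⟨?_, ?_⟩⟩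
  · dsimp only
    split_ifs
    · exact .alt .eps (hre p q).1
    · exact (hre p q).1
  · intro ρ i j
    rw [path_iff_pathVia]
    dsimp only
    split_ifs with h
    · simp [h, (hre _ _).2 ρ]
    · simp [h, (hre _ _).2 ρ]

/-- For partially ordered steps, the paths are defined by expressions in which only letters are
iterated. -/
theorem exists_definesPaths_of_isStrictOrder [Finite S] {lt : S → S → Prop} [IsStrictOrder S lt]
    (step : S → S → Formula P) (hstep : ∀ p q, step p q ≠ .fls → q = p ∨ lt q p) :
    ∃ re, DefinesPaths step re ∧ ∀ p q, (re p q).IsLetterStar := by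
  classical
  suffices ∀ p, ∃ re : S → RatExp (Formula P), ∀ q, (re q).IsLetterStar ∧
      (re q).LettersIn (fun ψ => ψ = .fls ∨ ∃ p q, ψ = step p q) ∧
      ∀ (ρ : TimedWord P) (i j : ℕ), Match ρ (re q) i j ↔ Path ρ step p i q j by
    choose re hre using this
    exact ⟨re, fun p q => (hre p q).2, fun p q => (hre p q).1⟩
  intro p
  induction p using (Finite.wellFounded_of_trans_of_irrefl lt).induction with
  | _ p ih =>
    have : Nonempty (RatExp (Formula P)) := ⟨.eps⟩
    choose! re hre using ih
    let tail : S → RatExp (Formula P) := fun q =>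
      .iAlt fun r : {r // lt r p} => .cat (.letter (step p r)) (re r q)
    have htail : ∀ q, (tail q).IsLetterStar ∧
        (tail q).LettersIn (fun ψ => ψ = .fls ∨ ∃ p q, ψ = step p q) := fun q =>
      ⟨.iAlt fun r => .cat (.letter _) (hre r r.2 q).1,
        .iAlt (Or.inl rfl) fun r => .cat (.letter (Or.inr ⟨_, _, rfl⟩)) (hre r r.2 q).2.1⟩
    refine ⟨fun q => .cat (.star (.letter (step p p)))
      (if p = q then .alt .eps (tail q) else tail q), fun q => ⟨?_, ?_, fun ρ i j => ?_⟩⟩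
    · refine .cat (.star _) ?_
      split_ifs
      · exact .alt .eps (htail q).1
      · exact (htail q).1
    · refine .cat (.star (.letter (Or.inr ⟨_, _, rfl⟩))) ?_
      split_ifs
      · exact .alt .eps (htail q).2
      · exact (htail q).2
    · have hiff : Match ρ (.cat (.star (.letter (step p p)))
          (if p = q then .alt .eps (tail q) else tail q)) i j ↔
          ∃ k, (i ≤ k ∧ ∀ m, i ≤ m → m < k → SatAt ρ (step p p) m) ∧
            ((p = q ∧ k = j) ∨ ∃ r, lt r p ∧ SatAt ρ (step p r) k ∧ Path ρ step r (k + 1) q j) := by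
        rw [match_cat]
        refine exists_congr fun k => and_congr match_star_letter ?_
        have : Match ρ (tail q) k j ↔
            ∃ r, lt r p ∧ SatAt ρ (step p r) k ∧ Path ρ step r (k + 1) q j := by
          simp only [tail, match_iAlt, match_cat, match_letter, Subtype.exists, exists_prop]
          refine exists_congr fun r => and_congr_right fun hr => ?_
          constructor
          · rintro ⟨_, ⟨rfl, h1⟩, h2⟩
            exact ⟨h1, ((hre r hr q).2.2 ρ _ _).1 h2⟩
          · rintro ⟨h1, h2⟩
            exact ⟨_, ⟨rfl, h1⟩, ((hre r hr q).2.2 ρ _ _).2 h2⟩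
        rw [← this]
        split_ifs with h <;> simp [h]
      rw [hiff]
      clear hiff
      constructor
      · rintro ⟨k, ⟨hik, h⟩, h'⟩
        have : Path ρ step p i p k := by
          clear h'
          induction k, hik using Nat.le_induction with
          | base => exact .refl _ _
          | succ k hk ih =>
            exact (path_succ_iff hk).2
              ⟨p, ih fun m h1 h2 => h m h1 (by omega), h k hk (by omega)⟩
        refine this.trans ?_
        rcases h' with ⟨rfl, rfl⟩ | ⟨r, -, h1, h2⟩
        · exact .refl _ _
        · exact .cons h1 h2
      · intro h
        obtain ⟨k, h1, h2⟩ := h.exists_leave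
        refine ⟨k, h1, h2.imp_right ?_⟩
        rintro ⟨r, hr, h3, h4⟩
        -- A step that is satisfied somewhere is not `fls`, so it goes to `p` or below, and `r ≠ p`.
        refine ⟨r, (hstep p r fun hf => ?_).resolve_left hr, h3, h4⟩
        rw [hf] at h3
        exact not_satAt_fls h3

end Path

/-! ### Letters and clock constraints as formulas -/

/-- The formula that holds at the positions with the symbol `a`. -/
noncomputable def Formula.ofLetter [Finite P] (a : Letter P) : Formula P :=
  .exactly (fun p : P => .atom p) a.1

@[simp] theorem satAt_ofLetter [Finite P] {a : Letter P} {ρ : TimedWord P} {k : ℕ} :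
    SatAt ρ (.ofLetter a) k ↔ ρ.letterAt k = a := by
  rw [Formula.ofLetter, satAt_exactly]
  simp only [satAt_atom]
  exact ⟨fun h => Subtype.ext h.symm, fun h => by rw [h]; rfl⟩

/-- `FRat` for the interval `[0, a]`, where `re₀` matches the segments that `re` matches and in which
no time elapses up to the next position. -/
def Formula.fratLe (a : ℕ) (re re₀ : RatExp (Formula P)) (φ : Formula P) : Formula P :=
  if a = 0 then .and .nextSimul (.frat (.ci 0) re₀ φ) else .frat (.cc 0 a) re φ

/-- `FRat` with a clock constraint in place of an interval. -/
def Formula.fratGuard (re re₀ : RatExp (Formula P)) (φ : Formula P) : Guard → Formula P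
  | .mem I => .frat I re φ
  | .notMem (.cc a b) => .orList [.frat (.co 0 a) re φ, .frat (.oi b) re φ]
  | .notMem (.co a b) => .orList [.frat (.co 0 a) re φ, .frat (.ci b) re φ]
  | .notMem (.oc a b) => .orList [.fratLe a re re₀ φ, .frat (.oi b) re φ]
  | .notMem (.oo a b) => .orList [.fratLe a re re₀ φ, .frat (.ci b) re φ]
  | .notMem (.ci a) => .frat (.co 0 a) re φ
  | .notMem (.oi a) => .fratLe a re re₀ φ

section

variable {re re₀ : RatExp (Formula P)} {φ : Formula P} {ρ : TimedWord P} {i : ℕ}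

/-- For `a = 0` the interval `[0, 0]` is punctual. The delay is then `0` iff no time elapses at any
step from `i` to `j`: `nextSimul` checks the first step, and `re₀` the others. -/
theorem satAt_fratLe {a : ℕ} (hi : i ≤ ρ.last)
    (h : ∀ j ≤ ρ.last, Match ρ re₀ (i + 1) j ↔
      Match ρ re (i + 1) j ∧ ∀ k, i < k → k < j → SatAt ρ .nextSimul k) :
    SatAt ρ (.fratLe a re re₀ φ) i ↔ ∃ j, i < j ∧ j ≤ ρ.last ∧ SatAt ρ φ j ∧
      ρ.timeAt j - ρ.timeAt i ≤ a ∧ Match ρ re (i + 1) j := by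
  have h0 : ∀ {j}, i < j → ρ.timeAt i ≤ ρ.timeAt j := fun h => ρ.timeAt_mono h.le
  rw [Formula.fratLe]
  split_ifs with ha
  · rw [satAt_and, satAt_frat hi]
    subst ha
    constructor
    · rintro ⟨hs, j, hj, hjl, h1, -, h2⟩
      obtain ⟨h2, h3⟩ := (h j hjl).1 h2
      refine ⟨j, hj, hjl, h1, ?_, h2⟩
      have : ∀ k, i ≤ k → k ≤ j → ρ.timeAt k = ρ.timeAt i := by
        intro k hk
        induction k, hk using Nat.le_induction with
        | base => exact fun _ => rfl
        | succ k hk ih =>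
          intro hkj
          rw [← ih (by omega), ← satAt_nextSimul (by omega)]
          rcases Nat.eq_or_lt_of_le hk with rfl | hk
          · exact hs
          · exact h3 k hk (by omega)
      rw [this j hj.le le_rfl]
      simp
    · rintro ⟨j, hj, hjl, h1, h2, h3⟩
      have hs : ∀ k, i ≤ k → k < j → SatAt ρ .nextSimul k := by
        intro k hk hkj
        rw [satAt_nextSimul (by omega)]
        have h4 := ρ.timeAt_mono hk
        have h5 := ρ.timeAt_mono (show k + 1 ≤ j from hkj)
        have h6 := ρ.timeAt_mono (Nat.le_succ k)
        simp only [Nat.cast_zero, Nat.succ_eq_add_one] at h2 h6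
        linarith
      refine ⟨hs i le_rfl hj, j, hj, hjl, h1, ?_, (h j hjl).2 ⟨h3, fun k hk => hs k hk.le⟩⟩
      simpa [Interval.toSet] using h0 hj
  · rw [satAt_frat hi]
    refine exists_congr fun j => and_congr_right fun hj => and_congr_right fun _ =>
      and_congr_right fun _ => and_congr_left fun _ => ?_
    have := h0 hj
    simp [Interval.toSet, this]

/-- Delays are nonnegative, so a negated constraint is a union of an initial interval ending at `a`
and a final one starting at `b`, of which one may be missing. -/
theorem satAt_fratGuard {g : Guard} (hi : i ≤ ρ.last)
    (h : ∀ j ≤ ρ.last, Match ρ re₀ (i + 1) j ↔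
      Match ρ re (i + 1) j ∧ ∀ k, i < k → k < j → SatAt ρ .nextSimul k) :
    SatAt ρ (.fratGuard re re₀ φ g) i ↔ ∃ j, i < j ∧ j ≤ ρ.last ∧ SatAt ρ φ j ∧
      g.Holds (ρ.timeAt j - ρ.timeAt i) ∧ Match ρ re (i + 1) j := by
  have h0 : ∀ {j}, i < j → 0 ≤ ρ.timeAt j - ρ.timeAt i := fun h =>
    sub_nonneg.2 (ρ.timeAt_mono h.le)
  have hor : ∀ {A B C : ℕ → Prop}, (∀ j, i < j → (C j ↔ A j ∨ B j)) →
      (((∃ j, i < j ∧ j ≤ ρ.last ∧ SatAt ρ φ j ∧ A j ∧ Match ρ re (i + 1) j) ∨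
        ∃ j, i < j ∧ j ≤ ρ.last ∧ SatAt ρ φ j ∧ B j ∧ Match ρ re (i + 1) j) ↔
      ∃ j, i < j ∧ j ≤ ρ.last ∧ SatAt ρ φ j ∧ C j ∧ Match ρ re (i + 1) j) := by
    intro A B C hC
    rw [← exists_or]
    refine exists_congr fun j => ?_
    by_cases hj : i < j
    · rw [hC j hj]
      tauto
    · simp [hj]
  have hone : ∀ {A C : ℕ → Prop}, (∀ j, i < j → (C j ↔ A j)) →
      ((∃ j, i < j ∧ j ≤ ρ.last ∧ SatAt ρ φ j ∧ A j ∧ Match ρ re (i + 1) j) ↔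
      ∃ j, i < j ∧ j ≤ ρ.last ∧ SatAt ρ φ j ∧ C j ∧ Match ρ re (i + 1) j) := by
    intro A C hC
    refine exists_congr fun j => and_congr_right fun hj => ?_
    rw [hC j hj]
  rcases g with I | I
  · exact satAt_frat hi
  · cases I <;> simp only [Formula.fratGuard, satAt_orList, List.mem_cons, List.not_mem_nil,
      or_false, exists_eq_or_imp, exists_eq_left, satAt_frat hi, satAt_fratLe hi h] <;>
    first
    | refine hor fun j hj => ?_
    | refine hone fun j hj => ?_
    all_goals
      have := h0 hj
      simp only [Guard.Holds, Interval.toSet, Set.mem_Icc, Set.mem_Ico, Set.mem_Ioc, Set.mem_Ioo,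
        Set.mem_Ici, Set.mem_Ioi, Nat.cast_zero, this, true_and, not_and_or, not_le, not_lt]

theorem Formula.Within.fratGuard {J : Interval → Prop} {R : RatExp (Formula P) → Prop}
    (hJ : ∀ I : Interval, ¬ I.Punctual → J I) (hR : R re) (hR₀ : R re₀)
    (hl : re.LettersIn (Formula.Within J R)) (hl₀ : re₀.LettersIn (Formula.Within J R))
    (hφ : φ.Within J R) {g : Guard} (hg : J g.interval) :
    (Formula.fratGuard re re₀ φ g).Within J R := by
  have hco : ∀ a b, J (.co a b) := fun a b => hJ _ (by rintro ⟨_, h⟩; cases h)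
  have hci : ∀ a, J (.ci a) := fun a => hJ _ (by rintro ⟨_, h⟩; cases h)
  have hoi : ∀ a, J (.oi a) := fun a => hJ _ (by rintro ⟨_, h⟩; cases h)
  have hor : ∀ {φ ψ : Formula P}, φ.Within J R → ψ.Within J R →
      (Formula.orList [φ, ψ]).Within J R := by
    intro φ ψ h1 h2
    refine .orList fun χ hχ => ?_
    simp only [List.mem_cons, List.not_mem_nil, or_false] at hχ
    rcases hχ with rfl | rfl
    · exact h1
    · exact h2
  have hle : ∀ a, (Formula.fratLe a re re₀ φ).Within J R := by
    intro a
    rw [Formula.fratLe]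
    split_ifs with ha
    · exact .and (.neg (.until (hoi 0) .fls .tru)) (.frat (hci 0) hR₀ hl₀ hφ)
    -- Here `a ≠ 0`, so `[0, a]` is not punctual.
    · refine .frat (hJ _ ?_) hR hl hφ
      rintro ⟨b, hb⟩
      injection hb with h1 h2
      omega
  have hf : ∀ I, J I → (Formula.frat I re φ).Within J R := fun I hI => .frat hI hR hl hφ
  rcases g with I | I
  · exact hf I hg
  · cases I
    · exact hor (hf _ (hco _ _)) (hf _ (hoi _))
    · exact hor (hf _ (hco _ _)) (hf _ (hci _))
    · exact hor (hle _) (hf _ (hoi _))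
    · exact hor (hle _) (hf _ (hci _))
    · exact hf _ (hco _ _)
    · exact hle _

end

end ATA

/-! ### From automata to formulas -/

namespace ATA

variable {P : Type*} {S : Type}

/-! ### Transition formulas as formulas of the logic -/

/-- Uniform clauses for the path analysis: a location or a clock constraint, together with a reset
combination. The latter can be evaluated at the reset time `now`, since it does not depend on the
clock. -/
theorem TForm.IsDisjunctive.exists_clauses {Q : Set S} {φ : TForm S} (h : φ.IsDisjunctive Q) :
    ∃ l : List ((S ⊕ Guard) × TForm S),
      (∀ c ∈ l, c.2.IsResetCombination ∧ c.2.boundLocs ⊆ φ.boundLocs ∧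
        (∀ q, c.1 = .inl q → q ∈ Q ∧ q ∈ φ.freeLocs) ∧
        ∀ g, c.1 = .inr g → g ∈ φ.guards ∨ g = .mem (.ci 0)) ∧
      ∀ (L : S → ℝ → Prop) (now t : ℝ), t ≤ now → (φ.Ev L now t ↔ ∃ c ∈ l,
        Sum.elim (fun q => L q t) (fun g => g.Holds (now - t)) c.1 ∧ c.2.Ev L now now) := by
  induction h with
  | @loc q hq =>
    refine ⟨[(.inl q, .top)], ?_, fun L now t _ => by simp [TForm.Ev]⟩
    intro c hc
    obtain rfl := List.mem_singleton.1 hc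
    refine ⟨.top, by simp [TForm.boundLocs], ?_, fun g hg => by cases hg⟩
    intro q' hq'
    cases hq'
    exact ⟨hq, rfl⟩
  | @locAnd q β hq hβ =>
    refine ⟨[(.inl q, β)], ?_, fun L now t _ => by
      simp [TForm.Ev, hβ.ev_iff (t := t) (t' := now)]⟩
    intro c hc
    obtain rfl := List.mem_singleton.1 hc
    refine ⟨hβ, by simp [TForm.boundLocs], ?_, fun g hg => by cases hg⟩
    intro q' hq'
    cases hq'
    exact ⟨hq, Or.inl rfl⟩
  | guard g =>
    refine ⟨[(.inr g, .top)], ?_, fun L now t _ => by simp [TForm.Ev]⟩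
    intro c hc
    obtain rfl := List.mem_singleton.1 hc
    refine ⟨.top, by simp [TForm.boundLocs], fun q hq => (by cases hq), ?_⟩
    intro g' hg'
    cases hg'
    exact Or.inl rfl
  | @guardAnd g β hβ =>
    refine ⟨[(.inr g, β)], ?_, fun L now t _ => by
      simp [TForm.Ev, hβ.ev_iff (t := t) (t' := now)]⟩
    intro c hc
    obtain rfl := List.mem_singleton.1 hc
    refine ⟨hβ, by simp [TForm.boundLocs], fun q hq => (by cases hq), ?_⟩
    intro g' hg'
    cases hg'
    exact Or.inl (Or.inl rfl)
  | @resets β hβ =>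
    -- A clause without location or constraint gets `x ∈ [0, ∞)`, which is true because `t ≤ now`,
    -- and which is not punctual.
    refine ⟨[(.inr (.mem (.ci 0)), β)], ?_, fun L now t ht => by
      simp [hβ.ev_iff (t := t) (t' := now), Guard.Holds, Interval.toSet, ht]⟩
    intro c hc
    obtain rfl := List.mem_singleton.1 hc
    refine ⟨hβ, subset_rfl, fun q hq => (by cases hq), ?_⟩
    intro g' hg'
    cases hg'
    exact Or.inr rfl
  | disj _ _ h1 h2 =>
    obtain ⟨l, hl, h1⟩ := h1
    obtain ⟨l', hl', h2⟩ := h2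
    refine ⟨l ++ l', ?_, ?_⟩
    · intro c hc
      rcases List.mem_append.1 hc with hc | hc
      · obtain ⟨k1, k2, k3, k4⟩ := hl c hc
        exact ⟨k1, fun p hp => Or.inl (k2 hp), fun q hq => ⟨(k3 q hq).1, Or.inl (k3 q hq).2⟩,
          fun g hg => (k4 g hg).imp_left Or.inl⟩
      · obtain ⟨k1, k2, k3, k4⟩ := hl' c hc
        exact ⟨k1, fun p hp => Or.inr (k2 hp), fun q hq => ⟨(k3 q hq).1, Or.inr (k3 q hq).2⟩,
          fun g hg => (k4 g hg).imp_left Or.inr⟩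
    · intro L now t ht
      simp only [TForm.Ev, h1 L now t ht, h2 L now t ht, List.mem_append, or_and_right, exists_or]

open Classical in
/-- The formula obtained from a transition formula that is evaluated with the clock value `0`,
where the formulas `Φ s` stand for the locations. -/
noncomputable def TForm.toFormula (Φ : S → Formula P) : TForm S → Formula P
  | top => .tru
  | bot => .fls
  | conj φ ψ => .and (φ.toFormula Φ) (ψ.toFormula Φ)
  | disj φ ψ => .orList [φ.toFormula Φ, ψ.toFormula Φ]
  | loc s => Φ s
  | guard g => if g.Holds 0 then .tru else .fls
  | reset φ => φ.toFormula Φ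

theorem TForm.satAt_toFormula {Φ : S → Formula P} {L : S → ℝ → Prop} {now : ℝ}
    {ρ : TimedWord P} {k : ℕ} {φ : TForm S}
    (h : ∀ s ∈ φ.freeLocs ∪ φ.boundLocs, SatAt ρ (Φ s) k ↔ L s now) :
    SatAt ρ (φ.toFormula Φ) k ↔ φ.Ev L now now := by
  induction φ with
  | top => simp [toFormula, Ev]
  | bot => simp [toFormula, Ev]
  | conj φ ψ h1 h2 =>
    rw [toFormula, satAt_and, Ev, h1, h2]
    · exact fun s hs => h s (hs.imp Or.inr Or.inr)
    · exact fun s hs => h s (hs.imp Or.inl Or.inl)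
  | disj φ ψ h1 h2 =>
    rw [Ev, ← h1, ← h2]
    · simp [toFormula]
    · exact fun s hs => h s (hs.imp Or.inr Or.inr)
    · exact fun s hs => h s (hs.imp Or.inl Or.inl)
  | loc s => exact h s (Or.inl rfl)
  | guard g =>
    rw [toFormula, Ev, sub_self]
    split_ifs with hg <;> simp [hg]
  | reset φ h1 => exact h1 fun s hs => h s (Or.inr hs)

theorem Formula.Within.toFormula {J : Interval → Prop} {R : RatExp (Formula P) → Prop}
    {Φ : S → Formula P} (hΦ : ∀ s, (Φ s).Within J R) (φ : TForm S) :
    (φ.toFormula Φ).Within J R := by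
  induction φ with
  | top => exact .tru
  | bot => exact .fls
  | conj φ ψ h1 h2 => exact .and h1 h2
  | disj φ ψ h1 h2 =>
    refine .orList fun χ hχ => ?_
    simp only [List.mem_cons, List.not_mem_nil, or_false] at hχ
    rcases hχ with rfl | rfl
    · exact h1
    · exact h2
  | loc s => exact hΦ s
  | guard g =>
    rw [TForm.toFormula]
    split_ifs
    · exact .tru
    · exact .fls
  | reset φ h => exact h

theorem Formula.Within.ofLetter [Finite P] {J : Interval → Prop}
    {R : RatExp (Formula P) → Prop} (a : Letter P) : (Formula.ofLetter a).Within J R := by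
  refine .iAnd fun p => ?_
  split_ifs
  · exact .atom p
  · exact .neg (.atom p)

/-! ### Islands as formulas -/

/-- Reachability along free locations. -/
def FreeReach (δ : S → Letter P → TForm S) : S → S → Prop :=
  Relation.ReflTransGen fun p q => ∃ a, q ∈ (δ p a).freeLocs

/-- The formula `Φ p` expresses acceptance by the location `p` with a clock that has just been
reset. -/
def Expresses (δ : S → Letter P → TForm S) (F : Set S) (p : S) (φ : Formula P) : Prop :=
  ∀ (ρ : TimedWord P) (k : ℕ), k ≤ ρ.last →
    (SatAt ρ φ k ↔ Accept δ F ρ (k + 1) p (ρ.timeAt k))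

/-- A clause of the transition formula of `q` with a clock constraint is satisfied. -/
def ClauseExit [Finite P] (Φ : S → Formula P) (cl : S → Letter P → List ((S ⊕ Guard) × TForm S))
    (ρ : TimedWord P) (q : S) (k : ℕ) (t : ℝ) : Prop :=
  ∃ c ∈ cl q (ρ.letterAt k), ∃ g, c.1 = .inr g ∧ SatAt ρ (c.2.toFormula Φ) k ∧
    g.Holds (ρ.timeAt k - t)

open Classical in
/-- A clause of the transition formula of `p` with the location `q` is satisfied. -/
noncomputable def clauseStep [Finite P] (δ : S → Letter P → TForm S) (Φ : S → Formula P)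
    (cl : S → Letter P → List ((S ⊕ Guard) × TForm S)) (p q : S) : Formula P :=
  if ∃ a, q ∈ (δ p a).freeLocs then
    .iOr fun a => .and (.ofLetter a) (.orList ((cl p a).map fun c =>
      if c.1 = .inl q then c.2.toFormula Φ else .fls))
  else .fls

section Island

variable [Finite P] {δ : S → Letter P → TForm S} {F : Set S}
  {Φ : S → Formula P} {cl : S → Letter P → List ((S ⊕ Guard) × TForm S)} {ρ : TimedWord P}

theorem satAt_clauseStep {p q : S} {k : ℕ} : SatAt ρ (clauseStep δ Φ cl p q) k ↔
    (∃ a, q ∈ (δ p a).freeLocs) ∧ ∃ c ∈ cl p (ρ.letterAt k), c.1 = .inl q ∧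
      SatAt ρ (c.2.toFormula Φ) k := by
  rw [clauseStep]
  split_ifs with h
  · simp only [h, true_and, satAt_iOr, satAt_and, satAt_ofLetter, exists_eq_left', satAt_orList,
      List.mem_map, exists_exists_and_eq_and]
    refine exists_congr fun c => and_congr_right fun _ => ?_
    split_ifs with hc <;> simp [hc]
  · simp [h]

/-- A satisfied clause passes the obligation to at most one location with the same reset time `t`.
Its other part is expressed by `Φ`, so the obligations form a single path, which ends with the word
or with a clause that has a clock constraint. -/
theorem accept_iff_path {Q : Set S} {s : S} (hs : s ∈ Q)
    (hcl : ∀ q a, ∀ c ∈ cl q a, c.2.IsResetCombination ∧ c.2.boundLocs ⊆ (δ q a).boundLocs ∧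
        (∀ p, c.1 = .inl p → p ∈ Q ∧ p ∈ (δ q a).freeLocs))
    (hev : ∀ q ∈ Q, ∀ a, ∀ (L : S → ℝ → Prop) (now t : ℝ), t ≤ now →
      ((δ q a).Ev L now t ↔ ∃ c ∈ cl q a,
        Sum.elim (fun q => L q t) (fun g => g.Holds (now - t)) c.1 ∧ c.2.Ev L now now))
    (hΦ : ∀ q, FreeReach δ s q → ∀ a, ∀ p ∈ (δ q a).boundLocs, Expresses δ F p (Φ p))
    {k : ℕ} (hk : k ≤ ρ.last + 1) {t : ℝ} (ht : t ≤ ρ.timeAt k) :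
    Accept δ F ρ k s t ↔ (∃ p ∈ F, Path ρ (clauseStep δ Φ cl) s k p (ρ.last + 1)) ∨
      ∃ p j, j ≤ ρ.last ∧ Path ρ (clauseStep δ Φ cl) s k p j ∧ ClauseExit Φ cl ρ p j t := by
  induction hk using Nat.decreasingInduction generalizing s with
  | self =>
    rw [accept_end]
    constructor
    · exact fun h => Or.inl ⟨s, h, .refl _ _⟩
    · rintro (⟨p, hp, h⟩ | ⟨p, j, hj, h, -⟩)
      · rcases path_iff.1 h with ⟨rfl, -⟩ | ⟨_, -, h⟩
        · exact hp
        · have := h.le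
          omega
      · have := h.le
        omega
  | of_succ k hk ih =>
    rw [accept_iff (by omega), hev s hs _ _ _ _ ht]
    have hmono : t ≤ ρ.timeAt (k + 1) := ht.trans (ρ.timeAt_mono (Nat.le_succ k))
    have hsat : ∀ c ∈ cl s (ρ.letterAt k), SatAt ρ (c.2.toFormula Φ) k ↔
        c.2.Ev (Accept δ F ρ (k + 1)) (ρ.timeAt k) (ρ.timeAt k) := by
      intro c hc
      obtain ⟨h1, h2, -⟩ := hcl _ _ c hc
      apply TForm.satAt_toFormula
      rw [h1.freeLocs_eq, Set.empty_union]
      exact fun p hp => hΦ s .refl _ p (h2 hp) ρ k (by omega)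
    -- What is freely reachable from `p` is so from `s`; hence the hypothesis on `Φ` passes to `p`.
    have hih : ∀ p, (∃ a, p ∈ (δ s a).freeLocs) → p ∈ Q → _ := fun p hp hpQ =>
      ih (s := p) hpQ (fun q hq => hΦ q (.head hp hq)) hmono
    constructor
    · rintro ⟨c, hc, h1, h2⟩
      rcases hc1 : c.1 with p | g
      · obtain ⟨hpQ, hp⟩ := (hcl _ _ c hc).2.2 p hc1
        rw [hc1] at h1
        have hstep : SatAt ρ (clauseStep δ Φ cl s p) k :=
          satAt_clauseStep.2 ⟨⟨_, hp⟩, c, hc, hc1, (hsat c hc).2 h2⟩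
        rcases (hih p ⟨_, hp⟩ hpQ).1 h1 with ⟨q, hq, h3⟩ | ⟨q, j, hj, h3, h4⟩
        · exact Or.inl ⟨q, hq, .cons hstep h3⟩
        · exact Or.inr ⟨q, j, hj, .cons hstep h3, h4⟩
      · rw [hc1] at h1
        exact Or.inr ⟨s, k, by omega, .refl _ _, c, hc, g, hc1, (hsat c hc).2 h2, h1⟩
    · have hcons : ∀ p, SatAt ρ (clauseStep δ Φ cl s p) k → Accept δ F ρ (k + 1) p t →
          ∃ c ∈ cl s (ρ.letterAt k), Sum.elim (fun q => Accept δ F ρ (k + 1) q t)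
            (fun g => g.Holds (ρ.timeAt k - t)) c.1 ∧
              c.2.Ev (Accept δ F ρ (k + 1)) (ρ.timeAt k) (ρ.timeAt k) := by
        intro p hp hacc
        obtain ⟨-, c, hc, hc1, h⟩ := satAt_clauseStep.1 hp
        exact ⟨c, hc, by rw [hc1]; exact hacc, (hsat c hc).1 h⟩
      have hmem : ∀ p, SatAt ρ (clauseStep δ Φ cl s p) k →
          (∃ a, p ∈ (δ s a).freeLocs) ∧ p ∈ Q := by
        intro p hp
        obtain ⟨h, c, hc, hc1, -⟩ := satAt_clauseStep.1 hp
        exact ⟨h, ((hcl _ _ c hc).2.2 p hc1).1⟩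
      rintro (⟨p, hp, h⟩ | ⟨p, j, hj, h, h'⟩)
      · rcases path_iff.1 h with ⟨-, h⟩ | ⟨q, h1, h2⟩
        · omega
        · exact hcons q h1 ((hih q (hmem q h1).1 (hmem q h1).2).2 (Or.inl ⟨p, hp, h2⟩))
      · rcases path_iff.1 h with ⟨rfl, rfl⟩ | ⟨q, h1, h2⟩
        · obtain ⟨c, hc, g, hc1, h3, h4⟩ := h'
          exact ⟨c, hc, by rw [hc1]; exact h4, (hsat c hc).1 h3⟩
        · exact hcons q h1 ((hih q (hmem q h1).1 (hmem q h1).2).2 (Or.inr ⟨p, j, hj, h2, h'⟩))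

/-- The two ways in which a path may end, written with `FRat` over the path expressions. The clock
was reset at `k`, so a clock constraint at `j` bounds exactly the delay from `k` to `j`. -/
theorem exists_expresses_of_isDisjunctive [Finite S] {J : Interval → Prop}
    {R : RatExp (Formula P) → Prop} (hJ : ∀ I : Interval, ¬ I.Punctual → J I)
    (hR : ∀ step : S → S → Formula P,
      (∀ p q, step p q ≠ .fls → ∃ a, q ∈ (δ p a).freeLocs) →
        ∃ re, DefinesPaths step re ∧ ∀ p q, R (re p q))
    {Q : Set S} (hQ : ∀ q ∈ Q, ∀ a, (δ q a).IsDisjunctive Q)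
    (hg : ∀ q a, ∀ g ∈ (δ q a).guards, J g.interval) {s : S} (hs : s ∈ Q)
    (hΦJ : ∀ p, (Φ p).Within J R)
    (hΦ : ∀ q, FreeReach δ s q → ∀ a, ∀ p ∈ (δ q a).boundLocs, Expresses δ F p (Φ p)) :
    ∃ φ : Formula P, φ.Within J R ∧ Expresses δ F s φ := by
  classical
  have hci : ∀ a, J (.ci a) := fun a => hJ _ (by rintro ⟨_, h⟩; cases h)
  have hcl : ∀ q a, ∃ l : List ((S ⊕ Guard) × TForm S),
      (∀ c ∈ l, (c.2.IsResetCombination ∧ c.2.boundLocs ⊆ (δ q a).boundLocs ∧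
        (∀ p, c.1 = .inl p → p ∈ Q ∧ p ∈ (δ q a).freeLocs)) ∧
        ∀ g, c.1 = .inr g → J g.interval) ∧
      (q ∈ Q → ∀ (L : S → ℝ → Prop) (now t : ℝ), t ≤ now → ((δ q a).Ev L now t ↔ ∃ c ∈ l,
        Sum.elim (fun q => L q t) (fun g => g.Holds (now - t)) c.1 ∧ c.2.Ev L now now)) := by
    intro q a
    by_cases hq : q ∈ Q
    · obtain ⟨l, hl, hev⟩ := (hQ q hq a).exists_clauses
      refine ⟨l, fun c hc => ?_, fun _ => hev⟩
      obtain ⟨h1, h2, h3, h4⟩ := hl c hc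
      refine ⟨⟨h1, h2, h3⟩, fun g hgc => ?_⟩
      rcases h4 g hgc with h | rfl
      · exact hg q a g h
      · exact hci 0
    -- Paths from `s` stay in `Q`, so the clauses of other locations are irrelevant.
    · exact ⟨[], fun c hc => (List.not_mem_nil hc).elim, fun h => (hq h).elim⟩
  choose cl hcl hev using hcl
  set step := clauseStep δ Φ cl with hstep
  have hfree : ∀ p q, step p q ≠ .fls → ∃ a, q ∈ (δ p a).freeLocs := by
    intro p q h
    by_contra hne
    exact h (by rw [hstep, clauseStep, if_neg hne])
  have hstepJ : ∀ p q, (step p q).Within J R := by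
    intro p q
    rw [hstep, clauseStep]
    split_ifs
    · refine .iOr fun a => .and (.ofLetter a) (.orList fun φ hφ => ?_)
      obtain ⟨c, -, rfl⟩ := List.mem_map.1 hφ
      split_ifs
      · exact .toFormula hΦJ _
      · exact .fls
    · exact .fls
  obtain ⟨re, hre, hreR⟩ := hR step hfree
  -- The paths along which no time elapses, for the interval `[0, 0]`. Steps that are `fls` stay
  -- literally `fls`, as `hR` allows other formulas only along free locations.
  obtain ⟨re₀, hre₀, hreR₀⟩ := hR
    (fun p q => if step p q = .fls then .fls else .and (step p q) .nextSimul) (by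
      intro p q h
      apply hfree
      rintro h'
      simp [h'] at h)
  have hreJ : ∀ p q, (re p q).LettersIn (Formula.Within J R) := by
    intro p q ψ hψ
    rcases (hre p q).1 ψ hψ with rfl | ⟨p, q, rfl⟩
    · exact .fls
    · exact hstepJ p q
  have hreJ₀ : ∀ p q, (re₀ p q).LettersIn (Formula.Within J R) := by
    intro p q ψ hψ
    rcases (hre₀ p q).1 ψ hψ with rfl | ⟨p, q, rfl⟩
    · exact .fls
    · dsimp only
      split_ifs
      · exact .fls
      · exact .and (hstepJ p q)
          (.neg (.until (hJ _ (by rintro ⟨_, h⟩; cases h)) .fls .tru))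
  have hpath₀ : ∀ (ρ : TimedWord P) p q i j, Match ρ (re₀ p q) i j ↔
      Match ρ (re p q) i j ∧ ∀ k, i ≤ k → k < j → SatAt ρ .nextSimul k := by
    intro ρ p q i j
    rw [(hre₀ p q).2, (hre p q).2]
    constructor
    · intro h
      induction h with
      | refl => exact ⟨.refl _ _, fun k _ _ => by omega⟩
      | cons h1 _ ih =>
        split_ifs at h1
        · exact (not_satAt_fls h1).elim
        · rw [satAt_and] at h1
          refine ⟨.cons h1.1 ih.1, fun k hk hkj => ?_⟩
          rcases Nat.eq_or_lt_of_le hk with rfl | hk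
          · exact h1.2
          · exact ih.2 k hk hkj
    · rintro ⟨h, h'⟩
      induction h with
      | refl => exact .refl _ _
      | cons h1 h2 ih =>
        have hle := h2.le
        refine .cons ?_ (ih fun k hk hkj => h' k (by omega) hkj)
        rw [if_neg (fun hf => by rw [hf] at h1; exact not_satAt_fls h1), satAt_and]
        exact ⟨h1, h' _ le_rfl (by omega)⟩
  -- No symbol is left after the position `k`.
  let φ₁ : Formula P := if s ∈ F then .atEnd else .fls
  -- The path reads the rest of the word. `FRat` needs a target that is a position of the word, so
  -- the step that reads the last symbol is split off and checked there.
  let φ₂ : Formula P := .iOr fun p : S => .iOr fun q : S =>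
    if q ∈ F then .frat (.ci 0) (re s p) (.and .atEnd (step p q)) else .fls
  -- The path leaves at `p` through a clause with a clock constraint; clauses with a location
  -- contribute nothing.
  let φ₃ : Formula P := .iOr fun p : S => .iOr fun a : Letter P => .orList ((cl p a).map fun c =>
    Sum.elim (fun _ => .fls) (.fratGuard (re s p) (re₀ s p)
      (.and (.ofLetter a) (c.2.toFormula Φ))) c.1)
  refine ⟨.orList [φ₁, φ₂, φ₃], .orList fun ψ hψ => ?_, fun ρ k hk => ?_⟩
  · simp only [List.mem_cons, List.not_mem_nil, or_false] at hψ
    have hend : (Formula.atEnd : Formula P).Within J R := .neg (.until (hci 0) .tru .tru)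
    rcases hψ with rfl | rfl | rfl
    · dsimp only [φ₁]
      split_ifs
      · exact hend
      · exact .fls
    · refine .iOr fun p => .iOr fun q => ?_
      split_ifs
      · exact .frat (hci 0) (hreR _ _) (hreJ _ _) (.and hend (hstepJ _ _))
      · exact .fls
    · refine .iOr fun p => .iOr fun a => .orList fun ψ hψ => ?_
      obtain ⟨c, hc, rfl⟩ := List.mem_map.1 hψ
      rcases hc1 : c.1 with q | g
      · exact .fls
      · exact .fratGuard hJ (hreR _ _) (hreR₀ _ _) (hreJ _ _) (hreJ₀ _ _)
          (.and (.ofLetter a) (.toFormula hΦJ _)) ((hcl p a c hc).2 g hc1)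
  · rw [accept_iff_path (Q := Q) hs (fun q a c hc => (hcl q a c hc).1)
      (fun q hq a => hev q a hq) hΦ (by omega) (ρ.timeAt_mono (Nat.le_succ k)), ← hstep]
    have h₁ : SatAt ρ φ₁ k ↔ k = ρ.last ∧ s ∈ F := by
      dsimp only [φ₁]
      split_ifs with h <;> simp [h, satAt_atEnd hk]
    have h₂ : SatAt ρ φ₂ k ↔ k < ρ.last ∧ ∃ q ∈ F, Path ρ step s (k + 1) q (ρ.last + 1) := by
      simp only [φ₂, satAt_iOr]
      constructor
      · rintro ⟨p, q, h⟩
        split_ifs at h with hq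
        · obtain ⟨j, hj, hjl, h1, -, h2⟩ := (satAt_frat hk).1 h
          rw [satAt_and, satAt_atEnd hjl] at h1
          obtain ⟨rfl, h1⟩ := h1
          exact ⟨hj, q, hq, (path_succ_iff (by omega)).2 ⟨p, ((hre s p).2 _ _ _).1 h2, h1⟩⟩
        · exact (not_satAt_fls h).elim
      · rintro ⟨hlt, q, hq, h⟩
        obtain ⟨p, h1, h2⟩ := (path_succ_iff (by omega)).1 h
        refine ⟨p, q, ?_⟩
        rw [if_pos hq, satAt_frat hk]
        refine ⟨ρ.last, hlt, le_rfl, satAt_and.2 ⟨(satAt_atEnd le_rfl).2 rfl, h2⟩, ?_,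
          ((hre s p).2 _ _ _).2 h1⟩
        simpa [Interval.toSet] using ρ.timeAt_mono hk
    have h₃ : SatAt ρ φ₃ k ↔ ∃ p j, j ≤ ρ.last ∧ Path ρ step s (k + 1) p j ∧
        ClauseExit Φ cl ρ p j (ρ.timeAt k) := by
      have hfg : ∀ (p : S) (ψ : Formula P) (g : Guard),
          SatAt ρ (.fratGuard (re s p) (re₀ s p) ψ g) k ↔ ∃ j, k < j ∧ j ≤ ρ.last ∧ SatAt ρ ψ j ∧
            g.Holds (ρ.timeAt j - ρ.timeAt k) ∧ Path ρ step s (k + 1) p j := by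
        intro p ψ g
        rw [satAt_fratGuard hk fun j _ => hpath₀ ρ s p (k + 1) j]
        simp only [(hre s p).2 ρ]
      simp only [φ₃, satAt_iOr, satAt_orList, List.mem_map, exists_exists_and_eq_and]
      refine exists_congr fun p => ?_
      constructor
      · rintro ⟨a, c, hc, h⟩
        rcases hc1 : c.1 with q | g
        · rw [hc1] at h
          exact (not_satAt_fls h).elim
        · rw [hc1, Sum.elim_inr, hfg] at h
          obtain ⟨j, hj, hjl, h1, h2, h3⟩ := h
          rw [satAt_and, satAt_ofLetter] at h1
          obtain ⟨rfl, h1⟩ := h1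
          exact ⟨j, hjl, h3, c, hc, g, hc1, h1, h2⟩
      · rintro ⟨j, hjl, h, c, hc, g, hc1, h1, h2⟩
        refine ⟨ρ.letterAt j, c, hc, ?_⟩
        rw [hc1, Sum.elim_inr, hfg]
        have := h.le
        exact ⟨j, by omega, hjl, satAt_and.2 ⟨satAt_ofLetter.2 rfl, h1⟩, h2, h⟩
    simp only [satAt_orList, List.mem_cons, List.not_mem_nil, or_false, exists_eq_or_imp,
      exists_eq_left, h₁, h₂, h₃]
    rw [← or_assoc]
    refine or_congr_left ?_
    rcases Nat.eq_or_lt_of_le hk with rfl | hlt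
    · constructor
      · rintro (⟨-, h⟩ | ⟨h, -⟩)
        · exact ⟨s, h, .refl _ _⟩
        · omega
      · rintro ⟨p, hp, h⟩
        rcases path_iff.1 h with ⟨rfl, -⟩ | ⟨_, -, h⟩
        · exact Or.inl ⟨rfl, hp⟩
        · have := h.le
          omega
    · simp [hlt, hlt.ne]

end Island

/-! ### From automata to formulas -/

/-- Induction along `lt`: all resets reachable from `s` without a reset lead strictly below `s`, so
their formulas exist already. The hypothesis `hR` is the only point where the general and the
partially ordered case differ. -/
theorem OneATA.exists_formula [Finite P] {A : OneATA P} {J : Interval → Prop}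
    {R : RatExp (Formula P) → Prop} (hJ : ∀ I : Interval, ¬ I.Punctual → J I)
    (hR : ∀ step : A.Loc → A.Loc → Formula P,
      (∀ p q, step p q ≠ .fls → ∃ a, q ∈ (A.δ p a).freeLocs) →
        ∃ re, DefinesPaths step re ∧ ∀ p q, R (re p q))
    (hg : ∀ q a, ∀ g ∈ (A.δ q a).guards, J g.interval) (hcd : A.IsConjunctiveDisjunctive)
    {lt : A.Loc → A.Loc → Prop} [IsStrictOrder A.Loc lt]
    (hlt : ∀ s q, FreeReach A.δ s q → ∀ a, ∀ p ∈ (A.δ q a).boundLocs, lt p s) :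
    ∃ φ : Formula P, φ.Within J R ∧ A.language = φ.language := by
  classical
  have := A.finite_loc
  obtain ⟨Q, hQ⟩ := hcd
  have key : ∀ s, ∃ φ : Formula P, φ.Within J R ∧ Expresses A.δ A.final s φ := by
    intro s
    induction s using (Finite.wellFounded_of_trans_of_irrefl lt).induction with
    | _ s ih =>
      have : Nonempty (Formula P) := ⟨.tru⟩
      choose! Φ hΦJ hΦ using ih
      -- The value `tru` elsewhere is a default; only locations below `s` are consulted.
      let Φ' : A.Loc → Formula P := fun p => if lt p s then Φ p else .tru
      have hΦJ' : ∀ p, (Φ' p).Within J R := by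
        intro p
        dsimp only [Φ']
        split_ifs with h
        · exact hΦJ p h
        · exact .tru
      have hΦ' : ∀ q, FreeReach A.δ s q → ∀ a, ∀ p ∈ (A.δ q a).boundLocs,
          Expresses A.δ A.final p (Φ' p) := by
        intro q hq a p hp
        have hps := hlt s q hq a p hp
        dsimp only [Φ']
        rw [if_pos hps]
        exact hΦ p hps
      -- A conjunctive location is disjunctive in the dual automaton, where the negated formulas
      -- express the resets; the formula found there is negated.
      by_cases hs : s ∈ Q
      · have hfree : ∀ p a, ((A.δ p a).dual).freeLocs = (A.δ p a).freeLocs :=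
          fun p a => TForm.freeLocs_dual _
        obtain ⟨φ, hφ, h⟩ := exists_expresses_of_isDisjunctive
          (δ := fun s a => (A.δ s a).dual) (F := A.finalᶜ) (Φ := fun p => .neg (Φ' p)) (Q := Q)
          (J := J) (R := R) hJ (by simpa only [hfree] using hR)
          (fun q hq a => ((hQ q a).1 hq).dual) (fun q a => TForm.guards_dual (hg q a)) hs
          (fun p => .neg (hΦJ' p)) (by
            intro q hq a p hp ρ k hk
            rw [TForm.boundLocs_dual] at hp
            rw [FreeReach] at hq
            simp only [hfree] at hq
            rw [satAt_neg, hΦ' q hq a p hp ρ k hk, accept_dual])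
        refine ⟨.neg φ, .neg hφ, fun ρ k hk => ?_⟩
        rw [satAt_neg, h ρ k hk, accept_dual, not_not]
      · exact exists_expresses_of_isDisjunctive (Q := Qᶜ) hJ hR (fun q hq a => (hQ q a).2 hq) hg hs
          hΦJ' hΦ'
  choose Φ hΦJ hΦ using key
  -- `Φ` speaks of acceptance from the next position on, so the first symbol is read explicitly by
  -- the transition formula of the initial location, with clock value `0`.
  refine ⟨.iOr fun a => .and (.ofLetter a) ((A.δ A.init a).toFormula Φ),
    .iOr fun a => .and (.ofLetter a) (.toFormula hΦJ _), ?_⟩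
  ext ρ
  rw [OneATA.mem_language, Formula.mem_language, accept_iff (Nat.zero_le _), ρ.timeAt_zero]
  simp only [satAt_iOr, satAt_and, satAt_ofLetter, exists_eq_left']
  refine (TForm.satAt_toFormula fun s _ => ?_).symm
  rw [hΦ s ρ 0 (Nat.zero_le _), ρ.timeAt_zero]

/-- Locations are compared by their headers: free moves keep the header, and a bound location is its
own header. -/
theorem OneATA.HasLoopFreeResets.exists_order {A : OneATA P} (hA : A.HasLoopFreeResets) :
    ∃ lt : A.Loc → A.Loc → Prop, IsStrictOrder A.Loc lt ∧
      ∀ s q, FreeReach A.δ s q → ∀ a, ∀ p ∈ (A.δ q a).boundLocs, lt p s := by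
  obtain ⟨header, lt, hn, hlt, h⟩ := hA
  refine ⟨fun p q => lt (header p) (header q), ?_, fun s q hq a p hp => ?_⟩
  · exact { irrefl := fun a => hlt.irrefl _, trans := fun a b c => hlt.trans _ _ _ }
  · have : header q = header s := by
      clear hp
      induction hq with
      | refl => rfl
      | tail _ h2 ih =>
        obtain ⟨b, h2⟩ := h2
        rw [← ih, (hn.free _ b _ h2).1]
    change lt (header p) (header s)
    rw [hn.bound q a p hp, ← this]
    exact h q a p hp

/-- Free moves never go up, and a bound location differs from the location that resets to it, so it
lies strictly below. -/
theorem OneATA.IsPartiallyOrdered.exists_order {A : OneATA P} (hA : A.IsPartiallyOrdered) :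
    ∃ lt : A.Loc → A.Loc → Prop, IsStrictOrder A.Loc lt ∧
      (∀ p q, (∃ a, q ∈ (A.δ p a).freeLocs) → q = p ∨ lt q p) ∧
      ∀ s q, FreeReach A.δ s q → ∀ a, ∀ p ∈ (A.δ q a).boundLocs, lt p s := by
  obtain ⟨lt, hlt, h⟩ := hA
  have hfree : ∀ p q, (∃ a, q ∈ (A.δ p a).freeLocs) → q = p ∨ lt q p := by
    rintro p q ⟨a, hq⟩
    exact (h p a).1 q (Or.inl hq)
  refine ⟨lt, hlt, hfree, fun s q hq a p hp => ?_⟩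
  have hpq : lt p q := by
    rcases (h q a).1 p (Or.inr hp) with rfl | hpq
    · exact ((h p a).2 hp).elim
    · exact hpq
  have hqs : q = s ∨ lt q s := by
    clear hp hpq
    induction hq with
    | refl => exact Or.inl rfl
    | tail _ h2 ih =>
      rcases hfree _ _ h2 with rfl | h2
      · exact ih
      · rcases ih with rfl | ih
        · exact Or.inr h2
        · exact Or.inr (hlt.trans _ _ _ h2 ih)
  rcases hqs with rfl | hqs
  · exact hpq
  · exact hlt.trans _ _ _ hpq hqs

end ATA

/-! ### Position automata and renaming of locations -/

namespace ATA

/-! ### Position automata of rational expressions -/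

/-- Automata whose states are an initial state and positions, each of which is entered with a fixed
letter. -/
structure PosAut (α : Type*) where
  Pos : Type
  label : Pos → α
  follow : Option Pos → Pos → Prop
  final : Option Pos → Prop

/-- Acceptance of a word from a state. -/
def PosAut.Accepts {α : Type*} (M : PosAut α) : Option M.Pos → List α → Prop
  | q, [] => M.final q
  | q, a :: w => ∃ p, M.follow q p ∧ M.label p = a ∧ M.Accepts (some p) w

namespace PosAut

variable {α : Type*} (M N : PosAut α)

/-- Disjoint alternatives. -/
def alt : PosAut α where
  Pos := M.Pos ⊕ N.Pos
  label := Sum.elim M.label N.label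
  follow
    | none, .inl q => M.follow none q
    | none, .inr q => N.follow none q
    | some (.inl p), .inl q => M.follow (some p) q
    | some (.inr p), .inr q => N.follow (some p) q
    | _, _ => False
  final
    | none => M.final none ∨ N.final none
    | some (.inl p) => M.final (some p)
    | some (.inr p) => N.final (some p)

/-- Concatenation. -/
def cat : PosAut α where
  Pos := M.Pos ⊕ N.Pos
  label := Sum.elim M.label N.label
  follow
    | none, .inl q => M.follow none q
    | none, .inr q => M.final none ∧ N.follow none q
    | some (.inl p), .inl q => M.follow (some p) q
    | some (.inl p), .inr q => M.final (some p) ∧ N.follow none q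
    | some (.inr p), .inr q => N.follow (some p) q
    | some (.inr _), .inl _ => False
  final
    | none => M.final none ∧ N.final none
    | some (.inl p) => M.final (some p) ∧ N.final none
    | some (.inr p) => N.final (some p)

/-- Iteration. -/
def star : PosAut α where
  Pos := M.Pos
  label := M.label
  follow p q := M.follow p q ∨ (M.final p ∧ M.follow none q)
  final
    | none => True
    | some p => M.final (some p)

variable {M N}

theorem accepts_alt_inl {p : M.Pos} {w : List α} :
    (M.alt N).Accepts (some (.inl p)) w ↔ M.Accepts (some p) w := by
  induction w generalizing p with
  | nil => rfl
  | cons a w ih =>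
    constructor
    · rintro ⟨q | q, h1, h2, h3⟩
      · exact ⟨q, h1, h2, ih.1 h3⟩
      · exact h1.elim
    · rintro ⟨q, h1, h2, h3⟩
      exact ⟨.inl q, h1, h2, ih.2 h3⟩

theorem accepts_alt_inr {p : N.Pos} {w : List α} :
    (M.alt N).Accepts (some (.inr p)) w ↔ N.Accepts (some p) w := by
  induction w generalizing p with
  | nil => rfl
  | cons a w ih =>
    constructor
    · rintro ⟨q | q, h1, h2, h3⟩
      · exact h1.elim
      · exact ⟨q, h1, h2, ih.1 h3⟩
    · rintro ⟨q, h1, h2, h3⟩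
      exact ⟨.inr q, h1, h2, ih.2 h3⟩

theorem accepts_alt {w : List α} :
    (M.alt N).Accepts none w ↔ M.Accepts none w ∨ N.Accepts none w := by
  rcases w with _ | ⟨a, w⟩
  · rfl
  · constructor
    · rintro ⟨q | q, h1, h2, h3⟩
      · exact Or.inl ⟨q, h1, h2, accepts_alt_inl.1 h3⟩
      · exact Or.inr ⟨q, h1, h2, accepts_alt_inr.1 h3⟩
    · rintro (⟨q, h1, h2, h3⟩ | ⟨q, h1, h2, h3⟩)
      · exact ⟨.inl q, h1, h2, accepts_alt_inl.2 h3⟩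
      · exact ⟨.inr q, h1, h2, accepts_alt_inr.2 h3⟩

theorem accepts_cat_inr {p : N.Pos} {w : List α} :
    (M.cat N).Accepts (some (.inr p)) w ↔ N.Accepts (some p) w := by
  induction w generalizing p with
  | nil => rfl
  | cons a w ih =>
    constructor
    · rintro ⟨q | q, h1, h2, h3⟩
      · exact h1.elim
      · exact ⟨q, h1, h2, ih.1 h3⟩
    · rintro ⟨q, h1, h2, h3⟩
      exact ⟨.inr q, h1, h2, ih.2 h3⟩

/-- `Option.map .inl` covers the initial state and the positions of `M` in one induction: both may
hand over to `N` when they are final. -/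
theorem accepts_cat {p : Option M.Pos} {w : List α} :
    (M.cat N).Accepts (p.map .inl) w ↔
      ∃ u v, w = u ++ v ∧ M.Accepts p u ∧ N.Accepts none v := by
  have hinl : ∀ p q, (M.cat N).follow (Option.map .inl p) (.inl q) ↔ M.follow p q := by
    rintro (_ | p) q <;> rfl
  have hinr : ∀ p q, (M.cat N).follow (Option.map .inl p) (.inr q) ↔
      M.final p ∧ N.follow none q := by
    rintro (_ | p) q <;> rfl
  have hfin : ∀ p, (M.cat N).final (Option.map .inl p) ↔ M.final p ∧ N.final none := by
    rintro (_ | p) <;> rfl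
  induction w generalizing p with
  | nil =>
    refine (hfin p).trans ?_
    constructor
    · exact fun h => ⟨[], [], rfl, h⟩
    · rintro ⟨u, v, h, h'⟩
      obtain ⟨rfl, rfl⟩ := List.append_eq_nil_iff.1 h.symm
      exact h'
  | cons a w ih =>
    constructor
    · rintro ⟨q | q, h1, h2, h3⟩
      · obtain ⟨u, v, rfl, h4, h5⟩ := (ih (p := some q)).1 h3
        exact ⟨a :: u, v, rfl, ⟨q, (hinl p q).1 h1, h2, h4⟩, h5⟩
      · obtain ⟨h1, h4⟩ := (hinr p q).1 h1
        exact ⟨[], a :: w, rfl, h1, q, h4, h2, accepts_cat_inr.1 h3⟩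
    · rintro ⟨u, v, h, h', h''⟩
      rcases u with _ | ⟨b, u⟩
      · obtain rfl : v = a :: w := h.symm
        obtain ⟨q, h1, h2, h3⟩ := h''
        exact ⟨.inr q, (hinr p q).2 ⟨h', h1⟩, h2, accepts_cat_inr.2 h3⟩
      · obtain ⟨rfl, rfl⟩ := List.cons.inj h
        obtain ⟨q, h1, h2, h3⟩ := h'
        exact ⟨.inl q, (hinl p q).2 h1, h2, (ih (p := some q)).2 ⟨u, v, rfl, h3, h''⟩⟩

theorem mem_kstar_cons {L : Language α} {u v : List α} (hu : u ∈ L) (hv : v ∈ KStar.kstar L) :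
    u ++ v ∈ KStar.kstar L := by
  obtain ⟨l, rfl, hl⟩ := Language.mem_kstar.1 hv
  refine Language.mem_kstar.2 ⟨u :: l, by simp, fun y hy => ?_⟩
  rcases List.mem_cons.1 hy with rfl | hy
  · exact hu
  · exact hl y hy

/-- The word is cut where the first round of the iteration ends; the remaining rounds form a word of
the star. -/
theorem exists_append_of_accepts_star {L : Language α} (hM : ∀ w, M.Accepts none w ↔ w ∈ L)
    {p : M.Pos} {w : List α} (h : M.star.Accepts (some p) w) :
    ∃ u v, w = u ++ v ∧ M.Accepts (some p) u ∧ v ∈ KStar.kstar L := by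
  induction w generalizing p with
  | nil => exact ⟨[], [], rfl, h, Language.nil_mem_kstar _⟩
  | cons a w ih =>
    obtain ⟨q, h1, h2, h3⟩ := h
    obtain ⟨u, v, rfl, h4, h5⟩ := ih h3
    rcases h1 with h1 | ⟨h1, h6⟩
    · exact ⟨a :: u, v, rfl, ⟨q, h1, h2, h4⟩, h5⟩
    · exact ⟨[], a :: u ++ v, rfl, h1, mem_kstar_cons ((hM _).1 ⟨q, h6, h2, h4⟩) h5⟩

theorem accepts_star_append {p : M.Pos} {u v : List α} (hu : M.Accepts (some p) u)
    (hv : M.star.Accepts none v) : M.star.Accepts (some p) (u ++ v) := by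
  induction u generalizing p with
  | nil =>
    rcases v with _ | ⟨b, v⟩
    · exact hu
    · obtain ⟨q, h1, h2, h3⟩ := hv
      exact ⟨q, Or.inr ⟨hu, h1.elim id And.right⟩, h2, h3⟩
  | cons a u ih =>
    obtain ⟨q, h1, h2, h3⟩ := hu
    exact ⟨q, Or.inl h1, h2, ih h3⟩

theorem accepts_star {L : Language α} (hM : ∀ w, M.Accepts none w ↔ w ∈ L) {w : List α} :
    M.star.Accepts none w ↔ w ∈ KStar.kstar L := by
  constructor
  · intro h
    rcases w with _ | ⟨a, w⟩
    · exact Language.nil_mem_kstar _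
    · obtain ⟨q, h1, h2, h3⟩ := h
      obtain ⟨u, v, rfl, h4, h5⟩ := exists_append_of_accepts_star hM h3
      exact mem_kstar_cons (u := a :: u) ((hM _).1 ⟨q, h1.elim id And.right, h2, h4⟩) h5
  · intro h
    obtain ⟨l, rfl, hl⟩ := Language.mem_kstar.1 h
    clear h
    induction l with
    | nil => exact trivial
    | cons u l ih =>
      have ih := ih fun y hy => hl y (List.mem_cons_of_mem _ hy)
      have hu := (hM u).2 (hl u List.mem_cons_self)
      rcases u with _ | ⟨a, u⟩
      · exact ih
      · obtain ⟨q, h1, h2, h3⟩ := hu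
        exact ⟨q, Or.inl h1, h2, accepts_star_append h3 ih⟩

end PosAut

namespace RatExp

variable {α : Type*}

/-- The position automaton of a rational expression. -/
def posAut : RatExp α → PosAut α
  | eps => { Pos := Empty, label := Empty.elim, follow := fun _ _ => False, final := fun _ => True }
  | letter a => { Pos := Unit, label := fun _ => a, follow := fun p _ => p = none,
                  final := fun p => p ≠ none }
  | cat r s => r.posAut.cat s.posAut
  | alt r s => r.posAut.alt s.posAut
  | star r => r.posAut.star

theorem finite_pos (r : RatExp α) : Finite r.posAut.Pos := by
  induction r with
  | eps => exact inferInstanceAs (Finite Empty)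
  | letter a => exact inferInstanceAs (Finite Unit)
  | cat r s h1 h2 => exact inferInstanceAs (Finite (_ ⊕ _))
  | alt r s h1 h2 => exact inferInstanceAs (Finite (_ ⊕ _))
  | star r h => exact h

theorem label_posAut_mem (r : RatExp α) (p : r.posAut.Pos) : r.posAut.label p ∈ r.letters := by
  induction r with
  | eps => exact p.elim
  | letter a => exact rfl
  | cat r s h1 h2 => exact p.casesOn (fun p => Or.inl (h1 p)) fun p => Or.inr (h2 p)
  | alt r s h1 h2 => exact p.casesOn (fun p => Or.inl (h1 p)) fun p => Or.inr (h2 p)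
  | star r h => exact h p

theorem accepts_posAut (r : RatExp α) {w : List α} : r.posAut.Accepts none w ↔ w ∈ r.lang := by
  induction r generalizing w with
  | eps =>
    rw [lang, Language.mem_one]
    rcases w with _ | ⟨a, w⟩
    · exact iff_of_true trivial rfl
    · exact iff_of_false (fun ⟨q, _⟩ => q.elim) (by simp)
  | letter a =>
    change _ ↔ w = [a]
    rcases w with _ | ⟨b, w⟩
    · exact iff_of_false (fun h => h rfl) (by simp)
    · constructor
      · rintro ⟨q, -, rfl, h⟩
        rcases w with _ | ⟨c, w⟩
        · rfl
        · obtain ⟨_, h, -⟩ := h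
          cases h
      · intro h
        obtain ⟨rfl, rfl⟩ := List.cons.inj h
        exact ⟨(), rfl, rfl, fun h => by cases h⟩
  | cat r s h1 h2 =>
    rw [lang, Language.mem_mul]
    refine (PosAut.accepts_cat (p := none)).trans ?_
    constructor
    · rintro ⟨u, v, rfl, hu, hv⟩
      exact ⟨u, h1.1 hu, v, h2.1 hv, rfl⟩
    · rintro ⟨u, hu, v, hv, rfl⟩
      exact ⟨u, v, rfl, h1.2 hu, h2.2 hv⟩
  | alt r s h1 h2 =>
    rw [lang, Language.mem_add, ← h1, ← h2]
    exact PosAut.accepts_alt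
  | star r h => exact PosAut.accepts_star fun w => h

/-- If only letters are iterated, then the positions are partially ordered. -/
theorem IsLetterStar.exists_rank {r : RatExp α} (h : r.IsLetterStar) :
    ∃ rank : r.posAut.Pos → ℕ, ∀ p q, r.posAut.follow (some p) q → q = p ∨ rank q < rank p := by
  induction h with
  | eps => exact ⟨fun _ => 0, fun p => p.elim⟩
  | letter a => exact ⟨fun _ => 0, fun p q _ => Or.inl rfl⟩
  | star a => exact ⟨fun _ => 0, fun p q _ => Or.inl rfl⟩
  | alt _ _ h1 h2 =>
    obtain ⟨f, hf⟩ := h1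
    obtain ⟨g, hg⟩ := h2
    refine ⟨Sum.elim f g, ?_⟩
    rintro (p | p) (q | q) h
    · exact (hf p q h).imp_left (congrArg Sum.inl)
    · exact h.elim
    · exact h.elim
    · exact (hg p q h).imp_left (congrArg Sum.inr)
  | @cat r s _ _ h1 h2 =>
    obtain ⟨f, hf⟩ := h1
    obtain ⟨g, hg⟩ := h2
    have := s.finite_pos
    obtain ⟨N, hN⟩ := (Set.finite_range g).bddAbove
    -- The shift puts all positions of `r` above those of `s`, whose ranks are at most `N`.
    refine ⟨Sum.elim (fun p => f p + N + 1) g, ?_⟩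
    rintro (p | p) (q | q) h
    · exact (hf p q h).imp (congrArg Sum.inl) fun h => by simpa using h
    · have := hN ⟨q, rfl⟩
      exact Or.inr (by simp; omega)
    · exact h.elim
    · exact (hg p q h).imp_left (congrArg Sum.inr)

end RatExp

/-! ### Renaming locations -/

namespace TForm

variable {S S' : Type}

/-- Renaming of the locations. -/
def map (f : S → S') : TForm S → TForm S'
  | top => top
  | bot => bot
  | conj φ ψ => conj (φ.map f) (ψ.map f)
  | disj φ ψ => disj (φ.map f) (ψ.map f)
  | loc s => loc (f s)
  | guard g => guard g
  | reset φ => reset (φ.map f)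

theorem ev_map {f : S → S'} {L : S' → ℝ → Prop} {now : ℝ} {φ : TForm S} {t : ℝ} :
    (φ.map f).Ev L now t ↔ φ.Ev (fun s t => L (f s) t) now t := by
  induction φ generalizing t with
  | conj φ ψ h1 h2 => exact and_congr h1 h2
  | disj φ ψ h1 h2 => exact or_congr h1 h2
  | reset φ h => exact h
  | _ => rfl

theorem freeLocs_map {f : S → S'} (φ : TForm S) : (φ.map f).freeLocs = f '' φ.freeLocs := by
  induction φ with
  | conj φ ψ h1 h2 => simp [map, freeLocs, h1, h2, Set.image_union]
  | disj φ ψ h1 h2 => simp [map, freeLocs, h1, h2, Set.image_union]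
  | _ => simp [map, freeLocs]

theorem boundLocs_map {f : S → S'} (φ : TForm S) : (φ.map f).boundLocs = f '' φ.boundLocs := by
  induction φ with
  | conj φ ψ h1 h2 => simp [map, boundLocs, h1, h2, Set.image_union]
  | disj φ ψ h1 h2 => simp [map, boundLocs, h1, h2, Set.image_union]
  | reset φ h => simp [map, boundLocs, h, freeLocs_map, Set.image_union]
  | _ => simp [map, boundLocs]

theorem guards_map {f : S → S'} (φ : TForm S) : (φ.map f).guards = φ.guards := by
  induction φ with
  | conj φ ψ h1 h2 => simp [map, guards, h1, h2]
  | disj φ ψ h1 h2 => simp [map, guards, h1, h2]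
  | reset φ h => simp [map, guards, h]
  | _ => rfl

theorem IsResetCombination.map {β : TForm S} (hβ : β.IsResetCombination) (f : S → S') :
    (β.map f).IsResetCombination := by
  induction hβ with
  | top => exact .top
  | bot => exact .bot
  | atom q => exact .atom _
  | conj _ _ h1 h2 => exact .conj h1 h2
  | disj _ _ h1 h2 => exact .disj h1 h2

theorem IsConjunctive.map {Q : Set S} {Q' : Set S'} {f : S → S'} (hf : ∀ q ∈ Q, f q ∈ Q')
    {φ : TForm S} (h : φ.IsConjunctive Q) : (φ.map f).IsConjunctive Q' := by
  induction h with
  | loc h => exact .loc (hf _ h)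
  | locOr h hβ => exact .locOr (hf _ h) (hβ.map f)
  | guard g => exact .guard g
  | guardOr g hβ => exact .guardOr g (hβ.map f)
  | resets hβ => exact .resets (hβ.map f)
  | conj _ _ h1 h2 => exact .conj h1 h2

theorem IsDisjunctive.map {Q : Set S} {Q' : Set S'} {f : S → S'} (hf : ∀ q ∈ Q, f q ∈ Q')
    {φ : TForm S} (h : φ.IsDisjunctive Q) : (φ.map f).IsDisjunctive Q' := by
  induction h with
  | loc h => exact .loc (hf _ h)
  | locAnd h hβ => exact .locAnd (hf _ h) (hβ.map f)
  | guard g => exact .guard g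
  | guardAnd g hβ => exact .guardAnd g (hβ.map f)
  | resets hβ => exact .resets (hβ.map f)
  | disj _ _ h1 h2 => exact .disj h1 h2

/-- Finite disjunctions. -/
def disjList : List (TForm S) → TForm S
  | [] => bot
  | φ :: l => disj φ (disjList l)

theorem ev_disjList {L : S → ℝ → Prop} {now t : ℝ} {l : List (TForm S)} :
    (disjList l).Ev L now t ↔ ∃ φ ∈ l, φ.Ev L now t := by
  induction l with
  | nil => simp [disjList, Ev]
  | cons φ l ih => simp [disjList, Ev, ih]

theorem freeLocs_disjList {l : List (TForm S)} {s : S} :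
    s ∈ (disjList l).freeLocs ↔ ∃ φ ∈ l, s ∈ φ.freeLocs := by
  induction l with
  | nil => simp [disjList, freeLocs]
  | cons φ l ih => simp [disjList, freeLocs, ih]

theorem boundLocs_disjList {l : List (TForm S)} {s : S} :
    s ∈ (disjList l).boundLocs ↔ ∃ φ ∈ l, s ∈ φ.boundLocs := by
  induction l with
  | nil => simp [disjList, boundLocs]
  | cons φ l ih => simp [disjList, boundLocs, ih]

theorem guards_disjList {l : List (TForm S)} {g : Guard} :
    g ∈ (disjList l).guards ↔ ∃ φ ∈ l, g ∈ φ.guards := by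
  induction l with
  | nil => simp [disjList, guards]
  | cons φ l ih => simp [disjList, guards, ih]

theorem IsDisjunctive.disjList {Q : Set S} {l : List (TForm S)}
    (h : ∀ φ ∈ l, φ.IsDisjunctive Q) : (TForm.disjList l).IsDisjunctive Q := by
  induction l with
  | nil => exact .resets .bot
  | cons φ l ih => exact .disj (h φ (by simp)) (ih fun ψ hψ => h ψ (by simp [hψ]))

end TForm

/-- A renaming that respects transitions and final locations preserves acceptance, injective or not;
this covers all embeddings of automata into larger ones. -/
theorem accept_map {P : Type*} {S S' : Type} {δ : S → Letter P → TForm S} {F : Set S}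
    {δ' : S' → Letter P → TForm S'} {F' : Set S'} {f : S → S'}
    (hδ : ∀ s a, δ' (f s) a = (δ s a).map f) (hF : ∀ s, f s ∈ F' ↔ s ∈ F) {ρ : TimedWord P}
    {k : ℕ} {s : S} {t : ℝ} : Accept δ' F' ρ k (f s) t ↔ Accept δ F ρ k s t := by
  have : ∀ m s t, acceptRem δ' F' ρ m (f s) t ↔ acceptRem δ F ρ m s t := by
    intro m
    induction m with
    | zero => exact fun s t => hF s
    | succ m ih =>
      intro s t
      rw [acceptRem, acceptRem, hδ, TForm.ev_map]
      exact TForm.ev_congr (fun s _ => ih s _) fun s _ => ih s _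
  exact this _ s t

end ATA

/-! ### From formulas to automata -/

namespace ATA

variable {P : Type*}

/-! ### Transition structures with islands -/

/-- The transition structure of an automaton without initial location, with islands given by
`header`, a rank of the locations, and the set `conjLocs` of conjunctive locations. -/
structure TransitionStructure (P : Type*) where
  Loc : Type
  finite_loc : Finite Loc
  δ : Loc → Letter P → TForm Loc
  final : Set Loc
  header : Loc → Loc
  rank : Loc → ℕ
  conjLocs : Set Loc

namespace TransitionStructure

/-- The conditions on the transition structure of a conjunctive-disjunctive automaton with
loop-free resets and with intervals in `J`, which is partially ordered if `ord` holds. -/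
structure Valid (ord : Prop) (J : Interval → Prop) (B : TransitionStructure P) : Prop where
  header_header : ∀ s, B.header (B.header s) = B.header s
  bound : ∀ s a, ∀ q ∈ (B.δ s a).boundLocs,
    B.header q = q ∧ B.rank q < B.rank s ∧ B.rank q < B.rank (B.header s)
  free : ∀ s a, ∀ p ∈ (B.δ s a).freeLocs,
    B.header p = B.header s ∧ p ≠ B.header s ∧ (ord → p = s ∨ B.rank p < B.rank s)
  isConjunctive : ∀ s ∈ B.conjLocs, ∀ a, (B.δ s a).IsConjunctive B.conjLocs
  isDisjunctive : ∀ s ∉ B.conjLocs, ∀ a, (B.δ s a).IsDisjunctive B.conjLocsᶜ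
  guards : ∀ s a, ∀ g ∈ (B.δ s a).guards, J g.interval

/-- The formula `φ` is represented by the reset combinations `T a`, to be used at the symbol `a`. -/
structure Represents (B : TransitionStructure P) (T : Letter P → TForm B.Loc) (φ : Formula P) :
    Prop where
  isResetCombination : ∀ a, (T a).IsResetCombination
  bound : ∀ a, ∀ q ∈ (T a).boundLocs, B.header q = q
  satAt_iff : ∀ (ρ : TimedWord P) (k : ℕ), k ≤ ρ.last → ∀ t, (SatAt ρ φ k ↔
    (T (ρ.letterAt k)).Ev (Accept B.δ B.final ρ (k + 1)) (ρ.timeAt k) t)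

/-- The empty transition structure. -/
def empty : TransitionStructure P where
  Loc := Empty
  finite_loc := inferInstance
  δ s := s.elim
  final := ∅
  header := id
  rank := fun _ => 0
  conjLocs := ∅

theorem valid_empty {ord : Prop} {J : Interval → Prop} :
    (empty : TransitionStructure P).Valid ord J where
  header_header s := s.elim
  bound s := s.elim
  free s := s.elim
  isConjunctive s := s.elim
  isDisjunctive s := s.elim
  guards s := s.elim

/-- The dual transition structure. -/
abbrev dual (B : TransitionStructure P) : TransitionStructure P where
  Loc := B.Loc
  finite_loc := B.finite_loc
  δ s a := (B.δ s a).dual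
  final := B.finalᶜ
  header := B.header
  rank := B.rank
  conjLocs := B.conjLocsᶜ

theorem Valid.dual {ord : Prop} {J : Interval → Prop} {B : TransitionStructure P}
    (h : B.Valid ord J) : B.dual.Valid ord J where
  header_header := h.header_header
  bound s a q hq := h.bound s a q (by rwa [← TForm.boundLocs_dual])
  free s a q hq := h.free s a q (by rwa [← TForm.freeLocs_dual])
  isConjunctive s hs a := (h.isDisjunctive s hs a).dual
  isDisjunctive s hs a := by
    have := (h.isConjunctive s (not_not.1 hs) a).dual
    rwa [← compl_compl B.conjLocs] at this
  guards s a := TForm.guards_dual (h.guards s a)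

/-- Negation dualises the whole structure together with the entry formulas; hence `Valid` has to be,
and is, closed under duality. -/
theorem Represents.dual {B : TransitionStructure P} {T : Letter P → TForm B.Loc}
    {φ : Formula P} (h : B.Represents T φ) :
    B.dual.Represents (fun a => (T a).dual) (.neg φ) where
  isResetCombination a := (h.isResetCombination a).dual
  bound a q hq := h.bound a q (by rwa [← TForm.boundLocs_dual])
  satAt_iff ρ k hk t := by
    rw [satAt_neg, h.satAt_iff ρ k hk t, ← TForm.ev_dual]
    refine TForm.ev_congr (fun s _ => ?_) fun s _ => ?_ <;> exact accept_dual.symm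

/-- The disjoint union. -/
abbrev sigma {ι : Type} [Finite ι] (B : ι → TransitionStructure P) : TransitionStructure P where
  Loc := Σ i, (B i).Loc
  finite_loc := have := fun i => (B i).finite_loc; inferInstance
  δ s a := ((B s.1).δ s.2 a).map (Sigma.mk s.1)
  final := {s | s.2 ∈ (B s.1).final}
  header s := ⟨s.1, (B s.1).header s.2⟩
  rank s := (B s.1).rank s.2
  conjLocs := {s | s.2 ∈ (B s.1).conjLocs}

theorem Valid.sigma {ord : Prop} {J : Interval → Prop} {ι : Type} [Finite ι]
    {B : ι → TransitionStructure P} (h : ∀ i, (B i).Valid ord J) :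
    (TransitionStructure.sigma B).Valid ord J where
  header_header s := congrArg (Sigma.mk s.1) ((h s.1).header_header s.2)
  bound := by
    rintro ⟨i, s⟩ a q hq
    obtain ⟨q, hq', rfl⟩ := (TForm.boundLocs_map _).subset hq
    obtain ⟨h1, h2⟩ := (h i).bound s a q hq'
    exact ⟨congrArg (Sigma.mk i) h1, h2⟩
  free := by
    rintro ⟨i, s⟩ a q hq
    obtain ⟨q, hq', rfl⟩ := (TForm.freeLocs_map _).subset hq
    obtain ⟨h1, h2, h3⟩ := (h i).free s a q hq'
    exact ⟨congrArg (Sigma.mk i) h1, fun h => h2 (by simpa using h),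
      fun ho => (h3 ho).imp_left (congrArg (Sigma.mk i))⟩
  isConjunctive s hs a := ((h s.1).isConjunctive s.2 hs a).map (f := Sigma.mk s.1) fun _ hq => hq
  isDisjunctive s hs a := ((h s.1).isDisjunctive s.2 hs a).map (f := Sigma.mk s.1) fun _ hq => hq
  guards s a g hg := (h s.1).guards s.2 a g ((TForm.guards_map _).subset hg)

theorem Represents.sigma {ι : Type} [Finite ι] {B : ι → TransitionStructure P} {i : ι}
    {T : Letter P → TForm (B i).Loc} {φ : Formula P} (h : (B i).Represents T φ) :
    (TransitionStructure.sigma B).Represents (fun a => (T a).map (Sigma.mk i)) φ where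
  isResetCombination a := (h.isResetCombination a).map _
  bound a q hq := by
    obtain ⟨q, hq', rfl⟩ := (TForm.boundLocs_map _).subset hq
    exact congrArg (Sigma.mk i) (h.bound a q hq')
  satAt_iff ρ k hk t := by
    rw [h.satAt_iff ρ k hk t, TForm.ev_map]
    refine TForm.ev_congr (fun s _ => ?_) fun s _ => ?_ <;>
    exact (accept_map (f := Sigma.mk i) (δ' := (TransitionStructure.sigma B).δ)
      (F' := (TransitionStructure.sigma B).final) (fun _ _ => rfl) fun _ => Iff.rfl).symm

section Island

variable (B : TransitionStructure P) (M : PosAut (Formula P)) (I : Interval)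
  (T : Option M.Pos → Letter P → TForm B.Loc)

open Classical in
/-- The transitions of an island for `FRat`, from the position automaton `M`: `T (some p)`
represents the label of the position `p`, and `T none` represents the argument of `FRat`. -/
noncomputable def islandδ [Finite M.Pos] (q : Option M.Pos) (a : Letter P) :
    TForm (Option M.Pos ⊕ B.Loc) :=
  have := Fintype.ofFinite M.Pos
  .disj
    (.disjList (Finset.univ.toList.map fun p : M.Pos =>
      if M.follow q p then .conj (.loc (.inl (some p))) ((T (some p) a).map .inr) else .bot))
    (if M.final q then .conj (.guard (.mem I)) ((T none a).map .inr) else .bot)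

/-- The transition structure with an additional island for `FRat`. -/
noncomputable abbrev island [Finite M.Pos] (N : ℕ) (r : Option M.Pos → ℕ) :
    TransitionStructure P where
  Loc := Option M.Pos ⊕ B.Loc
  finite_loc := have := B.finite_loc; inferInstance
  δ := Sum.elim (B.islandδ M I T) fun s a => (B.δ s a).map .inr
  final := Sum.inr '' B.final
  header := Sum.elim (fun _ => .inl none) fun s => .inr (B.header s)
  rank := Sum.elim (fun q => N + 1 + r q) B.rank
  conjLocs := Sum.inr '' B.conjLocs

variable {B M I T}

theorem ev_islandδ [Finite M.Pos] {L : Option M.Pos ⊕ B.Loc → ℝ → Prop} {now t : ℝ}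
    {q : Option M.Pos} {a : Letter P} : (B.islandδ M I T q a).Ev L now t ↔
      (∃ p, M.follow q p ∧ L (.inl (some p)) t ∧ ((T (some p) a).map .inr).Ev L now t) ∨
        (M.final q ∧ now - t ∈ I.toSet ∧ ((T none a).map .inr).Ev L now t) := by
  rw [islandδ, TForm.Ev, TForm.ev_disjList]
  refine or_congr ?_ ?_
  · simp only [List.mem_map, Finset.mem_toList, Finset.mem_univ, true_and,
      exists_exists_eq_and]
    refine exists_congr fun p => ?_
    split_ifs with h <;> simp [h, TForm.Ev]
  · split_ifs with h <;> simp [h, TForm.Ev, Guard.Holds]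

theorem exists_of_mem_boundLocs_islandδ [Finite M.Pos] {q : Option M.Pos} {a : Letter P}
    {s : Option M.Pos ⊕ B.Loc} (hs : s ∈ (B.islandδ M I T q a).boundLocs) :
    ∃ o, ∃ b ∈ (T o a).boundLocs, s = .inr b := by
  have key : ∀ o, s ∈ ((T o a).map Sum.inr).boundLocs → ∃ o, ∃ b ∈ (T o a).boundLocs, s = .inr b := by
    intro o h
    obtain ⟨b, hb, rfl⟩ := (TForm.boundLocs_map _).subset h
    exact ⟨o, b, hb, rfl⟩
  rcases hs with hs | hs
  · rw [TForm.boundLocs_disjList] at hs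
    obtain ⟨φ, hφ, hs⟩ := hs
    obtain ⟨p, -, rfl⟩ := List.mem_map.1 hφ
    split_ifs at hs
    · exact hs.elim (fun h => h.elim) (key _)
    · exact hs.elim
  · split_ifs at hs
    · exact hs.elim (fun h => h.elim) (key _)
    · exact hs.elim

theorem exists_of_mem_freeLocs_islandδ [Finite M.Pos] (hT : ∀ o a, (T o a).IsResetCombination)
    {q : Option M.Pos} {a : Letter P} {s : Option M.Pos ⊕ B.Loc}
    (hs : s ∈ (B.islandδ M I T q a).freeLocs) : ∃ p, M.follow q p ∧ s = .inl (some p) := by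
  have key : ∀ o, s ∉ ((T o a).map Sum.inr).freeLocs := by
    intro o h
    rw [((hT o a).map _).freeLocs_eq] at h
    exact h
  rcases hs with hs | hs
  · rw [TForm.freeLocs_disjList] at hs
    obtain ⟨φ, hφ, hs⟩ := hs
    obtain ⟨p, -, rfl⟩ := List.mem_map.1 hφ
    split_ifs at hs with h
    · exact hs.elim (fun hs => ⟨p, h, hs⟩) fun h => (key _ h).elim
    · exact hs.elim
  · split_ifs at hs
    · exact hs.elim (fun h => h.elim) fun h => (key _ h).elim
    · exact hs.elim

theorem guards_islandδ [Finite M.Pos] (hT : ∀ o a, (T o a).IsResetCombination)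
    {q : Option M.Pos} {a : Letter P} {g : Guard}
    (hg : g ∈ (B.islandδ M I T q a).guards) : g = .mem I := by
  have key : ∀ o, g ∉ ((T o a).map (Sum.inr : B.Loc → Option M.Pos ⊕ B.Loc)).guards := by
    intro o h
    rw [((hT o a).map _).guards_eq] at h
    exact h
  rcases hg with hg | hg
  · rw [TForm.guards_disjList] at hg
    obtain ⟨φ, hφ, hg⟩ := hg
    obtain ⟨p, -, rfl⟩ := List.mem_map.1 hφ
    split_ifs at hg with h
    · exact hg.elim (fun h => h.elim) fun h => (key _ h).elim
    · exact hg.elim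
  · split_ifs at hg
    · exact hg.elim id fun h => (key _ h).elim
    · exact hg.elim

/-- The new locations are all disjunctive and rank above everything in `B`, so resets go down. The
header `none` is not a target of free transitions, since only positions are entered. -/
theorem Valid.island {ord : Prop} {J : Interval → Prop} [Finite M.Pos] (h : B.Valid ord J)
    (hI : J I) (hT : ∀ o a, (T o a).IsResetCombination)
    (hTb : ∀ o a, ∀ q ∈ (T o a).boundLocs, B.header q = q) {N : ℕ} (hN : ∀ s, B.rank s ≤ N)
    {r : Option M.Pos → ℕ}
    (hr : ord → ∀ q p, M.follow q p → some p = q ∨ r (some p) < r q) :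
    (B.island M I T N r).Valid ord J where
  header_header := by
    rintro (q | s)
    · rfl
    · exact congrArg Sum.inr (h.header_header s)
  bound := by
    rintro (q | s) a b hb
    · obtain ⟨o, b, hb', rfl⟩ := exists_of_mem_boundLocs_islandδ hb
      have := hN b
      refine ⟨congrArg Sum.inr (hTb o a b hb'), ?_, ?_⟩
      · change B.rank b < N + 1 + r q
        omega
      · change B.rank b < N + 1 + r none
        omega
    · obtain ⟨b, hb', rfl⟩ := (TForm.boundLocs_map _).subset hb
      obtain ⟨h1, h2⟩ := h.bound s a b hb'
      exact ⟨congrArg Sum.inr h1, h2⟩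
  free := by
    rintro (q | s) a b hb
    · obtain ⟨p, hp, rfl⟩ := exists_of_mem_freeLocs_islandδ hT hb
      refine ⟨rfl, fun h => (by cases h), fun ho => ?_⟩
      exact (hr ho q p hp).imp (congrArg Sum.inl) fun h => Nat.add_lt_add_left h _
    · obtain ⟨b, hb', rfl⟩ := (TForm.freeLocs_map _).subset hb
      obtain ⟨h1, h2, h3⟩ := h.free s a b hb'
      exact ⟨congrArg Sum.inr h1, fun h => h2 (Sum.inr_injective h),
        fun ho => (h3 ho).imp_left (congrArg Sum.inr)⟩
  isConjunctive := by
    rintro _ ⟨s, hs, rfl⟩ a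
    exact (h.isConjunctive s hs a).map fun _ hq => Set.mem_image_of_mem _ hq
  isDisjunctive := by
    rintro (q | s) hs a
    · refine .disj (.disjList fun φ hφ => ?_) ?_
      · obtain ⟨p, -, rfl⟩ := List.mem_map.1 hφ
        split_ifs
        · refine .locAnd ?_ ((hT _ _).map _)
          rintro ⟨_, _, h⟩
          cases h
        · exact .resets .bot
      · split_ifs
        · exact .guardAnd _ ((hT _ _).map _)
        · exact .resets .bot
    · refine (h.isDisjunctive s (fun h => hs ⟨s, h, rfl⟩) a).map ?_
      rintro q hq ⟨q', hq', h⟩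
      cases h
      exact hq hq'
  guards := by
    rintro (q | s) a g hg
    · rw [guards_islandδ hT hg]
      exact hI
    · exact h.guards s a g ((TForm.guards_map _).subset hg)

theorem accept_island_inr [Finite M.Pos] {N : ℕ} {r : Option M.Pos → ℕ} {ρ : TimedWord P}
    {k : ℕ} {s : B.Loc} {t : ℝ} :
    Accept (B.island M I T N r).δ (B.island M I T N r).final ρ k (.inr s) t ↔
      Accept B.δ B.final ρ k s t :=
  accept_map (f := Sum.inr) (fun _ _ => rfl)
    fun _ => Sum.inr_injective.mem_set_image

/-- No location of the island is final, so the island must be left through the clause with `x ∈ I`,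
at the position where the argument of `FRat` holds. Until then each move checks the label of the
position that is entered. -/
theorem accept_island_inl [Finite M.Pos] {N : ℕ} {r : Option M.Pos → ℕ} {φ : Formula P}
    (hφ : B.Represents (T none) φ) (hM : ∀ p, B.Represents (T (some p)) (M.label p))
    {ρ : TimedWord P} {k : ℕ} (hk : k ≤ ρ.last + 1) {q : Option M.Pos} {t : ℝ} :
    Accept (B.island M I T N r).δ (B.island M I T N r).final ρ k (.inl q) t ↔
      ∃ j, k ≤ j ∧ j ≤ ρ.last ∧ SatAt ρ φ j ∧ ρ.timeAt j - t ∈ I.toSet ∧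
        ∃ w, M.Accepts q w ∧ k + w.length = j ∧ Labelled ρ id k w := by
  induction hk using Nat.decreasingInduction generalizing q with
  | self =>
    rw [accept_end]
    refine iff_of_false ?_ ?_
    · rintro ⟨_, -, h⟩
      cases h
    · rintro ⟨j, h1, h2, -⟩
      omega
  | of_succ k hk ih =>
    have hk : k ≤ ρ.last := by omega
    have hinr : ∀ (o : Option M.Pos) (ψ : Formula P), B.Represents (T o) ψ →
        (((T o (ρ.letterAt k)).map .inr).Ev (Accept (B.island M I T N r).δ
          (B.island M I T N r).final ρ (k + 1)) (ρ.timeAt k) t ↔ SatAt ρ ψ k) := by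
      intro o ψ h
      rw [TForm.ev_map, h.satAt_iff ρ k hk t]
      exact TForm.ev_congr (fun s _ => accept_island_inr) fun s _ => accept_island_inr
    rw [accept_iff hk]
    refine ev_islandδ.trans ?_
    rw [hinr none φ hφ]
    constructor
    · rintro (⟨p, h1, h2, h3⟩ | ⟨h1, h2, h3⟩)
      · rw [hinr _ _ (hM p)] at h3
        obtain ⟨j, hj, hjl, h4, h5, w, h6, h7, h8⟩ := ih.1 h2
        exact ⟨j, by omega, hjl, h4, h5, M.label p :: w, ⟨p, h1, rfl, h6⟩,
          by simp; omega, h3, h8⟩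
      · exact ⟨k, le_rfl, hk, h3, h2, [], h1, rfl, trivial⟩
    · rintro ⟨j, hj, hjl, h4, h5, w, h6, rfl, h8⟩
      -- An empty `w` means that `k` is itself the target; otherwise its first letter labels the
      -- position entered at `k`.
      rcases w with _ | ⟨ψ, w⟩
      · exact Or.inr ⟨h6, h5, h4⟩
      · obtain ⟨p, h1, rfl, h6⟩ := h6
        refine Or.inl ⟨p, h1, ?_, (hinr _ _ (hM p)).2 h8.1⟩
        exact ih.2 ⟨_, by simp, hjl, h4, h5, w, h6, by simp; omega, h8.2⟩

theorem Represents.island [Finite M.Pos] {N : ℕ} {r : Option M.Pos → ℕ} {φ : Formula P}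
    (hφ : B.Represents (T none) φ) (hM : ∀ p, B.Represents (T (some p)) (M.label p))
    {re : RatExp (Formula P)} (hre : ∀ w, M.Accepts none w ↔ w ∈ re.lang) :
    (B.island M I T N r).Represents (fun _ => .reset (.loc (.inl none))) (.frat I re φ) where
  isResetCombination _ := .atom _
  bound := by
    rintro _ q (hq | hq)
    · cases hq
      rfl
    · exact hq.elim
  satAt_iff ρ k hk t := by
    rw [satAt_frat hk]
    -- Resetting into the header at `k` is acceptance from `k + 1` on with the time of `k` as reset
    -- time; this matches the strict `j > k` in `FRat`.
    refine Iff.trans ?_ (accept_island_inl hφ hM (by omega)).symm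
    refine exists_congr fun j => and_congr_right fun _ => and_congr_right fun _ =>
      and_congr_right fun _ => and_congr_right fun _ => exists_congr fun w => ?_
    rw [hre, labelled_iff_getElem]
    rfl

end Island

end TransitionStructure

open TransitionStructure

/-- The structures for the argument and for the labels of all positions are put side by side,
indexed by `none` and the positions, and the island is added on top. -/
theorem exists_represents_frat {ord : Prop} {J : Interval → Prop} {I : Interval} (hI : J I)
    {re : RatExp (Formula P)} (hord : ord → re.IsLetterStar) {φ : Formula P}
    (hre : ∀ ψ ∈ re.letters, ∃ B : TransitionStructure P, B.Valid ord J ∧ ∃ T, B.Represents T ψ)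
    (hφ : ∃ B : TransitionStructure P, B.Valid ord J ∧ ∃ T, B.Represents T φ) :
    ∃ B : TransitionStructure P, B.Valid ord J ∧ ∃ T, B.Represents T (.frat I re φ) := by
  have := re.finite_pos
  have hall : ∀ o : Option re.posAut.Pos, ∃ B : TransitionStructure P, B.Valid ord J ∧
      ∃ T, B.Represents T (o.elim φ re.posAut.label) := by
    rintro (_ | p)
    · exact hφ
    · exact hre _ (re.label_posAut_mem p)
  choose B hB T hT using hall
  have := (sigma B).finite_loc
  obtain ⟨N, hN⟩ := (Set.finite_range (sigma B).rank).bddAbove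
  have hr : ∃ r : Option re.posAut.Pos → ℕ, ord →
      ∀ q p, re.posAut.follow q p → some p = q ∨ r (some p) < r q := by
    by_cases ho : ord
    · obtain ⟨f, hf⟩ := (hord ho).exists_rank
      obtain ⟨K, hK⟩ := (Set.finite_range f).bddAbove
      -- The initial state ranks above all positions, whose ranks are at most `K`.
      refine ⟨fun o => o.elim (K + 1) f, fun _ => ?_⟩
      rintro (_ | q) p h
      · exact Or.inr (Nat.lt_succ_of_le (hK ⟨p, rfl⟩))
      · exact (hf q p h).imp_left (congrArg some)
    · exact ⟨fun _ => 0, fun h => (ho h).elim⟩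
  obtain ⟨r, hr⟩ := hr
  let T' : Option re.posAut.Pos → Letter P → TForm (sigma B).Loc :=
    fun o a => (T o a).map (Sigma.mk o)
  have hT' : ∀ o, (sigma B).Represents (T' o) (o.elim φ re.posAut.label) := fun o => (hT o).sigma
  refine ⟨(sigma B).island re.posAut I T' N r, ?_, _,
    Represents.island (hT' none) (fun p => hT' (some p)) fun w => re.accepts_posAut⟩
  exact (Valid.sigma hB).island hI (fun o => (hT' o).isResetCombination) (fun o => (hT' o).bound)
    (fun s => hN ⟨s, rfl⟩) hr

theorem exists_represents_until {ord : Prop} {J : Interval → Prop} {I : Interval} (hI : J I)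
    {φ ψ : Formula P}
    (hφ : ∃ B : TransitionStructure P, B.Valid ord J ∧ ∃ T, B.Represents T φ)
    (hψ : ∃ B : TransitionStructure P, B.Valid ord J ∧ ∃ T, B.Represents T ψ) :
    ∃ B : TransitionStructure P, B.Valid ord J ∧ ∃ T, B.Represents T (.until I φ ψ) := by
  obtain ⟨B, hB, T, hT⟩ := exists_represents_frat (re := .star (.letter φ)) hI
    (fun _ => .star φ) (by rintro _ rfl; exact hφ) hψ
  exact ⟨B, hB, T, hT.isResetCombination, hT.bound, fun ρ k hk t =>
    (satAt_until_iff_frat hk).trans (hT.satAt_iff ρ k hk t)⟩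

theorem Formula.Within.exists_represents {ord : Prop} {J : Interval → Prop}
    {R : RatExp (Formula P) → Prop} (hR : ord → ∀ re, R re → re.IsLetterStar) {φ : Formula P}
    (h : φ.Within J R) :
    ∃ B : TransitionStructure P, B.Valid ord J ∧ ∃ T, B.Represents T φ := by
  classical
  induction h with
  | atom p =>
    refine ⟨empty, valid_empty, fun a => if p ∈ a.1 then .top else .bot, ?_, ?_, ?_⟩
    · intro a
      split_ifs
      · exact .top
      · exact .bot
    · exact fun a q => q.elim
    · intro ρ k _ t
      rw [satAt_atom]
      split_ifs with h <;> simp [h, TForm.Ev]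
  | tru =>
    exact ⟨empty, valid_empty, fun _ => .top, fun _ => .top, fun a q => q.elim,
      fun ρ k _ t => iff_of_true satAt_tru trivial⟩
  | @and φ ψ _ _ h1 h2 =>
    have hall : ∀ b : Bool, ∃ B : TransitionStructure P, B.Valid ord J ∧
        ∃ T, B.Represents T (if b then φ else ψ) := by
      rintro (_ | _)
      · exact h2
      · exact h1
    choose B hB T hT using hall
    have hT' := fun b => (hT b).sigma
    refine ⟨sigma B, .sigma hB, fun a => .conj ((T true a).map (Sigma.mk true))
      ((T false a).map (Sigma.mk false)), fun a => .conj ((hT' true).isResetCombination a)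
        ((hT' false).isResetCombination a), ?_, ?_⟩
    · rintro a q (hq | hq)
      · exact (hT' true).bound a q hq
      · exact (hT' false).bound a q hq
    · intro ρ k hk t
      rw [satAt_and]
      exact and_congr ((hT' true).satAt_iff ρ k hk t) ((hT' false).satAt_iff ρ k hk t)
  | neg _ h =>
    obtain ⟨B, hB, T, hT⟩ := h
    exact ⟨B.dual, hB.dual, _, hT.dual⟩
  | frat hI hr _ _ h1 h2 => exact exists_represents_frat hI (fun ho => hR ho _ hr) h1 h2
  | _ hI _ _ h1 h2 => exact exists_represents_until hI h1 h2

/-! ### From formulas to automata -/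

/-- The automaton with an additional initial location. -/
abbrev TransitionStructure.toOneATA (B : TransitionStructure P) (T : Letter P → TForm B.Loc) :
    OneATA P where
  Loc := Option B.Loc
  finite_loc := have := B.finite_loc; inferInstance
  init := none
  final := some '' B.final
  δ s a := s.elim ((T a).map some) fun s => (B.δ s a).map some

section

variable {B : TransitionStructure P} {T : Letter P → TForm B.Loc} {ord : Prop}
  {J : Interval → Prop} {φ : Formula P}

/-- `Represents` evaluates the entry formula at the symbol being read, so a fresh location with this
transition formula reads the first symbol. -/
theorem TransitionStructure.Represents.language_eq (hT : B.Represents T φ) :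
    φ.language = (B.toOneATA T).language := by
  ext ρ
  rw [Formula.mem_language, OneATA.mem_language, hT.satAt_iff ρ 0 (Nat.zero_le _) 0,
    accept_iff (Nat.zero_le _)]
  refine Iff.trans ?_ TForm.ev_map.symm
  refine TForm.ev_congr (fun s _ => ?_) fun s _ => ?_ <;>
  exact (accept_map (f := some) (fun _ _ => rfl) fun _ =>
    (Option.some_injective _).mem_set_image).symm

theorem TransitionStructure.Valid.isConjunctiveDisjunctive (hB : B.Valid ord J)
    (hT : B.Represents T φ) : (B.toOneATA T).IsConjunctiveDisjunctive := by
  refine ⟨some '' B.conjLocs, ?_⟩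
  rintro (_ | s) a
  · refine ⟨?_, fun _ => .resets ((hT.isResetCombination a).map _)⟩
    rintro ⟨_, -, h⟩
    cases h
  · refine ⟨?_, fun hs => ?_⟩
    · rintro ⟨s', hs, h⟩
      cases h
      exact (hB.isConjunctive s hs a).map fun _ hq => Set.mem_image_of_mem _ hq
    · refine (hB.isDisjunctive s (fun h => hs ⟨s, h, rfl⟩) a).map ?_
      rintro q hq ⟨q', hq', h⟩
      cases h
      exact hq hq'

/-- The order of the locations by rank, with the initial location above all others. -/
def TransitionStructure.rankLt (B : TransitionStructure P) : Option B.Loc → Option B.Loc → Prop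
  | some p, some q => B.rank p < B.rank q
  | some _, none => True
  | none, _ => False

theorem TransitionStructure.isStrictOrder_rankLt : IsStrictOrder (Option B.Loc) B.rankLt where
  irrefl := by
    rintro (_ | p) h
    · exact h
    · exact lt_irrefl _ h
  trans := by
    rintro (_ | p) (_ | q) (_ | r) h1 h2
    all_goals first | exact h1.elim | exact h2.elim | exact trivial | exact lt_trans h1 h2

/-- The initial location forms an island of its own, from which only resets lead; elsewhere the rank
decreases from the header of an island to its resets. -/
theorem TransitionStructure.Valid.hasLoopFreeResets (hB : B.Valid ord J)
    (hT : B.Represents T φ) : (B.toOneATA T).HasLoopFreeResets := by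
  refine ⟨Option.map B.header, B.rankLt, ⟨?_, rfl, ?_, ?_⟩, isStrictOrder_rankLt, ?_⟩
  · rintro (_ | s)
    · rfl
    · exact congrArg some (hB.header_header s)
  · rintro (_ | s) a q hq
    · obtain ⟨q, hq', rfl⟩ := (TForm.boundLocs_map _).subset hq
      exact congrArg some (hT.bound a q hq')
    · obtain ⟨q, hq', rfl⟩ := (TForm.boundLocs_map _).subset hq
      exact congrArg some (hB.bound s a q hq').1
  · rintro (_ | s) a q hq
    · have := ((hT.isResetCombination a).map some).freeLocs_eq
      exact (this.subset hq).elim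
    · obtain ⟨q, hq', rfl⟩ := (TForm.freeLocs_map _).subset hq
      obtain ⟨h1, h2, -⟩ := hB.free s a q hq'
      exact ⟨congrArg some h1, fun h => h2 (Option.some_injective _ h)⟩
  · rintro (_ | s) a q hq
    · obtain ⟨q, hq', rfl⟩ := (TForm.boundLocs_map _).subset hq
      exact trivial
    · obtain ⟨q, hq', rfl⟩ := (TForm.boundLocs_map _).subset hq
      exact (hB.bound s a q hq').2.2

theorem TransitionStructure.Valid.isPartiallyOrdered (hB : B.Valid ord J) (ho : ord)
    (hT : B.Represents T φ) : (B.toOneATA T).IsPartiallyOrdered := by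
  refine ⟨B.rankLt, isStrictOrder_rankLt, ?_⟩
  rintro (_ | s) a
  · have hb : ∀ q ∈ ((T a).map some).boundLocs, ∃ p, q = some p := by
      intro q hq
      obtain ⟨q, -, rfl⟩ := (TForm.boundLocs_map _).subset hq
      exact ⟨q, rfl⟩
    constructor
    · rintro q (hq | hq)
      · have := ((hT.isResetCombination a).map some).freeLocs_eq
        exact (this.subset hq).elim
      · obtain ⟨p, rfl⟩ := hb q hq
        exact Or.inr trivial
    · intro h
      obtain ⟨p, hp⟩ := hb none h
      cases hp
  · constructor
    · rintro q (hq | hq)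
      · obtain ⟨q, hq', rfl⟩ := (TForm.freeLocs_map _).subset hq
        exact ((hB.free s a q hq').2.2 ho).imp_left (congrArg some)
      · obtain ⟨q, hq', rfl⟩ := (TForm.boundLocs_map _).subset hq
        exact Or.inr (hB.bound s a q hq').2.1
    · intro hq
      obtain ⟨q, hq, h⟩ := (TForm.boundLocs_map _).subset hq
      cases h
      exact lt_irrefl _ (hB.bound s a s hq).2.1

theorem TransitionStructure.Valid.guards_toOneATA (hB : B.Valid ord J)
    (hT : B.Represents T φ) (s : (B.toOneATA T).Loc) (a : Letter P) :
    ∀ g ∈ ((B.toOneATA T).δ s a).guards, J g.interval := by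
  rcases s with _ | s
  · have := ((hT.isResetCombination a).map some).guards_eq
    exact fun g hg => (this.subset hg).elim
  · exact fun g hg => hB.guards s a g ((TForm.guards_map _).subset hg)

end

theorem Formula.Within.exists_cdLfr {J : Interval → Prop} {R : RatExp (Formula P) → Prop}
    {φ : Formula P} (h : φ.Within J R) : ∃ A ∈ CDLfr P,
      (∀ s a, ∀ g ∈ (A.δ s a).guards, J g.interval) ∧ φ.language = A.language := by
  obtain ⟨B, hB, T, hT⟩ := h.exists_represents (ord := False) fun h => h.elim
  exact ⟨B.toOneATA T, ⟨hB.isConjunctiveDisjunctive hT, hB.hasLoopFreeResets hT⟩,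
    hB.guards_toOneATA hT, hT.language_eq⟩

/-- An expression with a star-free equivalent may have a position automaton with longer loops, so
the formula is first rewritten with stars on letters only. The rewriting introduces the interval
`[0, ∞)`, hence the condition on `J`. -/
theorem Formula.Within.exists_cdPO {J : Interval → Prop} (hJ : J (.ci 0)) {φ : Formula P}
    (h : φ.Within J HasStarFreeEquivalent) : ∃ A ∈ CDPO P,
      (∀ s a, ∀ g ∈ (A.δ s a).guards, J g.interval) ∧ φ.language = A.language := by
  obtain ⟨φ', hφ', heq⟩ := h.exists_isLetterStar hJ
  obtain ⟨B, hB, T, hT⟩ := hφ'.exists_represents (ord := True) fun _ _ h => h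
  refine ⟨B.toOneATA T, ⟨hB.isConjunctiveDisjunctive hT, hB.isPartiallyOrdered trivial hT⟩,
    hB.guards_toOneATA hT, hT.language_eq ▸ ?_⟩
  ext ρ
  rw [Formula.mem_language, Formula.mem_language, heq ρ 0 (Nat.zero_le _)]

section

variable [Finite P] {J : Interval → Prop} {A : OneATA P}

theorem exists_within_of_cdLfr (hJ : ∀ I : Interval, ¬ I.Punctual → J I) (hA : A ∈ CDLfr P)
    (hg : ∀ s a, ∀ g ∈ (A.δ s a).guards, J g.interval) :
    ∃ φ : Formula P, φ.Within J (fun _ => True) ∧ A.language = φ.language := by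
  obtain ⟨lt, hlt, h⟩ := hA.2.exists_order
  have := A.finite_loc
  refine OneATA.exists_formula hJ (fun step _ => ?_) hg hA.1 h
  obtain ⟨re, hre⟩ := exists_definesPaths step
  exact ⟨re, hre, fun _ _ => trivial⟩

theorem exists_within_of_cdPO (hJ : ∀ I : Interval, ¬ I.Punctual → J I) (hA : A ∈ CDPO P)
    (hg : ∀ s a, ∀ g ∈ (A.δ s a).guards, J g.interval) :
    ∃ φ : Formula P, φ.Within J RatExp.IsLetterStar ∧ A.language = φ.language := by
  obtain ⟨lt, hlt, hfree, h⟩ := hA.2.exists_order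
  have := A.finite_loc
  exact OneATA.exists_formula hJ (fun step hstep =>
    exists_definesPaths_of_isStrictOrder step fun p q hpq => hfree p q (hstep p q hpq)) hg hA.1 h

end

theorem Interval.not_punctual_ci (a : ℕ) : ¬ (Interval.ci a).Punctual := by
  rintro ⟨_, h⟩
  cases h

end ATA

/-- The four equivalences are the two translations with and without the partial order, where `J` is
either trivial or non-punctuality. -/
theorem theorem3 {P : Type*} [Finite P] :
    ATA.ExpressivelyEquivalent (ATA.CDLfr P) (ATA.FRatMTL P) ∧
    ATA.ExpressivelyEquivalent (ATA.CDPO P) (ATA.FSfrMTL P) ∧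
    ATA.ExpressivelyEquivalent (ATA.CDLfr P ∩ ATA.NPAutomata P) (ATA.FRatMITL P) ∧
    ATA.ExpressivelyEquivalent (ATA.CDPO P ∩ ATA.NPAutomata P) (ATA.FSfrMITL P) := by
  have hls : ∀ re : ATA.RatExp (ATA.Formula P), re.IsLetterStar → ATA.HasStarFreeEquivalent re :=
    fun _ h => h.hasStarFreeEquivalent
  refine ⟨⟨fun A hA => ?_, fun φ _ => ?_⟩, ⟨fun A hA => ?_, fun φ hφ => ?_⟩,
    ⟨fun A hA => ?_, fun φ hφ => ?_⟩, ⟨fun A hA => ?_, fun φ hφ => ?_⟩⟩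
  · obtain ⟨φ, -, h⟩ := ATA.exists_within_of_cdLfr (J := fun _ => True) (fun _ _ => trivial) hA
      fun _ _ _ _ => trivial
    exact ⟨φ, trivial, h⟩
  · obtain ⟨A, hA, -, h⟩ := φ.within_true.exists_cdLfr
    exact ⟨A, hA, h⟩
  · obtain ⟨φ, hφ, h⟩ := ATA.exists_within_of_cdPO (J := fun _ => True) (fun _ _ => trivial) hA
      fun _ _ _ _ => trivial
    exact ⟨φ, hφ.isSfr hls, h⟩
  · obtain ⟨A, hA, -, h⟩ := (ATA.Formula.IsSfr.within hφ).exists_cdPO trivial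
    exact ⟨A, hA, h⟩
  · obtain ⟨φ, hφ, h⟩ := ATA.exists_within_of_cdLfr (fun _ h => h) hA.1 hA.2
    exact ⟨φ, hφ.isNonPunctual fun _ h => h, h⟩
  · obtain ⟨A, hA, hg, h⟩ := (ATA.Formula.IsNonPunctual.within hφ).exists_cdLfr
    exact ⟨A, ⟨hA, hg⟩, h⟩
  · obtain ⟨φ, hφ, h⟩ := ATA.exists_within_of_cdPO (fun _ h => h) hA.1 hA.2
    exact ⟨φ, ⟨hφ.isSfr hls, hφ.isNonPunctual fun _ h => h⟩, h⟩
  · obtain ⟨A, hA, hg, h⟩ := (((ATA.Formula.IsSfr.within hφ.1).inter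
      (ATA.Formula.IsNonPunctual.within hφ.2)).mono (J' := fun I => ¬ I.Punctual)
      (R' := ATA.HasStarFreeEquivalent) (fun _ h => h.2) fun _ h => h.1).exists_cdPO
        (ATA.Interval.not_punctual_ci 0)
    exact ⟨A, ⟨hA, hg⟩, h⟩
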